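/- Let $k$ be an algebraically closed field of characteristic zero and $G$ a finite group. Let $W$ be an $n$-dimensional representation of $G$ over $k$, and let $V\subset \wedge^2 W$ be a subrepresentation of codimension $r\le n-2$ (with $n\geq 2$), such that the induced actions of $G$ on the projective spaces (of lines) $\mathbb P(W)$ and $\mathbb P(V)$ are generically free, i.e., all stabilizers are trivial on a dense open subset. Let $\mathrm{Gr}(2,W)\subset \mathbb P(\wedge^2 W)$ be the Grassmannian of planes in $W$ in its Plücker embedding, and let $X := \mathrm{Gr}(2,W)\cap \mathbb P(V)$, with its reduced structure and the induced $G$-action. Assume that $X$ is irreducible of dimension $\dim \mathrm{Gr}(2,n) - r = 2(n-2)-r$. Then the varieties $$X\times \mathbb P^1 \quad\text{and}\quad \mathbb P(W)\times \mathbb P^{n-2-r},$$ with trivial actions of $G$ on the second factors, are $G$-equivariantly birational: there are dense open $G$-stable subsets of the two varieties that are isomorphic by a $G$-equivariant isomorphism of varieties. -/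

import Mathlib

open Topology
open scoped LinearAlgebra.Projectivization

universe u v v' w w'

/-- A space with functions over a field `k`: a topological space together with a sheaf of rings of
`k`-valued functions, in which a function is invertible near every point where it does not vanish.
The sheaf is given by the relation `RegularAt f x` ("`f` is regular near `x`"), which only
depends on the germ of `f` at `x`; a function is regular on an open set when it is regular at each
of its points. Classical algebraic varieties are objects of this kind. -/
structure SpaceWithFunctions (k : Type u) [Field k] where
  carrier : Type v
  [top : TopologicalSpace carrier]
  RegularAt : (carrier → k) → carrier → Prop
  congr : ∀ {f g : carrier → k} {x : carrier}, RegularAt f x → f =ᶠ[𝓝 x] g → RegularAt g x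
  eventually : ∀ {f : carrier → k} {x : carrier}, RegularAt f x → ∀ᶠ y in 𝓝 x, RegularAt f y
  const : ∀ (c : k) (x : carrier), RegularAt (fun _ => c) x
  add : ∀ {f g : carrier → k} {x : carrier}, RegularAt f x → RegularAt g x → RegularAt (f + g) x
  mul : ∀ {f g : carrier → k} {x : carrier}, RegularAt f x → RegularAt g x → RegularAt (f * g) x
  eventually_ne : ∀ {f : carrier → k} {x : carrier}, RegularAt f x → f x ≠ 0 →
    ∀ᶠ y in 𝓝 x, f y ≠ 0
  inv : ∀ {f : carrier → k} {x : carrier}, RegularAt f x → f x ≠ 0 → RegularAt f⁻¹ x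

namespace SpaceWithFunctions

variable {k : Type u} [Field k]

instance (X : SpaceWithFunctions.{u, v} k) : TopologicalSpace X.carrier := X.top

/-- A morphism of spaces with functions: a continuous map that pulls regular functions back to
regular functions. -/
def IsMorphism (X : SpaceWithFunctions.{u, v} k) (Y : SpaceWithFunctions.{u, w} k)
    (φ : X.carrier → Y.carrier) : Prop :=
  Continuous φ ∧ ∀ (f : Y.carrier → k) (x : X.carrier), Y.RegularAt f (φ x) → X.RegularAt (f ∘ φ) x

theorem isMorphism_id (X : SpaceWithFunctions.{u, v} k) : IsMorphism X X id :=
  ⟨continuous_id, fun _ _ h => h⟩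

/-- A subset `S` of a space with functions, with the induced topology and with the functions that
are locally restrictions of regular functions of the ambient space (for a closed subset, the reduced
structure). -/
def restrict (X : SpaceWithFunctions.{u, v} k) (S : Set X.carrier) :
    SpaceWithFunctions.{u, v} k where
  carrier := S
  RegularAt f x := ∃ F : X.carrier → k, X.RegularAt F x ∧ f =ᶠ[𝓝 x] fun y => F y
  congr := by
    rintro f g x ⟨F, hF, hf⟩ hfg
    exact ⟨F, hF, hfg.symm.trans hf⟩
  eventually := by
    rintro f x ⟨F, hF, hf⟩
    filter_upwards [continuous_subtype_val.continuousAt.eventually (X.eventually hF),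
      hf.eventuallyEq_nhds] with y h1 h2
    exact ⟨F, h1, h2⟩
  const c x := ⟨fun _ => c, X.const c _, Filter.EventuallyEq.rfl⟩
  add := by
    rintro f g x ⟨F, hF, hf⟩ ⟨F', hF', hg⟩
    exact ⟨F + F', X.add hF hF', hf.add hg⟩
  mul := by
    rintro f g x ⟨F, hF, hf⟩ ⟨F', hF', hg⟩
    exact ⟨F * F', X.mul hF hF', hf.mul hg⟩
  eventually_ne := by
    rintro f x ⟨F, hF, hf⟩ hx
    have hx' : F x ≠ 0 := by rw [← hf.eq_of_nhds]; exact hx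
    filter_upwards [hf, continuous_subtype_val.continuousAt.eventually
      (X.eventually_ne hF hx')] with y h1 h2
    rw [h1]; exact h2
  inv := by
    rintro f x ⟨F, hF, hf⟩ hx
    have hx' : F x ≠ 0 := by rw [← hf.eq_of_nhds]; exact hx
    exact ⟨F⁻¹, X.inv hF hx', hf.inv⟩

/-! ### Products -/

/-- The underlying set of the product. It is a separate type because its topology is not the product
topology. -/
def ProdCarrier (X : SpaceWithFunctions.{u, v} k) (Y : SpaceWithFunctions.{u, w} k) : Type (max v w) :=
  X.carrier × Y.carrier

/-- Finite sums `∑ i, fᵢ(x) gᵢ(y)` where the `fᵢ` are regular on `U` and the `gᵢ` on `V`. -/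
def tensorFun (X : SpaceWithFunctions.{u, v} k) (Y : SpaceWithFunctions.{u, w} k)
    (U : Set X.carrier) (V : Set Y.carrier) : Submodule k (ProdCarrier X Y → k) :=
  Submodule.span k {h | ∃ (f : X.carrier → k) (g : Y.carrier → k),
    (∀ x ∈ U, X.RegularAt f x) ∧ (∀ y ∈ V, Y.RegularAt g y) ∧ h = fun z => f z.1 * g z.2}

theorem tensorFun_mono (X : SpaceWithFunctions.{u, v} k) (Y : SpaceWithFunctions.{u, w} k)
    {U U' : Set X.carrier} {V V' : Set Y.carrier} (hU : U' ⊆ U) (hV : V' ⊆ V) :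
    tensorFun X Y U V ≤ tensorFun X Y U' V' := by
  apply Submodule.span_mono
  rintro h ⟨f, g, hf, hg, rfl⟩
  exact ⟨f, g, fun x hx => hf x (hU hx), fun y hy => hg y (hV hy), rfl⟩

theorem tensorFun_const (X : SpaceWithFunctions.{u, v} k) (Y : SpaceWithFunctions.{u, w} k)
    (U : Set X.carrier) (V : Set Y.carrier) (c : k) :
    (fun _ => c) ∈ tensorFun X Y U V :=
  Submodule.subset_span ⟨fun _ => c, fun _ => 1, fun x _ => X.const c x, fun y _ => Y.const 1 y,
    by simp⟩

theorem tensorFun_mul (X : SpaceWithFunctions.{u, v} k) (Y : SpaceWithFunctions.{u, w} k)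
    {U : Set X.carrier} {V : Set Y.carrier} {a b : ProdCarrier X Y → k}
    (ha : a ∈ tensorFun X Y U V) (hb : b ∈ tensorFun X Y U V) : a * b ∈ tensorFun X Y U V := by
  refine Submodule.span_induction₂ (p := fun a b _ _ => a * b ∈ tensorFun X Y U V)
    ?_ ?_ ?_ ?_ ?_ ?_ ?_ ha hb
  · rintro _ _ ⟨f, g, hf, hg, rfl⟩ ⟨f', g', hf', hg', rfl⟩
    refine Submodule.subset_span ⟨f * f', g * g', fun x hx => X.mul (hf x hx) (hf' x hx),
      fun y hy => Y.mul (hg y hy) (hg' y hy), ?_⟩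
    funext z
    simp only [Pi.mul_apply]
    ring
  · intro y _; simp
  · intro x _; simp
  · intro x y z _ _ _ h1 h2; rw [add_mul]; exact Submodule.add_mem _ h1 h2
  · intro x y z _ _ _ h1 h2; rw [mul_add]; exact Submodule.add_mem _ h1 h2
  · intro r x y _ _ h; rw [smul_mul_assoc]; exact Submodule.smul_mem _ r h
  · intro r x y _ _ h; rw [mul_smul_comm]; exact Submodule.smul_mem _ r h

/-- The basic open set `{(x, y) ∈ U × V | h(x, y) ≠ 0}` of a product. -/
def prodBasicOpen (X : SpaceWithFunctions.{u, v} k) (Y : SpaceWithFunctions.{u, w} k)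
    (U : Set X.carrier) (V : Set Y.carrier) (h : ProdCarrier X Y → k) :
    Set (ProdCarrier X Y) :=
  {z | z.1 ∈ U ∧ z.2 ∈ V ∧ h z ≠ 0}

/-- The (Zariski) topology of the product of two spaces with functions: it is generated by the sets
`{(x, y) ∈ U × V | ∑ i, fᵢ(x) gᵢ(y) ≠ 0}` with `U`, `V` open and `fᵢ`, `gᵢ` regular on them. -/
instance prodTopology (X : SpaceWithFunctions.{u, v} k) (Y : SpaceWithFunctions.{u, w} k) :
    TopologicalSpace (ProdCarrier X Y) :=
  TopologicalSpace.generateFrom {D | ∃ (U : Set X.carrier) (V : Set Y.carrier)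
    (h : ProdCarrier X Y → k), IsOpen U ∧ IsOpen V ∧ h ∈ tensorFun X Y U V ∧
      D = prodBasicOpen X Y U V h}

theorem prodBasicOpen_mem_nhds (X : SpaceWithFunctions.{u, v} k)
    (Y : SpaceWithFunctions.{u, w} k) {U : Set X.carrier} {V : Set Y.carrier}
    {h : ProdCarrier X Y → k} (hU : IsOpen U) (hV : IsOpen V) (hh : h ∈ tensorFun X Y U V)
    {z : ProdCarrier X Y} (hz : z ∈ prodBasicOpen X Y U V h) :
    prodBasicOpen X Y U V h ∈ 𝓝 z :=
  IsOpen.mem_nhds (TopologicalSpace.isOpen_generateFrom_of_mem ⟨U, V, h, hU, hV, hh, rfl⟩) hz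

/-- A function on the product is regular at `z` if near `z` it is a quotient `a / b`, `b(z) ≠ 0`,
of sums of products of regular functions of the factors. -/
def ProdRegularAt (X : SpaceWithFunctions.{u, v} k) (Y : SpaceWithFunctions.{u, w} k)
    (h : ProdCarrier X Y → k) (z : ProdCarrier X Y) : Prop :=
  ∃ (U : Set X.carrier) (V : Set Y.carrier) (a b : ProdCarrier X Y → k),
    IsOpen U ∧ IsOpen V ∧ z.1 ∈ U ∧ z.2 ∈ V ∧ a ∈ tensorFun X Y U V ∧ b ∈ tensorFun X Y U V ∧
      b z ≠ 0 ∧ h =ᶠ[𝓝 z] fun y => a y / b y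

/-- The product of two spaces with functions; on classical varieties this is the usual product. -/
def prod (X : SpaceWithFunctions.{u, v} k) (Y : SpaceWithFunctions.{u, w} k) :
    SpaceWithFunctions.{u, max v w} k where
  carrier := ProdCarrier X Y
  RegularAt := ProdRegularAt X Y
  congr := by
    rintro f g z ⟨U, V, a, b, hU, hV, h1, h2, ha, hb, hbz, hf⟩ hfg
    exact ⟨U, V, a, b, hU, hV, h1, h2, ha, hb, hbz, hfg.symm.trans hf⟩
  eventually := by
    rintro f z ⟨U, V, a, b, hU, hV, h1, h2, ha, hb, hbz, hf⟩
    filter_upwards [prodBasicOpen_mem_nhds X Y hU hV hb ⟨h1, h2, hbz⟩,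
      hf.eventuallyEq_nhds] with y hy hy'
    exact ⟨U, V, a, b, hU, hV, hy.1, hy.2.1, ha, hb, hy.2.2, hy'⟩
  const c z := ⟨Set.univ, Set.univ, fun _ => c, fun _ => 1, isOpen_univ, isOpen_univ, trivial,
    trivial, tensorFun_const X Y _ _ c, tensorFun_const X Y _ _ 1, one_ne_zero, by simp⟩
  add := by
    rintro f g z ⟨U, V, a, b, hU, hV, h1, h2, ha, hb, hbz, hf⟩
      ⟨U', V', a', b', hU', hV', h1', h2', ha', hb', hbz', hg⟩
    have ha := tensorFun_mono X Y (Set.inter_subset_left (t := U'))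
      (Set.inter_subset_left (t := V')) ha
    have hb := tensorFun_mono X Y (Set.inter_subset_left (t := U'))
      (Set.inter_subset_left (t := V')) hb
    have ha' := tensorFun_mono X Y (Set.inter_subset_right (s := U))
      (Set.inter_subset_right (s := V)) ha'
    have hb' := tensorFun_mono X Y (Set.inter_subset_right (s := U))
      (Set.inter_subset_right (s := V)) hb'
    have hbb := tensorFun_mul X Y hb hb'
    refine ⟨U ∩ U', V ∩ V', a * b' + b * a', b * b', hU.inter hU', hV.inter hV', ⟨h1, h1'⟩,
      ⟨h2, h2'⟩, Submodule.add_mem _ (tensorFun_mul X Y ha hb') (tensorFun_mul X Y hb ha'),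
      hbb, mul_ne_zero hbz hbz', ?_⟩
    filter_upwards [hf, hg, prodBasicOpen_mem_nhds X Y (hU.inter hU') (hV.inter hV') hbb
      ⟨⟨h1, h1'⟩, ⟨h2, h2'⟩, mul_ne_zero hbz hbz'⟩] with y hy hy' hn
    have hn := hn.2.2
    simp only [Pi.mul_apply, Pi.add_apply] at hn ⊢
    rw [hy, hy', div_add_div _ _ (left_ne_zero_of_mul hn) (right_ne_zero_of_mul hn)]
  mul := by
    rintro f g z ⟨U, V, a, b, hU, hV, h1, h2, ha, hb, hbz, hf⟩
      ⟨U', V', a', b', hU', hV', h1', h2', ha', hb', hbz', hg⟩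
    have ha := tensorFun_mono X Y (Set.inter_subset_left (t := U'))
      (Set.inter_subset_left (t := V')) ha
    have hb := tensorFun_mono X Y (Set.inter_subset_left (t := U'))
      (Set.inter_subset_left (t := V')) hb
    have ha' := tensorFun_mono X Y (Set.inter_subset_right (s := U))
      (Set.inter_subset_right (s := V)) ha'
    have hb' := tensorFun_mono X Y (Set.inter_subset_right (s := U))
      (Set.inter_subset_right (s := V)) hb'
    refine ⟨U ∩ U', V ∩ V', a * a', b * b', hU.inter hU', hV.inter hV', ⟨h1, h1'⟩,
      ⟨h2, h2'⟩, tensorFun_mul X Y ha ha', tensorFun_mul X Y hb hb', mul_ne_zero hbz hbz', ?_⟩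
    filter_upwards [hf, hg] with y hy hy'
    simp only [Pi.mul_apply]
    rw [hy, hy', div_mul_div_comm]
  eventually_ne := by
    rintro f z ⟨U, V, a, b, hU, hV, h1, h2, ha, hb, hbz, hf⟩ hz
    have hfz : f z = a z / b z := hf.eq_of_nhds
    have haz : a z ≠ 0 := by
      intro h0; rw [hfz, h0, zero_div] at hz; exact hz rfl
    filter_upwards [hf, prodBasicOpen_mem_nhds X Y hU hV ha ⟨h1, h2, haz⟩,
      prodBasicOpen_mem_nhds X Y hU hV hb ⟨h1, h2, hbz⟩] with y hy hy1 hy2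
    rw [hy]
    exact div_ne_zero hy1.2.2 hy2.2.2
  inv := by
    rintro f z ⟨U, V, a, b, hU, hV, h1, h2, ha, hb, hbz, hf⟩ hz
    have hfz : f z = a z / b z := hf.eq_of_nhds
    have haz : a z ≠ 0 := by
      intro h0; rw [hfz, h0, zero_div] at hz; exact hz rfl
    refine ⟨U, V, b, a, hU, hV, h1, h2, hb, ha, haz, ?_⟩
    filter_upwards [hf] with y hy
    rw [Pi.inv_apply, hy, inv_div]

theorem prod_morphism {X : SpaceWithFunctions.{u, v} k} {X' : SpaceWithFunctions.{u, v'} k}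
    {Y : SpaceWithFunctions.{u, w} k} {Y' : SpaceWithFunctions.{u, w'} k}
    {φ : X.carrier → X'.carrier} {ψ : Y.carrier → Y'.carrier} (hφ : IsMorphism X X' φ)
    (hψ : IsMorphism Y Y' ψ) :
    IsMorphism (X.prod Y) (X'.prod Y') (fun z : ProdCarrier X Y => ((φ z.1, ψ z.2) : ProdCarrier X' Y')) := by
  let Φ : ProdCarrier X Y → ProdCarrier X' Y' := fun z => (φ z.1, ψ z.2)
  have key : ∀ {U V a}, a ∈ tensorFun X' Y' U V →
      a ∘ Φ ∈ tensorFun X Y (φ ⁻¹' U) (ψ ⁻¹' V) := by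
    intro U V a ha
    refine Submodule.span_induction (p := fun a _ => a ∘ Φ ∈
      tensorFun X Y (φ ⁻¹' U) (ψ ⁻¹' V)) ?_ ?_ ?_ ?_ ha
    · rintro _ ⟨f, g, hf, hg, rfl⟩
      exact Submodule.subset_span ⟨f ∘ φ, g ∘ ψ, fun x hx => hφ.2 f x (hf _ hx),
        fun y hy => hψ.2 g y (hg _ hy), rfl⟩
    · exact Submodule.zero_mem _
    · intro x y _ _ h1 h2; exact Submodule.add_mem _ h1 h2
    · intro r x _ h; exact Submodule.smul_mem _ r h
  have hc : Continuous Φ := by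
    refine continuous_generateFrom_iff.2 ?_
    rintro _ ⟨U, V, h, hU, hV, hh, rfl⟩
    exact TopologicalSpace.isOpen_generateFrom_of_mem
      ⟨φ ⁻¹' U, ψ ⁻¹' V, h ∘ Φ, hU.preimage hφ.1, hV.preimage hψ.1, key hh, rfl⟩
  refine ⟨hc, ?_⟩
  rintro f z ⟨U, V, a, b, hU, hV, h1, h2, ha, hb, hbz, hf⟩
  exact ⟨φ ⁻¹' U, ψ ⁻¹' V, a ∘ Φ, b ∘ Φ, hU.preimage hφ.1,
    hV.preimage hψ.1, h1, h2, key ha, key hb, hbz, hc.continuousAt.eventually hf⟩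

end SpaceWithFunctions

/-! ### Projective space -/

section Projective

variable {k : Type u} [Field k] {A : Type v} [AddCommGroup A] [Module k A]

/-- The value at `a : A` of a polynomial `p` in linear forms on `A`, that is, of a polynomial
function on the vector space `A`. -/
noncomputable def formEval (p : MvPolynomial (Module.Dual k A) k) (a : A) : k :=
  MvPolynomial.eval (fun l : Module.Dual k A => l a) p

theorem formEval_smul {p : MvPolynomial (Module.Dual k A) k} {d : ℕ} (hp : p.IsHomogeneous d)
    (c : k) (a : A) : formEval p (c • a) = c ^ d * formEval p a := by
  simp only [formEval, MvPolynomial.eval_eq, Finset.mul_sum]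
  refine Finset.sum_congr rfl fun m hm => ?_
  have hd : ∑ i ∈ m.support, m i = d := by
    have := hp (MvPolynomial.mem_support_iff.1 hm)
    simpa [Finsupp.weight_apply, Finsupp.sum] using this
  simp only [map_smul, smul_eq_mul, mul_pow, Finset.prod_mul_distrib,
    Finset.prod_pow_eq_pow_sum, hd]
  ring

theorem formEval_rename {B : Type w} [AddCommGroup B] [Module k B] (T : A →ₗ[k] B)
    (p : MvPolynomial (Module.Dual k B) k) (a : A) :
    formEval (MvPolynomial.rename (fun l : Module.Dual k B => l ∘ₗ T) p) a = formEval p (T a) := by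
  simp only [formEval, MvPolynomial.eval_rename]
  rfl

theorem formEval_mk_rep {p : MvPolynomial (Module.Dual k A) k} {d : ℕ} (hp : p.IsHomogeneous d)
    {a : A} (ha : a ≠ 0) :
    ∃ c : kˣ, formEval p (Projectivization.mk k a ha).rep = (c : k) ^ d * formEval p a := by
  obtain ⟨c, hc⟩ := Projectivization.exists_smul_eq_mk_rep k a ha
  exact ⟨c, by rw [← hc, Units.smul_def, formEval_smul hp]⟩

/-- The complement in the projective space of lines in `A` of the zero locus of a form. (For
homogeneous `p` the choice of the representative does not matter.) -/
def projBasicOpen (p : MvPolynomial (Module.Dual k A) k) : Set (ℙ k A) :=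
  {x | formEval p x.rep ≠ 0}

/-- The Zariski topology on projective space, generated by the complements of the zero loci of
homogeneous polynomials. -/
instance zariskiTopology : TopologicalSpace (ℙ k A) :=
  TopologicalSpace.generateFrom {D | ∃ (p : MvPolynomial (Module.Dual k A) k) (d : ℕ),
    p.IsHomogeneous d ∧ D = projBasicOpen p}

theorem projBasicOpen_mem_nhds {p : MvPolynomial (Module.Dual k A) k} {d : ℕ}
    (hp : p.IsHomogeneous d) {x : ℙ k A} (hx : formEval p x.rep ≠ 0) :
    projBasicOpen p ∈ 𝓝 x :=
  IsOpen.mem_nhds (TopologicalSpace.isOpen_generateFrom_of_mem ⟨p, d, hp, rfl⟩) hx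

/-- A function on projective space is regular at `x` if near `x` it is a quotient `p / q` of
two homogeneous polynomials of the same degree with `q(x) ≠ 0`. -/
def ProjRegularAt (f : ℙ k A → k) (x : ℙ k A) : Prop :=
  ∃ (d : ℕ) (p q : MvPolynomial (Module.Dual k A) k), p.IsHomogeneous d ∧ q.IsHomogeneous d ∧
    formEval q x.rep ≠ 0 ∧
      f =ᶠ[𝓝 x] fun y => formEval p y.rep / formEval q y.rep

variable (k A) in
/-- The projective space of lines in the vector space `A`, as a classical algebraic variety. -/
def projSpace : SpaceWithFunctions.{u, v} k where
  carrier := ℙ k A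
  RegularAt := ProjRegularAt
  congr := by
    rintro f g x ⟨d, p, q, hp, hq, hx, hf⟩ hfg
    exact ⟨d, p, q, hp, hq, hx, hfg.symm.trans hf⟩
  eventually := by
    rintro f x ⟨d, p, q, hp, hq, hx, hf⟩
    filter_upwards [projBasicOpen_mem_nhds hq hx,
      hf.eventuallyEq_nhds] with y h1 h2
    exact ⟨d, p, q, hp, hq, h1, h2⟩
  const c x := ⟨0, MvPolynomial.C c, MvPolynomial.C 1, MvPolynomial.isHomogeneous_C _ _,
    MvPolynomial.isHomogeneous_C _ _, by simp [formEval], by simp [formEval]⟩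
  add := by
    rintro f g x ⟨d, p, q, hp, hq, hx, hf⟩ ⟨d', p', q', hp', hq', hx', hg⟩
    refine ⟨d + d', p * q' + q * p', q * q', (hp.mul hq').add (hq.mul hp'), hq.mul hq',
      by simpa [formEval] using ⟨hx, hx'⟩, ?_⟩
    filter_upwards [hf, hg, projBasicOpen_mem_nhds hq hx, projBasicOpen_mem_nhds hq' hx']
      with y h1 h2 h3 h4
    simp only [projBasicOpen, Set.mem_ofPred_eq, formEval] at h1 h2 h3 h4
    simp only [Pi.add_apply, h1, h2, formEval, map_add, map_mul]
    rw [div_add_div _ _ h3 h4]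
  mul := by
    rintro f g x ⟨d, p, q, hp, hq, hx, hf⟩ ⟨d', p', q', hp', hq', hx', hg⟩
    refine ⟨d + d', p * p', q * q', hp.mul hp', hq.mul hq',
      by simpa [formEval] using ⟨hx, hx'⟩, ?_⟩
    filter_upwards [hf, hg] with y h1 h2
    simp only [Pi.mul_apply, h1, h2, formEval, map_mul]
    rw [div_mul_div_comm]
  eventually_ne := by
    rintro f x ⟨d, p, q, hp, hq, hx, hf⟩ hz
    have hfx : f x = formEval p x.rep / formEval q x.rep :=
      hf.eq_of_nhds
    have hpx : formEval p x.rep ≠ 0 := by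
      intro h0; rw [hfx, h0, zero_div] at hz; exact hz rfl
    filter_upwards [hf, projBasicOpen_mem_nhds hq hx, projBasicOpen_mem_nhds hp hpx]
      with y h1 h2 h3
    rw [h1]; exact div_ne_zero h3 h2
  inv := by
    rintro f x ⟨d, p, q, hp, hq, hx, hf⟩ hz
    have hfx : f x = formEval p x.rep / formEval q x.rep :=
      hf.eq_of_nhds
    have hpx : formEval p x.rep ≠ 0 := by
      intro h0; rw [hfx, h0, zero_div] at hz; exact hz rfl
    refine ⟨d, q, p, hq, hp, hpx, ?_⟩
    filter_upwards [hf] with y h1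
    rw [Pi.inv_apply, h1, inv_div]

theorem projSpace_map_morphism {B : Type w} [AddCommGroup B] [Module k B] (T : A →ₗ[k] B)
    (hT : Function.Injective T) :
    SpaceWithFunctions.IsMorphism (projSpace k A) (projSpace k B) (Projectivization.map T hT) := by
  have key : ∀ {d : ℕ} {p : MvPolynomial (Module.Dual k B) k}, p.IsHomogeneous d →
      ∀ x : ℙ k A, ∃ c : kˣ, ∀ {p : MvPolynomial (Module.Dual k B) k} {d : ℕ},
        p.IsHomogeneous d → formEval p (Projectivization.map T hT x).rep =
        (c : k) ^ d * formEval (MvPolynomial.rename (fun l : Module.Dual k B => l ∘ₗ T) p) x.rep := by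
    intro _ _ _ x
    have hx : Projectivization.map T hT x = Projectivization.mk k (T x.rep)
        ((map_ne_zero_iff T hT).2 x.rep_nonzero) := by
      conv_lhs => rw [← x.mk_rep]
      rw [Projectivization.map_mk]
    rw [hx]
    obtain ⟨c, hc⟩ := Projectivization.exists_smul_eq_mk_rep k (T x.rep)
      ((map_ne_zero_iff T hT).2 x.rep_nonzero)
    refine ⟨c, fun {p d} hp => ?_⟩
    rw [← hc, Units.smul_def, formEval_smul hp, formEval_rename]
  have hc : Continuous (Projectivization.map T hT) := by
    refine continuous_generateFrom_iff.2 ?_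
    rintro _ ⟨p, d, hp, rfl⟩
    refine TopologicalSpace.isOpen_generateFrom_of_mem
      ⟨MvPolynomial.rename (fun l : Module.Dual k B => l ∘ₗ T) p, d, hp.rename_isHomogeneous, ?_⟩
    ext x
    obtain ⟨c, hc⟩ := key hp x
    simp [projBasicOpen, hc hp]
  refine ⟨hc, ?_⟩
  rintro f x ⟨d, p, q, hp, hq, hx, hf⟩
  refine ⟨d, MvPolynomial.rename (fun l : Module.Dual k B => l ∘ₗ T) p,
    MvPolynomial.rename (fun l : Module.Dual k B => l ∘ₗ T) q, hp.rename_isHomogeneous,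
    hq.rename_isHomogeneous, ?_, ?_⟩
  · obtain ⟨c, hc⟩ := key hp x
    rw [hc hq] at hx
    exact right_ne_zero_of_mul hx
  · filter_upwards [hc.continuousAt.eventually hf] with y hy
    obtain ⟨c, hc⟩ := key hp y
    change f (Projectivization.map T hT y) = _
    rw [hy, hc hp, hc hq, mul_div_mul_left _ _ (pow_ne_zero _ c.ne_zero)]

end Projective

/-! ### Group actions -/

/-- A space with functions with a regular action of the group `G`. -/
structure GSpace (k : Type u) [Field k] (G : Type w) [Group G] extends
    SpaceWithFunctions.{u, v} k where
  [action : MulAction G carrier]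
  regular_smul : ∀ g : G, SpaceWithFunctions.IsMorphism toSpaceWithFunctions toSpaceWithFunctions
    (fun x => g • x)

namespace GSpace

variable {k : Type u} [Field k] {G : Type w} [Group G]

instance (X : GSpace.{u, v, w} k G) : MulAction G X.carrier := X.action

/-- The action is generically free: stabilizers are trivial on a dense open subset. -/
def GenericallyFree (X : GSpace.{u, v, w} k G) : Prop :=
  ∃ U : Set X.carrier, IsOpen U ∧ Dense U ∧ ∀ x ∈ U, ∀ g : G, g • x = x → g = 1

/-- A `G`-stable subset, with the induced structure. -/
def restrict (X : GSpace.{u, v, w} k G) (S : Set X.carrier)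
    (hS : ∀ (g : G), ∀ x ∈ S, g • x ∈ S) : GSpace.{u, v, w} k G where
  toSpaceWithFunctions := X.toSpaceWithFunctions.restrict S
  action :=
    { smul := fun g x => ⟨g • x.1, hS g x.1 x.2⟩
      one_smul := fun x => Subtype.ext (one_smul G x.1)
      mul_smul := fun g h x => Subtype.ext (mul_smul g h x.1) }
  regular_smul g := by
    have hc : Continuous (fun x : S => (⟨g • x.1, hS g x.1 x.2⟩ : S)) :=
      ((X.regular_smul g).1.comp continuous_subtype_val).subtype_mk _
    refine ⟨hc, ?_⟩
    rintro f x ⟨F, hF, hf⟩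
    exact ⟨fun y => F (g • y), (X.regular_smul g).2 F x.1 hF, hc.continuousAt.eventually hf⟩

/-- The product of two `G`-spaces, with the diagonal action. -/
def prod (X : GSpace.{u, v, w} k G) (Y : GSpace.{u, v', w} k G) :
    GSpace.{u, max v v', w} k G where
  toSpaceWithFunctions := X.toSpaceWithFunctions.prod Y.toSpaceWithFunctions
  action :=
    { smul := fun g (z : X.ProdCarrier Y.toSpaceWithFunctions) =>
        ((g • z.1, g • z.2) : X.ProdCarrier Y.toSpaceWithFunctions)
      one_smul := fun (z : X.ProdCarrier Y.toSpaceWithFunctions) => Prod.ext (one_smul G z.1) (one_smul G z.2)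
      mul_smul := fun g h (z : X.ProdCarrier Y.toSpaceWithFunctions) =>
        Prod.ext (mul_smul g h z.1) (mul_smul g h z.2) }
  regular_smul g := SpaceWithFunctions.prod_morphism (X.regular_smul g) (Y.regular_smul g)

/-- `X` and `Y` are `G`-equivariantly birational: some dense open `G`-stable subsets are
isomorphic by a `G`-equivariant isomorphism. -/
def EquivariantlyBirational (X : GSpace.{u, v, w} k G) (Y : GSpace.{u, v', w} k G) : Prop :=
  ∃ (U : Set X.carrier) (V : Set Y.carrier)
    (hU : ∀ (g : G), ∀ x ∈ U, g • x ∈ U) (hV : ∀ (g : G), ∀ y ∈ V, g • y ∈ V)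
    (e : (X.restrict U hU).carrier ≃ (Y.restrict V hV).carrier),
    IsOpen U ∧ Dense U ∧ IsOpen V ∧ Dense V ∧
    SpaceWithFunctions.IsMorphism (X.restrict U hU).toSpaceWithFunctions
      (Y.restrict V hV).toSpaceWithFunctions e ∧
    SpaceWithFunctions.IsMorphism (Y.restrict V hV).toSpaceWithFunctions
      (X.restrict U hU).toSpaceWithFunctions e.symm ∧
    ∀ (g : G) (x : (X.restrict U hU).carrier), e (g • x) = g • e x

end GSpace

section Representations

variable {k : Type u} [Field k] {G : Type w} [Group G] {A : Type v} [AddCommGroup A] [Module k A]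

theorem representation_injective (ρ : Representation k G A) (g : G) :
    Function.Injective (ρ g) := (ρ.apply_bijective g).1

/-- The projective space `ℙ(A)` of lines in a representation `A` of `G`, with the induced action. -/
def projRep (ρ : Representation k G A) : GSpace.{u, v, w} k G where
  toSpaceWithFunctions := projSpace k A
  action :=
    { smul := fun g x => Projectivization.map (ρ g) (representation_injective ρ g) x
      one_smul := fun x => by
        change Projectivization.map (ρ 1) _ x = x
        induction x using Projectivization.ind with | h a ha =>
        simp [Projectivization.map_mk]
      mul_smul := fun g h x => by
        change Projectivization.map (ρ (g * h)) _ x =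
          Projectivization.map (ρ g) _ (Projectivization.map (ρ h) _ x)
        induction x using Projectivization.ind with | h a ha =>
        simp [Projectivization.map_mk] }
  regular_smul g := projSpace_map_morphism (ρ g) (representation_injective ρ g)

variable (k G) in
/-- The projective space `ℙ^m` with the trivial action of `G`. -/
def projTrivial (m : ℕ) : GSpace.{u, u, w} k G :=
  projRep (Representation.trivial k G (Fin (m + 1) → k))

/-- The representation `⋀² A`. -/
noncomputable def exteriorSquare (ρ : Representation k G A) : Representation k G (⋀[k]^2 A) where
  toFun g := exteriorPower.map 2 (ρ g)
  map_one' := by rw [map_one]; exact exteriorPower.map_id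
  map_mul' g h := by rw [map_mul]; exact exteriorPower.map_comp (n := 2) (ρ h) (ρ g)

variable (k A) in
/-- The Grassmannian of planes in `A`, in its Plücker embedding: the lines in `⋀² A` spanned by
`a ∧ b` with `a`, `b` linearly independent. -/
def grassmannian : Set (ℙ k (⋀[k]^2 A)) :=
  {x | ∃ a : Fin 2 → A, LinearIndependent k a ∧
    x.submodule = Submodule.span k {exteriorPower.ιMulti k 2 a}}

/-- The linear subspace `ℙ(V)` of `ℙ(A)` for a subspace `V` of `A`. -/
def projSubspace (V : Submodule k A) : Set (ℙ k A) := {x | x.submodule ≤ V}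

theorem grassmannian_section_stable (ρ : Representation k G A)
    (V : Subrepresentation (exteriorSquare ρ)) (g : G) :
    ∀ x ∈ (grassmannian k A ∩ projSubspace V.toSubmodule :
        Set (projRep (exteriorSquare ρ)).carrier),
      g • x ∈ (grassmannian k A ∩ projSubspace V.toSubmodule :
        Set (projRep (exteriorSquare ρ)).carrier) := by
  rintro x ⟨⟨a, ha, hxa⟩, hxV⟩
  have hsub : Projectivization.submodule (g • x : (projRep (exteriorSquare ρ)).carrier) =
      (Projectivization.submodule x).map (exteriorSquare ρ g) := by
    change Projectivization.submodule (Projectivization.map (exteriorSquare ρ g) _ x) = _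
    clear hxa hxV
    induction x using Projectivization.ind with | h y hy =>
    rw [Projectivization.map_mk, Projectivization.submodule_mk, Projectivization.submodule_mk,
      Submodule.map_span, Set.image_singleton]
  refine ⟨⟨ρ g ∘ a, ha.map' _ (LinearMap.ker_eq_bot.2 (representation_injective ρ g)), ?_⟩, ?_⟩
  · rw [hsub, hxa, Submodule.map_span, Set.image_singleton]
    congr 2
    exact exteriorPower.map_apply_ιMulti (ρ g) a
  · change Projectivization.submodule (g • x : (projRep (exteriorSquare ρ)).carrier) ≤ _
    rw [hsub, Submodule.map_le_iff_le_comap]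
    exact fun y hy => V.apply_mem_toSubmodule g (hxV hy)

/-- The linear section `Gr(2, A) ∩ ℙ(V)` of the Grassmannian for a subrepresentation `V ⊆ ⋀² A`, as a
`G`-stable subset of `ℙ(⋀² A)` with its reduced structure. -/
noncomputable def grassmannianSection (ρ : Representation k G A) (V : Subrepresentation (exteriorSquare ρ)) :
    GSpace.{u, max u v, w} k G :=
  (projRep (exteriorSquare ρ)).restrict (grassmannian k A ∩ projSubspace V.toSubmodule)
    (grassmannian_section_stable ρ V)

end Representations

/-! A point of `X` is a line in `ℙ(W)`. Consider the incidence variety of pairs `(x, y)` with `x ∈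
X` and `y` a point of the line `x`. Over `X` it is a `ℙ¹`-bundle, the projectivized tautological
plane bundle. Over `y = [w]` its fibre is the projectivization of `K_w / ⟨w⟩`, where `K_w` is the
kernel of `x ↦ w ∧ x mod V` (`wedgeMod`). Always `dim K_w ≥ n - r`. If the least value of `dim K_w`
is `m + 2`, then `dim X ≥ m + (n - 2)` (`le_topologicalKrullDim_grassmannianSection`), so the
hypothesis on `dim X` forces `dim K_w = n - r` for generic `w`, and the generic fibre is
`ℙ^(n-2-r)`. It remains to trivialize both bundles equivariantly over dense open sets.

This is the no-name lemma: over a base with generically free action, an equivariant vector bundle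
has generically a frame of invariant sections. Polynomial sections of `K_w` come from Cramer's rule
(`exists_formMap_ker`), those of the tautological plane from contraction with linear forms.
Multiplying a section by a form that vanishes on the rest of the orbit of a free point
(`exists_form_orbit`) and averaging makes it equivariant without changing its value at that point.
Bundles are never constructed: the relation `IsComb` says that a point is a combination of the
values of polynomial maps, and `equivariantlyBirational_of_isComb` turns two mutually inverse
families of this kind into a birational equivalence.

Freeness on `ℙ(W)` is given; a free point of `X` has to be found (`exists_free_point`). If `g ≠ 1`
fixed `X` pointwise, irreducibility would place `X` in one eigenspace of `⋀² g`. Then every plane of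
`X` is `g`-stable, so the only plane of `X` through a non-eigenvector `w` is `⟨w, g w⟩`. Hence,
unless `g` is scalar on `W`, one has `r = n - 2`, `g` has exactly two eigenspaces `A` and `B`, and
an eigenvalue argument (`finrank_le_two_of_alternating`) bounds their dimensions by 2. This gives `V
⊆ A ∧ B`, so `g` is scalar on `V` (`map_eq_smul_of_forall_wedge`). Generic freeness on `ℙ(W)` and on
`ℙ(V)` excludes the two cases. -/

/-! ### Forms -/

section Forms

variable {k : Type*} [Field k] {A B C : Type*} [AddCommGroup A] [Module k A]
  [AddCommGroup B] [Module k B] [AddCommGroup C] [Module k C]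

/-- The function `f` on the vector space `A` is given by a homogeneous polynomial of degree `d`. -/
def IsForm (d : ℕ) (f : A → k) : Prop :=
  ∃ p : MvPolynomial (Module.Dual k A) k, p.IsHomogeneous d ∧ ∀ a, f a = formEval p a

theorem isForm_const (c : k) : IsForm 0 (fun _ : A => c) :=
  ⟨MvPolynomial.C c, MvPolynomial.isHomogeneous_C _ _, by simp [formEval]⟩

theorem isForm_zero (d : ℕ) : IsForm d (fun _ : A => (0 : k)) :=
  ⟨0, MvPolynomial.isHomogeneous_zero _ _ _, by simp [formEval]⟩

theorem isForm_linear (l : A →ₗ[k] k) : IsForm 1 (fun a => l a) :=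
  ⟨MvPolynomial.X l, MvPolynomial.isHomogeneous_X _ _, by simp [formEval]⟩

namespace IsForm

variable {d e : ℕ} {f g : A → k}

theorem add (hf : IsForm d f) (hg : IsForm d g) : IsForm d (fun a => f a + g a) := by
  obtain ⟨p, hp, hp'⟩ := hf
  obtain ⟨q, hq, hq'⟩ := hg
  exact ⟨p + q, hp.add hq, by simp [formEval, hp', hq']⟩

theorem mul (hf : IsForm d f) (hg : IsForm e g) : IsForm (d + e) (fun a => f a * g a) := by
  obtain ⟨p, hp, hp'⟩ := hf
  obtain ⟨q, hq, hq'⟩ := hg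
  exact ⟨p * q, hp.mul hq, by simp [formEval, hp', hq']⟩

theorem const_mul (c : k) (hf : IsForm d f) : IsForm d (fun a => c * f a) := by
  simpa using (isForm_const c).mul hf

theorem sum {ι : Type*} (s : Finset ι) {f : ι → A → k} (hf : ∀ i ∈ s, IsForm d (f i)) :
    IsForm d (fun a => ∑ i ∈ s, f i a) := by
  classical
  induction s using Finset.induction_on with
  | empty => simpa using isForm_zero d
  | insert i s hi ih =>
    simp only [Finset.sum_insert hi]
    exact (hf i (s.mem_insert_self i)).add (ih fun j hj => hf j (Finset.mem_insert_of_mem hj))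

theorem prod {ι : Type*} (s : Finset ι) {d : ι → ℕ} {f : ι → A → k}
    (hf : ∀ i ∈ s, IsForm (d i) (f i)) :
    IsForm (∑ i ∈ s, d i) (fun a => ∏ i ∈ s, f i a) := by
  classical
  induction s using Finset.induction_on with
  | empty => simpa using isForm_const (A := A) (1 : k)
  | insert i s hi ih =>
    simp only [Finset.sum_insert hi, Finset.prod_insert hi]
    exact (hf i (s.mem_insert_self i)).mul (ih fun j hj => hf j (Finset.mem_insert_of_mem hj))

theorem map_smul (hf : IsForm d f) (c : k) (a : A) : f (c • a) = c ^ d * f a := by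
  obtain ⟨p, hp, hp'⟩ := hf
  rw [hp', hp', formEval_smul hp]

end IsForm

/-- The determinant of a matrix of forms, the entries of the column `i` having degree `d i`. -/
theorem isForm_det {ι : Type*} [Fintype ι] [DecidableEq ι] {d : ι → ℕ} {M : A → Matrix ι ι k}
    (hM : ∀ i j, IsForm (d j) (fun a => M a i j)) : IsForm (∑ j, d j) (fun a => (M a).det) := by
  simp only [Matrix.det_apply', ]
  refine IsForm.sum _ fun σ _ => ?_
  exact (IsForm.prod _ fun i _ => hM (σ i) i).const_mul _

/-- The map `σ : A → B` of vector spaces is given by homogeneous polynomials of degree `d`. -/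
def IsFormMap (k : Type*) [Field k] {A B : Type*} [AddCommGroup A] [Module k A] [AddCommGroup B]
    [Module k B] (d : ℕ) (σ : A → B) : Prop :=
  ∀ l : Module.Dual k B, IsForm d (fun a => l (σ a))

theorem isFormMap_linear (T : A →ₗ[k] B) : IsFormMap k 1 (fun a => T a) :=
  fun l => isForm_linear (l ∘ₗ T)

namespace IsFormMap

variable {d e : ℕ} {σ τ : A → B} {f : A → k}

theorem add (hσ : IsFormMap k d σ) (hτ : IsFormMap k d τ) : IsFormMap k d (fun a => σ a + τ a) :=
  fun l => by simpa using (hσ l).add (hτ l)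

theorem smul (hf : IsForm d f) (hσ : IsFormMap k e σ) :
    IsFormMap k (d + e) (fun a => f a • σ a) :=
  fun l => by simpa using hf.mul (hσ l)

theorem sum {ι : Type*} (s : Finset ι) {σ : ι → A → B} (hσ : ∀ i ∈ s, IsFormMap k d (σ i)) :
    IsFormMap k d (fun a => ∑ i ∈ s, σ i a) :=
  fun l => by simpa using IsForm.sum s fun i hi => hσ i hi l

theorem linear_comp (hσ : IsFormMap k d σ) (T : B →ₗ[k] C) : IsFormMap k d (fun a => T (σ a)) :=
  fun l => hσ (l ∘ₗ T)

theorem isForm_comp (hσ : IsFormMap k d σ) {f : B → k} (hf : IsForm e f) :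
    IsForm (d * e) (fun a => f (σ a)) := by
  obtain ⟨p, hp, hp'⟩ := hf
  choose q hq hq' using hσ
  refine ⟨MvPolynomial.aeval q p, hp.aeval q hq, fun a => ?_⟩
  refine (hp' _).trans ?_
  clear hp hp'
  induction p using MvPolynomial.induction_on with
  | C c => simp [formEval]
  | add p q h1 h2 => simpa [formEval] using congrArg₂ (· + ·) h1 h2
  | mul_X p l h =>
    have := congrArg₂ (· * ·) h (hq' l a)
    simpa [formEval] using this

theorem comp {σ : B → C} {τ : A → B} (hτ : IsFormMap k d τ) (hσ : IsFormMap k e σ) :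
    IsFormMap k (d * e) (fun a => σ (τ a)) :=
  fun l => hτ.isForm_comp (hσ l)

/-- Expanding the first argument in a basis writes the map as a sum of coordinate forms times linear
images of `σ`; the coordinates account for the extra degree 1. -/
theorem bilinear (β : A →ₗ[k] B →ₗ[k] C) {σ : A → B} (hσ : IsFormMap k d σ) [FiniteDimensional k A] :
    IsFormMap k (1 + d) (fun a => β a (σ a)) := by
  classical
  let b := Module.finBasis k A
  have : ∀ a, β a (σ a) = ∑ i, b.coord i a • β (b i) (σ a) := fun a => by
    have h := congrArg (fun x => β x (σ a)) (b.sum_repr a)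
    simp only [map_sum, LinearMap.sum_apply, map_smul, LinearMap.smul_apply] at h
    exact h.symm
  simp only [this]
  exact IsFormMap.sum _ fun i _ => IsFormMap.smul (isForm_linear (b.coord i)) (hσ.linear_comp (β (b i)))

theorem map_smul (hσ : IsFormMap k d σ) (c : k) (a : A) : σ (c • a) = c ^ d • σ a := by
  rw [← sub_eq_zero, ← Module.forall_dual_apply_eq_zero_iff k]
  intro l
  rw [map_sub, (hσ l).map_smul, LinearMap.map_smul, smul_eq_mul, sub_self]

end IsFormMap

end Forms

/-! ### Functions that are polynomial on lines -/

section Lines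

variable {k : Type*} [Field k] {A E : Type*} [AddCommGroup A] [Module k A]
  [AddCommGroup E] [Module k E]

/-- The restriction of `f` to every line is a polynomial. -/
def PolyOnLines (f : E → k) : Prop :=
  ∀ a v : E, ∃ P : Polynomial k, ∀ t : k, f (a + t • v) = P.eval t

namespace PolyOnLines

variable {f g : E → k}

theorem const (c : k) : PolyOnLines (fun _ : E => c) := fun _ _ => ⟨Polynomial.C c, by simp⟩

theorem add (hf : PolyOnLines f) (hg : PolyOnLines g) : PolyOnLines (fun a => f a + g a) := by
  intro a v
  obtain ⟨P, hP⟩ := hf a v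
  obtain ⟨Q, hQ⟩ := hg a v
  exact ⟨P + Q, by simp [hP, hQ]⟩

theorem mul (hf : PolyOnLines f) (hg : PolyOnLines g) : PolyOnLines (fun a => f a * g a) := by
  intro a v
  obtain ⟨P, hP⟩ := hf a v
  obtain ⟨Q, hQ⟩ := hg a v
  exact ⟨P * Q, by simp [hP, hQ]⟩

theorem linear (l : E →ₗ[k] k) : PolyOnLines (fun a => l a) := fun a v =>
  ⟨Polynomial.C (l a) + Polynomial.C (l v) * Polynomial.X, fun t => by simp [mul_comm t]⟩

theorem sum {ι : Type*} (s : Finset ι) {f : ι → E → k} (hf : ∀ i ∈ s, PolyOnLines (f i)) :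
    PolyOnLines (fun a => ∑ i ∈ s, f i a) := by
  classical
  induction s using Finset.induction_on with
  | empty => simpa using const 0
  | insert i s hi ih =>
    simp only [Finset.sum_insert hi]
    exact (hf i (s.mem_insert_self i)).add (ih fun j hj => hf j (Finset.mem_insert_of_mem hj))

theorem comp_linear {F : Type*} [AddCommGroup F] [Module k F] (hf : PolyOnLines f)
    (T : F →ₗ[k] E) : PolyOnLines (fun a => f (T a)) := by
  intro a v
  obtain ⟨P, hP⟩ := hf (T a) (T v)
  exact ⟨P, fun t => by simp [← hP]⟩

theorem form_comp {F : E → A} (hF : ∀ l : Module.Dual k A, PolyOnLines (fun e => l (F e)))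
    {d : ℕ} {f : A → k} (hf : IsForm d f) : PolyOnLines (fun e => f (F e)) := by
  obtain ⟨p, -, hp⟩ := hf
  simp only [hp]
  clear hp
  induction p using MvPolynomial.induction_on with
  | C c => simpa [formEval] using const c
  | add p q h1 h2 => simpa [formEval] using h1.add h2
  | mul_X p l h => simpa [formEval] using h.mul (hF l)

theorem form {d : ℕ} {f : E → k} (hf : IsForm d f) : PolyOnLines f :=
  form_comp (F := fun e => e) linear hf

/-- Two functions that are polynomial on lines and do not vanish identically on a line have a common
point of non-vanishing on it. -/
theorem exists_ne_zero [Infinite k] (hf : PolyOnLines f) (hg : PolyOnLines g) {a b : E}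
    (ha : f a ≠ 0) (hb : g b ≠ 0) : ∃ t : k, f (a + t • (b - a)) ≠ 0 ∧ g (a + t • (b - a)) ≠ 0 := by
  obtain ⟨P, hP⟩ := hf a (b - a)
  obtain ⟨Q, hQ⟩ := hg a (b - a)
  have hP0 : P ≠ 0 := by
    rintro rfl; exact ha (by simpa using hP 0)
  have hQ0 : Q ≠ 0 := by
    rintro rfl; exact hb (by simpa using hQ 1)
  by_contra! h
  refine mul_ne_zero hP0 hQ0 (Polynomial.funext fun t => ?_)
  have := h t
  rw [hP, hQ] at this
  rw [Polynomial.eval_mul, Polynomial.eval_zero, mul_eq_zero]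
  tauto

end PolyOnLines

end Lines

/-! ### Morphisms of spaces with functions -/

namespace SpaceWithFunctions

variable {k : Type u} [Field k]

/-- The functions that are regular near a point. -/
def regularSubalgebra (X : SpaceWithFunctions.{u, v} k) (x : X.carrier) :
    Subalgebra k (X.carrier → k) where
  carrier := {f | X.RegularAt f x}
  mul_mem' := X.mul
  add_mem' := X.add
  algebraMap_mem' c := X.const c x

theorem mem_regularSubalgebra {X : SpaceWithFunctions.{u, v} k} {x : X.carrier}
    {f : X.carrier → k} : f ∈ X.regularSubalgebra x ↔ X.RegularAt f x := Iff.rfl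

theorem IsMorphism.comp {X : SpaceWithFunctions.{u, v} k} {Y : SpaceWithFunctions.{u, w} k}
    {Z : SpaceWithFunctions.{u, w'} k} {ψ : Y.carrier → Z.carrier} {φ : X.carrier → Y.carrier}
    (hψ : IsMorphism Y Z ψ) (hφ : IsMorphism X Y φ) : IsMorphism X Z (ψ ∘ φ) :=
  ⟨hψ.1.comp hφ.1, fun f x h => hφ.2 (f ∘ ψ) x (hψ.2 f _ h)⟩

theorem isMorphism_const (X : SpaceWithFunctions.{u, v} k) (Y : SpaceWithFunctions.{u, w} k)
    (y : Y.carrier) : IsMorphism X Y (fun _ => y) :=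
  ⟨continuous_const, fun f x _ => X.const (f y) x⟩

theorem isMorphism_restrict_val (X : SpaceWithFunctions.{u, v} k) (S : Set X.carrier) :
    IsMorphism (X.restrict S) X Subtype.val :=
  ⟨continuous_subtype_val, fun f _ h => ⟨f, h, Filter.EventuallyEq.rfl⟩⟩

theorem isMorphism_restrict_of_val {X : SpaceWithFunctions.{u, v} k} {S : Set X.carrier}
    {Z : SpaceWithFunctions.{u, w} k} {φ : Z.carrier → (X.restrict S).carrier}
    (h : IsMorphism Z X (Subtype.val ∘ φ)) : IsMorphism Z (X.restrict S) φ := by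
  have hc : Continuous φ := h.1.subtype_mk fun z => (φ z).2
  refine ⟨hc, ?_⟩
  rintro f z ⟨F, hF, hf⟩
  refine Z.congr (h.2 F z hF) ?_
  filter_upwards [hc.continuousAt.eventually hf] with y hy
  exact hy.symm

/-- The first component of a point of the product. -/
def fst {X : SpaceWithFunctions.{u, v} k} {Y : SpaceWithFunctions.{u, w} k}
    (z : (X.prod Y).carrier) : X.carrier :=
  Prod.fst (show ProdCarrier X Y from z)

/-- The second component of a point of the product. -/
def snd {X : SpaceWithFunctions.{u, v} k} {Y : SpaceWithFunctions.{u, w} k}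
    (z : (X.prod Y).carrier) : Y.carrier :=
  Prod.snd (show ProdCarrier X Y from z)

theorem isMorphism_fst (X : SpaceWithFunctions.{u, v} k) (Y : SpaceWithFunctions.{u, w} k) :
    IsMorphism (X.prod Y) X fst := by
  refine ⟨⟨fun U hU => TopologicalSpace.isOpen_generateFrom_of_mem ⟨U, Set.univ, fun _ => 1, hU,
    isOpen_univ, tensorFun_const X Y _ _ 1, ?_⟩⟩, fun f z h => ?_⟩
  · ext z; simp [prodBasicOpen]; rfl
  · obtain ⟨U, hU, hUo, hz⟩ := eventually_nhds_iff.1 (X.eventually h)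
    refine ⟨U, Set.univ, fun z => f z.1, fun _ => 1, hUo, isOpen_univ, hz, trivial,
      Submodule.subset_span ⟨f, fun _ => 1, hU, fun y _ => Y.const 1 y, by simp⟩,
      tensorFun_const X Y _ _ 1, one_ne_zero, ?_⟩
    exact Filter.Eventually.of_forall fun y => by simp; rfl

theorem isMorphism_snd (X : SpaceWithFunctions.{u, v} k) (Y : SpaceWithFunctions.{u, w} k) :
    IsMorphism (X.prod Y) Y snd := by
  refine ⟨⟨fun U hU => TopologicalSpace.isOpen_generateFrom_of_mem ⟨Set.univ, U, fun _ => 1,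
    isOpen_univ, hU, tensorFun_const X Y _ _ 1, ?_⟩⟩, fun f z h => ?_⟩
  · ext z; simp [prodBasicOpen]; rfl
  · obtain ⟨U, hU, hUo, hz⟩ := eventually_nhds_iff.1 (Y.eventually h)
    refine ⟨Set.univ, U, fun z => f z.2, fun _ => 1, isOpen_univ, hUo, trivial, hz,
      Submodule.subset_span ⟨fun _ => 1, f, fun x _ => X.const 1 x, hU, by simp⟩,
      tensorFun_const X Y _ _ 1, one_ne_zero, ?_⟩
    exact Filter.Eventually.of_forall fun y => by simp; rfl

/-- A point of the product. -/
def pair {X : SpaceWithFunctions.{u, v} k} {Y : SpaceWithFunctions.{u, w} k} (x : X.carrier)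
    (y : Y.carrier) : (X.prod Y).carrier :=
  show ProdCarrier X Y from (x, y)

theorem regularAt_tensorFun_comp {X : SpaceWithFunctions.{u, v} k}
    {Y : SpaceWithFunctions.{u, w} k} {Z : SpaceWithFunctions.{u, w'} k}
    {φ : Z.carrier → X.carrier} {ψ : Z.carrier → Y.carrier} (hφ : IsMorphism Z X φ)
    (hψ : IsMorphism Z Y ψ) {U : Set X.carrier} {V : Set Y.carrier} {h : ProdCarrier X Y → k}
    (hh : h ∈ tensorFun X Y U V) {z : Z.carrier} (hU : φ z ∈ U) (hV : ψ z ∈ V) :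
    Z.RegularAt (fun z => h (pair (φ z) (ψ z))) z := by
  refine Submodule.span_induction (p := fun h _ => Z.RegularAt (fun z => h (pair (φ z) (ψ z))) z)
    ?_ ?_ ?_ ?_ hh
  · rintro _ ⟨f, g, hf, hg, rfl⟩
    exact Z.mul (hφ.2 f z (hf _ hU)) (hψ.2 g z (hg _ hV))
  · exact Z.const 0 z
  · intro x y _ _ h1 h2; exact Z.add h1 h2
  · intro c x _ h; exact Z.mul (Z.const c z) h

/-- The universal property of the product. Sums of products of regular functions pull back to
regular functions, and their non-vanishing loci generate the topology of the product. -/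
theorem isMorphism_prodMk {X : SpaceWithFunctions.{u, v} k}
    {Y : SpaceWithFunctions.{u, w} k} {Z : SpaceWithFunctions.{u, w'} k}
    {φ : Z.carrier → X.carrier} {ψ : Z.carrier → Y.carrier} (hφ : IsMorphism Z X φ)
    (hψ : IsMorphism Z Y ψ) :
    IsMorphism Z (X.prod Y) (fun z => pair (φ z) (ψ z) : Z.carrier → (X.prod Y).carrier) := by
  have hc : Continuous (fun z => pair (φ z) (ψ z) : Z.carrier → (X.prod Y).carrier) := by
    refine continuous_generateFrom_iff.2 ?_
    rintro _ ⟨U, V, h, hU, hV, hh, rfl⟩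
    refine isOpen_iff_mem_nhds.2 fun z hz => ?_
    filter_upwards [hφ.1.continuousAt.preimage_mem_nhds (hU.mem_nhds hz.1),
      hψ.1.continuousAt.preimage_mem_nhds (hV.mem_nhds hz.2.1),
      Z.eventually_ne (regularAt_tensorFun_comp hφ hψ hh hz.1 hz.2.1) hz.2.2] with y h1 h2 h3
    exact ⟨h1, h2, h3⟩
  refine ⟨hc, ?_⟩
  rintro f z ⟨U, V, a, b, hU, hV, h1, h2, ha, hb, hbz, hf⟩
  refine Z.congr (Z.mul (regularAt_tensorFun_comp hφ hψ ha h1 h2)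
    (Z.inv (regularAt_tensorFun_comp hφ hψ hb h1 h2) hbz)) ?_
  filter_upwards [hc.continuousAt.eventually hf] with y hy
  exact ((div_eq_mul_inv _ _).symm.trans hy.symm :)

/-- Only the continuity of the slices `x ↦ (x, y)` and `y ↦ (x, y)` is used: a first coordinate
common to both open sets is found with `y₁` and `y₂` fixed, then a common second one on that slice.
-/
theorem irreducibleSpace_prod (X : SpaceWithFunctions.{u, v} k) (Y : SpaceWithFunctions.{u, w} k)
    [IrreducibleSpace X.carrier] [IrreducibleSpace Y.carrier] :
    IrreducibleSpace (X.prod Y).carrier := by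
  have hx : ∀ x : X.carrier, Continuous (fun y => pair x y : Y.carrier → (X.prod Y).carrier) := fun x =>
    (isMorphism_prodMk (isMorphism_const Y X x) (isMorphism_id Y)).1
  have hy : ∀ y : Y.carrier, Continuous (fun x => pair x y : X.carrier → (X.prod Y).carrier) := fun y =>
    (isMorphism_prodMk (isMorphism_id X) (isMorphism_const X Y y)).1
  have hn : Nonempty (X.prod Y).carrier :=
    ⟨pair (Classical.arbitrary X.carrier) (Classical.arbitrary Y.carrier)⟩
  refine @IrreducibleSpace.mk _ _ ⟨?_⟩ hn
  rintro U V hU hV ⟨⟨x₁, y₁⟩, -, h₁⟩ ⟨⟨x₂, y₂⟩, -, h₂⟩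
  obtain ⟨x, hx₁, hx₂⟩ := nonempty_preirreducible_inter (hU.preimage (hy y₁))
    (hV.preimage (hy y₂)) ⟨x₁, h₁⟩ ⟨x₂, h₂⟩
  obtain ⟨y, h1, h2⟩ := nonempty_preirreducible_inter (hU.preimage (hx x))
    (hV.preimage (hx x)) ⟨y₁, hx₁⟩ ⟨y₂, hx₂⟩
  exact ⟨pair x y, trivial, h1, h2⟩

/-! ### Regular vector valued functions -/

section RegVec

variable {A B C : Type*} [AddCommGroup A] [Module k A] [AddCommGroup B] [Module k B]
  [AddCommGroup C] [Module k C] {Z : SpaceWithFunctions.{u, v} k}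

/-- The function `a` with values in the vector space `A` is regular near `z`. -/
def RegVec (Z : SpaceWithFunctions.{u, v} k) (a : Z.carrier → A) (z : Z.carrier) : Prop :=
  ∀ l : Module.Dual k A, Z.RegularAt (fun y => l (a y)) z

theorem RegVec.regularAt_form {a : Z.carrier → A} {z : Z.carrier} (ha : RegVec Z a z) {d : ℕ}
    {f : A → k} (hf : IsForm d f) : Z.RegularAt (fun y => f (a y)) z := by
  obtain ⟨p, -, hp⟩ := hf
  simp only [hp]
  clear hp
  induction p using MvPolynomial.induction_on with
  | C c => simpa [formEval] using Z.const c z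
  | add p q h1 h2 =>
    convert Z.add h1 h2 using 1
    ext y; simp [formEval]
  | mul_X p l h =>
    convert Z.mul h (ha l) using 1
    ext y; simp [formEval]

theorem RegVec.formMap {a : Z.carrier → A} {z : Z.carrier} (ha : RegVec Z a z) {d : ℕ}
    {σ : A → B} (hσ : IsFormMap k d σ) : RegVec Z (fun y => σ (a y)) z :=
  fun l => ha.regularAt_form (hσ l)

theorem RegVec.smul {f : Z.carrier → k} {a : Z.carrier → A} {z : Z.carrier}
    (hf : Z.RegularAt f z) (ha : RegVec Z a z) : RegVec Z (fun y => f y • a y) z := by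
  intro l
  convert Z.mul hf (ha l) using 1
  ext y; simp

theorem regularAt_sum {ι : Type*} (s : Finset ι) {f : ι → Z.carrier → k} {z : Z.carrier}
    (hf : ∀ i ∈ s, Z.RegularAt (f i) z) : Z.RegularAt (fun y => ∑ i ∈ s, f i y) z := by
  have h := (Z.regularSubalgebra z).sum_mem (t := s) (f := f) fun i hi => hf i hi
  rw [mem_regularSubalgebra] at h
  convert h using 1
  ext y
  rw [Finset.sum_apply]

theorem RegVec.sum {ι : Type*} (s : Finset ι) {a : ι → Z.carrier → A} {z : Z.carrier}
    (ha : ∀ i ∈ s, RegVec Z (a i) z) : RegVec Z (fun y => ∑ i ∈ s, a i y) z := by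
  intro l
  simp only [map_sum]
  exact regularAt_sum s fun i hi => ha i hi l

theorem RegVec.pi {ι : Type*} [Fintype ι] {a : Z.carrier → ι → k} {z : Z.carrier}
    (ha : ∀ i, Z.RegularAt (fun y => a y i) z) : RegVec Z a z := by
  classical
  intro l
  rw [funext fun y => LinearMap.pi_apply_eq_sum_univ l (a y)]
  exact regularAt_sum _ fun i _ => Z.mul (ha i) (Z.const _ z)

/-- The subalgebra of functions regular near `z` as a ring, evaluated at a point. -/
def evalRegular (Z : SpaceWithFunctions.{u, v} k) (z y : Z.carrier) :
    Z.regularSubalgebra z →+* k :=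
  (Pi.evalRingHom (fun _ : Z.carrier => k) y).comp (Z.regularSubalgebra z).val.toRingHom

/-- The determinant is formed in the ring of functions regular near `z`; evaluation at a point is a
ring homomorphism and commutes with it. -/
theorem regularAt_det {ι : Type*} [Fintype ι] [DecidableEq ι] {M : Z.carrier → Matrix ι ι k}
    {z : Z.carrier} (hM : ∀ i j, Z.RegularAt (fun y => M y i j) z) :
    Z.RegularAt (fun y => (M y).det) z := by
  let N : Matrix ι ι (Z.regularSubalgebra z) := fun i j => ⟨fun y => M y i j, hM i j⟩
  have h : ∀ y, (M y).det = evalRegular Z z y N.det := fun y => by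
    rw [RingHom.map_det]; rfl
  simp only [h]
  exact N.det.2

theorem regularAt_adjugate {ι : Type*} [Fintype ι] [DecidableEq ι] {M : Z.carrier → Matrix ι ι k}
    {z : Z.carrier} (hM : ∀ i j, Z.RegularAt (fun y => M y i j) z) (i j : ι) :
    Z.RegularAt (fun y => (M y).adjugate i j) z := by
  let N : Matrix ι ι (Z.regularSubalgebra z) := fun i j => ⟨fun y => M y i j, hM i j⟩
  have h : ∀ y, (M y).adjugate i j = evalRegular Z z y (N.adjugate i j) := fun y => by
    have : (evalRegular Z z y).mapMatrix N = M y := rfl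
    rw [← this, ← RingHom.map_adjugate]; rfl
  simp only [h]
  exact (N.adjugate i j).2

theorem exists_dual_family {ι : Type*} [Fintype ι] [DecidableEq ι] {b : ι → A}
    (hb : LinearIndependent k b) : ∃ ψ : A →ₗ[k] ι → k, ∀ j, ψ (b j) = Pi.single j 1 := by
  obtain ⟨ψ, hψ⟩ := LinearMap.exists_leftInverse_of_injective (Fintype.linearCombination k b)
    (LinearMap.ker_eq_bot.2 (linearIndependent_iff_injective_fintypeLinearCombination.1 hb))
  refine ⟨ψ, fun j => ?_⟩
  have := LinearMap.congr_fun hψ (Pi.single j 1)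
  simpa using this

theorem linearIndependent_of_det_ne_zero {ι : Type*} [Fintype ι] [DecidableEq ι] {b : ι → A}
    (ψ : A →ₗ[k] ι → k) (h : (Matrix.of fun i j => ψ (b j) i).det ≠ 0) :
    LinearIndependent k b :=
  LinearIndependent.of_comp ψ (Matrix.linearIndependent_cols_of_det_ne_zero h)

/-- Coordinates dual to the family at `z` give a regular determinant with value 1 at `z`; wherever
it does not vanish the family is independent. -/
theorem RegVec.eventually_linearIndependent {ι : Type*} [Finite ι] {b : ι → Z.carrier → A}
    {z : Z.carrier} (hb : ∀ i, RegVec Z (b i) z) (h : LinearIndependent k (fun i => b i z)) :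
    ∀ᶠ y in 𝓝 z, LinearIndependent k (fun i => b i y) := by
  classical
  have := Fintype.ofFinite ι
  obtain ⟨ψ, hψ⟩ := exists_dual_family h
  have hreg : Z.RegularAt (fun y => (Matrix.of fun i j => ψ (b j y) i).det) z :=
    regularAt_det fun i j => hb j (LinearMap.proj i ∘ₗ ψ)
  have hz : (Matrix.of fun i j => ψ (b j z) i).det ≠ 0 := by
    have : (Matrix.of fun i j => ψ (b j z) i) = 1 := by
      ext i j
      simp [hψ, Matrix.one_apply, Pi.single_apply]
    rw [this, Matrix.det_one]
    exact one_ne_zero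
  filter_upwards [Z.eventually_ne hreg hz] with y hy
  exact linearIndependent_of_det_ne_zero ψ hy

end RegVec

end SpaceWithFunctions

/-! ### Morphisms to a projective space -/

namespace Projectivization

variable {k : Type*} [Field k] {A : Type*} [AddCommGroup A] [Module k A]

theorem rep_mem_submodule (x : ℙ k A) : x.rep ∈ x.submodule := by
  rw [submodule_eq]
  exact Submodule.mem_span_singleton_self _

theorem mem_submodule_iff {x : ℙ k A} {a : A} : a ∈ x.submodule ↔ ∃ c : k, c • x.rep = a := by
  rw [submodule_eq, Submodule.mem_span_singleton]

theorem exists_rep_eq_smul {x : ℙ k A} {a : A} (ha : a ≠ 0) (h : a ∈ x.submodule) :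
    ∃ c : k, c ≠ 0 ∧ x.rep = c • a := by
  obtain ⟨c, rfl⟩ := mem_submodule_iff.1 h
  have hc : c ≠ 0 := by rintro rfl; exact ha (zero_smul _ _)
  exact ⟨c⁻¹, inv_ne_zero hc, by rw [smul_smul, inv_mul_cancel₀ hc, one_smul]⟩

theorem submodule_eq_span {x : ℙ k A} {a : A} (ha : a ≠ 0) (h : a ∈ x.submodule) :
    x.submodule = Submodule.span k {a} := by
  obtain ⟨c, hc, hx⟩ := exists_rep_eq_smul ha h
  rw [submodule_eq, hx, Submodule.span_singleton_smul_eq (IsUnit.mk0 c hc)]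

theorem eq_of_mem_submodule {x y : ℙ k A} {a : A} (ha : a ≠ 0) (hx : a ∈ x.submodule)
    (hy : a ∈ y.submodule) : x = y :=
  submodule_injective (by rw [submodule_eq_span ha hx, submodule_eq_span ha hy])

theorem mk_mem_submodule {a : A} (ha : a ≠ 0) : a ∈ (mk k a ha).submodule := by
  rw [submodule_mk]
  exact Submodule.mem_span_singleton_self _

end Projectivization

namespace SpaceWithFunctions

open Projectivization

variable {k : Type u} [Field k] {A : Type v'} [AddCommGroup A] [Module k A]
  {Z : SpaceWithFunctions.{u, v} k}

/-- Near `z`, the map `φ` to a projective space is given by the regular function `a` with values in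
the vector space. -/
structure IsLift (Z : SpaceWithFunctions.{u, v} k) (φ : Z.carrier → ℙ k A) (a : Z.carrier → A)
    (z : Z.carrier) : Prop where
  regVec : RegVec Z a z
  ne_zero : ∀ᶠ y in 𝓝 z, a y ≠ 0
  mem : ∀ᶠ y in 𝓝 z, a y ∈ (φ y).submodule

theorem IsLift.exists_rep {φ : Z.carrier → ℙ k A} {a : Z.carrier → A} {z : Z.carrier}
    (h : IsLift Z φ a z) : ∀ᶠ y in 𝓝 z, ∃ c : k, c ≠ 0 ∧ (φ y).rep = c • a y := by
  filter_upwards [h.ne_zero, h.mem] with y h1 h2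
  exact exists_rep_eq_smul h1 h2

/-- The chosen representative of `φ y` differs from the lift `a y` by a nonzero scalar. This scalar
does not affect the vanishing of a form and cancels in a quotient of two forms of equal degree. -/
theorem isMorphism_projSpace_of_isLift {φ : Z.carrier → ℙ k A}
    (h : ∀ z, ∃ a, IsLift Z φ a z) : IsMorphism Z (projSpace k A) φ := by
  have key : ∀ z, ∃ a : Z.carrier → A, RegVec Z a z ∧ ∀ᶠ y in 𝓝 z, ∃ c : k, c ≠ 0 ∧
      ∀ (d : ℕ) (p : MvPolynomial (Module.Dual k A) k), p.IsHomogeneous d →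
        formEval p (φ y).rep = c ^ d * formEval p (a y) := by
    intro z
    obtain ⟨a, ha⟩ := h z
    refine ⟨a, ha.regVec, ?_⟩
    filter_upwards [ha.exists_rep] with y ⟨c, hc, hy⟩
    exact ⟨c, hc, fun d p hp => by rw [hy, formEval_smul hp]⟩
  have hc : Continuous φ := by
    refine continuous_generateFrom_iff.2 ?_
    rintro _ ⟨p, d, hp, rfl⟩
    refine isOpen_iff_mem_nhds.2 fun z hz => ?_
    obtain ⟨a, ha, h1⟩ := key z
    have hz' : formEval p (a z) ≠ 0 := by
      obtain ⟨c, hc, h2⟩ := h1.self_of_nhds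
      have hz : formEval p (φ z).rep ≠ 0 := hz
      rw [h2 d p hp] at hz
      exact right_ne_zero_of_mul hz
    filter_upwards [h1, Z.eventually_ne (ha.regularAt_form ⟨p, hp, fun _ => rfl⟩) hz']
      with y ⟨c, hc, hy⟩ hy'
    change formEval p (φ y).rep ≠ 0
    rw [hy d p hp]
    exact mul_ne_zero (pow_ne_zero _ hc) hy'
  refine ⟨hc, ?_⟩
  rintro f z ⟨d, p, q, hp, hq, hz, hf⟩
  obtain ⟨a, ha, h1⟩ := key z
  have hz' : formEval q (a z) ≠ 0 := by
    obtain ⟨c, hc, h2⟩ := h1.self_of_nhds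
    rw [h2 d q hq] at hz
    exact right_ne_zero_of_mul hz
  refine Z.congr (Z.mul (ha.regularAt_form ⟨p, hp, fun _ => rfl⟩)
    (Z.inv (ha.regularAt_form ⟨q, hq, fun _ => rfl⟩) hz')) ?_
  filter_upwards [hc.continuousAt.eventually hf, h1] with y hy ⟨c, hc, hy'⟩
  rw [hy' d p hp, hy' d q hq, mul_div_mul_left _ _ (pow_ne_zero _ hc), div_eq_mul_inv] at hy
  exact hy.symm

/-- Near `z` the representatives can be normalized by a linear form that does not vanish at `φ z`;
the coordinates then become quotients of linear forms. -/
theorem IsMorphism.exists_isLift {φ : Z.carrier → ℙ k A} (hφ : IsMorphism Z (projSpace k A) φ)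
    (z : Z.carrier) : ∃ a, IsLift Z φ a z := by
  obtain ⟨l, hl⟩ : ∃ l : Module.Dual k A, l (φ z).rep ≠ 0 := by
    by_contra! h'
    exact (φ z).rep_nonzero ((Module.forall_dual_apply_eq_zero_iff k _).1 h')
  have hl' : formEval (MvPolynomial.X l) (φ z).rep ≠ 0 := by simpa [formEval] using hl
  have hne : ∀ᶠ y in 𝓝 z, l (φ y).rep ≠ 0 := by
    have := hφ.1.continuousAt.preimage_mem_nhds
      (projBasicOpen_mem_nhds (MvPolynomial.isHomogeneous_X k l) hl')
    filter_upwards [this] with y hy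
    have hy : formEval (MvPolynomial.X l) (φ y).rep ≠ 0 := hy
    simpa [formEval] using hy
  refine ⟨fun y => (l (φ y).rep)⁻¹ • (φ y).rep, fun m => ?_, ?_, ?_⟩
  · refine hφ.2 (fun x => m ((l x.rep)⁻¹ • x.rep)) z ⟨1, MvPolynomial.X m, MvPolynomial.X l,
      MvPolynomial.isHomogeneous_X k m, MvPolynomial.isHomogeneous_X k l, hl', ?_⟩
    exact Filter.Eventually.of_forall fun y => by simp [formEval, div_eq_inv_mul]
  · filter_upwards [hne] with y hy
    exact smul_ne_zero (inv_ne_zero hy) (φ y).rep_nonzero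
  · exact Filter.Eventually.of_forall fun y => Submodule.smul_mem _ _ (rep_mem_submodule _)

end SpaceWithFunctions

/-! ### Irreducible subsets of a projective space -/

section Irreducible

open Projectivization

variable {k : Type u} [Field k] {A : Type v} [AddCommGroup A] [Module k A]

theorem exists_projBasicOpen_subset {O : Set (ℙ k A)} (hO : IsOpen O) {x : ℙ k A} (hx : x ∈ O) :
    ∃ (d : ℕ) (p : MvPolynomial (Module.Dual k A) k), p.IsHomogeneous d ∧
      formEval p x.rep ≠ 0 ∧ projBasicOpen p ⊆ O := by
  change TopologicalSpace.GenerateOpen _ O at hO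
  induction hO with
  | basic s hs =>
    obtain ⟨p, d, hp, rfl⟩ := hs
    exact ⟨d, p, hp, hx, subset_rfl⟩
  | univ => exact ⟨0, MvPolynomial.C 1, MvPolynomial.isHomogeneous_C _ _, by simp [formEval],
      Set.subset_univ _⟩
  | inter s t _ _ hs ht =>
    obtain ⟨d, p, hp, hpx, hps⟩ := hs hx.1
    obtain ⟨e, q, hq, hqx, hqt⟩ := ht hx.2
    refine ⟨d + e, p * q, hp.mul hq, by simpa [formEval] using ⟨hpx, hqx⟩, fun y hy => ?_⟩
    have hy : formEval (p * q) y.rep ≠ 0 := hy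
    simp only [formEval, map_mul] at hy
    exact ⟨hps (left_ne_zero_of_mul hy), hqt (right_ne_zero_of_mul hy)⟩
  | sUnion S _ ih =>
    obtain ⟨s, hs, hxs⟩ := hx
    obtain ⟨d, p, hp, hpx, hps⟩ := ih s hs hxs
    exact ⟨d, p, hp, hpx, hps.trans (Set.subset_sUnion_of_mem hs)⟩

theorem formEval_ne_zero_iff {p : MvPolynomial (Module.Dual k A) k} {d : ℕ}
    (hp : p.IsHomogeneous d) {x : ℙ k A} {a : A} (ha : a ≠ 0) (h : a ∈ x.submodule) :
    formEval p x.rep ≠ 0 ↔ formEval p a ≠ 0 := by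
  obtain ⟨c, hc, hx⟩ := exists_rep_eq_smul ha h
  rw [hx, formEval_smul hp]
  simp [hc]

/-- The points of a projective space that are parametrized by a linear space, by a map that is
polynomial on lines, form an irreducible set. -/
theorem isIrreducible_parametrized [Infinite k] {E : Type*} [AddCommGroup E] [Module k E]
    (D : Submodule k E) {F : E → A} (hF : ∀ l : Module.Dual k A, PolyOnLines (fun e => l (F e)))
    (hne : ∃ e ∈ D, F e ≠ 0) :
    IsIrreducible {x : ℙ k A | ∃ e ∈ D, F e ≠ 0 ∧ F e ∈ x.submodule} := by
  obtain ⟨e₀, he₀, h₀⟩ := hne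
  refine ⟨⟨mk k (F e₀) h₀, e₀, he₀, h₀, mk_mem_submodule h₀⟩, ?_⟩
  rintro U V hU hV ⟨x, ⟨e, he, hx, hxe⟩, hxU⟩ ⟨y, ⟨e', he', hy, hye⟩, hyV⟩
  obtain ⟨d, p, hp, hpx, hpU⟩ := exists_projBasicOpen_subset hU hxU
  obtain ⟨d', q, hq, hqy, hqV⟩ := exists_projBasicOpen_subset hV hyV
  rw [formEval_ne_zero_iff hp hx hxe] at hpx
  rw [formEval_ne_zero_iff hq hy hye] at hqy
  obtain ⟨l, hl⟩ : ∃ l : Module.Dual k A, l (F e) ≠ 0 := by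
    by_contra! h'
    exact hx ((Module.forall_dual_apply_eq_zero_iff k _).1 h')
  have h1 : PolyOnLines (fun e => formEval p (F e)) :=
    PolyOnLines.form_comp hF ⟨p, hp, fun _ => rfl⟩
  have h2 : PolyOnLines (fun e => formEval q (F e)) :=
    PolyOnLines.form_comp hF ⟨q, hq, fun _ => rfl⟩
  -- The extra factor `l ∘ F` keeps `F` nonzero at the new point; the form `p` alone would not,
  -- since it may have degree 0.
  obtain ⟨t, ht, ht'⟩ := (h1.mul (hF l)).exists_ne_zero h2 (mul_ne_zero hpx hl) hqy
  set z := e + t • (e' - e)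
  have hz : F z ≠ 0 := by
    intro h0
    rw [h0, map_zero, mul_zero] at ht
    exact ht rfl
  refine ⟨mk k (F z) hz, ⟨z, D.add_mem he (D.smul_mem _ (D.sub_mem he' he)), hz,
    mk_mem_submodule hz⟩, hpU ?_, hqV ?_⟩
  · exact (formEval_ne_zero_iff hp hz (mk_mem_submodule hz)).2 (left_ne_zero_of_mul ht)
  · exact (formEval_ne_zero_iff hq hz (mk_mem_submodule hz)).2 ht'

/-- Projective space is irreducible. -/
theorem irreducibleSpace_projectivization [Infinite k] [Nontrivial A] :
    IrreducibleSpace (ℙ k A) := by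
  obtain ⟨a, ha⟩ := exists_ne (0 : A)
  have h := isIrreducible_parametrized (⊤ : Submodule k A) (F := fun a => a)
    (fun l => PolyOnLines.linear l) ⟨a, trivial, ha⟩
  have hu : {x : ℙ k A | ∃ e ∈ (⊤ : Submodule k A), e ≠ 0 ∧ e ∈ x.submodule} = Set.univ :=
    Set.eq_univ_of_forall fun x => ⟨x.rep, trivial, x.rep_nonzero, rep_mem_submodule x⟩
  rw [hu] at h
  exact @IrreducibleSpace.mk _ _ ⟨h.2⟩ ⟨mk k a ha⟩

/-- A linear subspace of projective space is closed. -/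
theorem isClosed_projSubspace (V : Submodule k A) : IsClosed (projSubspace V) := by
  rw [← isOpen_compl_iff, isOpen_iff_mem_nhds]
  intro x hx
  have hx' : x.rep ∉ V := fun h => hx (by
    change x.submodule ≤ V
    rw [submodule_eq, Submodule.span_singleton_le_iff_mem]
    exact h)
  obtain ⟨l, hl, hlV⟩ := Submodule.exists_le_ker_of_notMem hx'
  have := projBasicOpen_mem_nhds (MvPolynomial.isHomogeneous_X k l) (x := x)
    (by simpa [formEval] using hl)
  filter_upwards [this] with y hy hyV
  have hy : formEval (MvPolynomial.X l) y.rep ≠ 0 := hy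
  simp only [formEval, MvPolynomial.eval_X] at hy
  exact hy (hlV (hyV (rep_mem_submodule y)))

end Irreducible

/-! ### Projective bundles trivialized by polynomial maps -/

open Projectivization SpaceWithFunctions

section Comb

variable {k : Type u} [Field k] {A : Type v} [AddCommGroup A] [Module k A]
  {B : Type v'} [AddCommGroup B] [Module k B] {ι : Type} [Fintype ι] {d : ℕ} {b : ι → A → B}

/-- The point `y` is the linear combination, with the coefficients `c`, of the values at `x` of the
polynomial maps `b`. -/
def IsComb (b : ι → A → B) (x : ℙ k A) (c : ℙ k (ι → k)) (y : ℙ k B) : Prop :=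
  ∑ j, c.rep j • b j x.rep ∈ y.submodule

/-- A change of representative multiplies all the vectors by the same unit `c ^ d`, the maps being
of a common degree. -/
theorem linearIndependent_rep_iff {ι : Type*} {d : ℕ} {b : ι → A → B}
    (hb : ∀ j, IsFormMap k d (b j)) {x : ℙ k A} {a : A} (ha : a ≠ 0) (hx : a ∈ x.submodule) :
    LinearIndependent k (fun j => b j x.rep) ↔ LinearIndependent k (fun j => b j a) := by
  obtain ⟨c, hc, h⟩ := exists_rep_eq_smul ha hx
  have : (fun j => b j x.rep) = (fun _ : ι => Units.mk0 c hc ^ d) • fun j => b j a := by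
    ext j
    simp [h, (hb j).map_smul, Units.smul_def]
  rw [this]
  exact LinearIndependent.units_smul_iff _ _

theorem isOpen_linearIndependent {ι : Type*} [Finite ι] {d : ℕ} {b : ι → A → B}
    (hb : ∀ j, IsFormMap k d (b j)) :
    IsOpen {x : ℙ k A | LinearIndependent k (fun j => b j x.rep)} := by
  refine isOpen_iff_mem_nhds.2 fun x hx => ?_
  obtain ⟨a, ha⟩ := IsMorphism.exists_isLift (isMorphism_id (projSpace k A)) x
  have hx' := (linearIndependent_rep_iff hb ha.ne_zero.self_of_nhds ha.mem.self_of_nhds).1 hx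
  filter_upwards [ha.ne_zero, ha.mem, RegVec.eventually_linearIndependent
    (fun j => ha.regVec.formMap (hb j)) hx'] with y h1 h2 h3
  exact (linearIndependent_rep_iff hb h1 h2).2 h3

theorem sum_smul_ne_zero {β : ι → B} (hβ : LinearIndependent k β) {γ : ι → k} (hγ : γ ≠ 0) :
    ∑ j, γ j • β j ≠ 0 := fun h =>
  hγ (funext (Fintype.linearIndependent_iff.1 hβ γ h))

/-- The common degree `d` is essential: rescaling representatives of `x` and `c` must rescale the
whole combination rather than its terms separately. -/
theorem isComb_iff (hb : ∀ j, IsFormMap k d (b j)) {x : ℙ k A} {c : ℙ k (ι → k)} {y : ℙ k B}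
    {a : A} (ha : a ≠ 0) (hx : a ∈ x.submodule) {γ : ι → k} (hγ : γ ≠ 0) (hc : γ ∈ c.submodule) :
    IsComb b x c y ↔ ∑ j, γ j • b j a ∈ y.submodule := by
  obtain ⟨r, hr, h⟩ := exists_rep_eq_smul ha hx
  obtain ⟨s, hs, h'⟩ := exists_rep_eq_smul hγ hc
  have : ∑ j, c.rep j • b j x.rep = (s * r ^ d) • ∑ j, γ j • b j a := by
    rw [Finset.smul_sum]
    refine Finset.sum_congr rfl fun j _ => ?_
    rw [h, h', (hb j).map_smul, smul_smul, smul_smul, Pi.smul_apply, smul_eq_mul]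
    congr 1
    ring
  rw [IsComb, this, Submodule.smul_mem_iff _ (mul_ne_zero hs (pow_ne_zero _ hr))]

theorem exists_isComb {x : ℙ k A} (h : LinearIndependent k (fun j => b j x.rep))
    (c : ℙ k (ι → k)) : ∃ y, IsComb b x c y :=
  ⟨mk k _ (sum_smul_ne_zero h c.rep_nonzero), mk_mem_submodule _⟩

theorem IsComb.unique {x : ℙ k A} (h : LinearIndependent k (fun j => b j x.rep))
    {c : ℙ k (ι → k)} {y y' : ℙ k B} (hy : IsComb b x c y) (hy' : IsComb b x c y') : y = y' :=
  eq_of_mem_submodule (sum_smul_ne_zero h c.rep_nonzero) hy hy'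

theorem IsComb.unique_coeff {x : ℙ k A} (h : LinearIndependent k (fun j => b j x.rep))
    {c c' : ℙ k (ι → k)} {y : ℙ k B} (hy : IsComb b x c y) (hy' : IsComb b x c' y) : c = c' := by
  obtain ⟨r, hr⟩ := mem_submodule_iff.1 hy
  obtain ⟨s, hs, hs'⟩ := exists_rep_eq_smul (sum_smul_ne_zero h c'.rep_nonzero) hy'
  rw [hs', smul_smul] at hr
  have h0 : ∑ j, (c.rep j - (r * s) * c'.rep j) • b j x.rep = 0 := by
    simp only [sub_smul, Finset.sum_sub_distrib, ← hr, Finset.smul_sum, smul_smul, sub_self]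
  have h1 := Fintype.linearIndependent_iff.1 h _ h0
  refine eq_of_mem_submodule c.rep_nonzero (rep_mem_submodule c)
    (mem_submodule_iff.2 ⟨r * s, funext fun j => ?_⟩)
  simpa using (sub_eq_zero.1 (h1 j)).symm

variable {Z : SpaceWithFunctions.{u, w} k}

/-- Local lifts of `x` and `c` combine to a local lift of `y`, which is nonzero by independence. -/
theorem isMorphism_of_isComb (hb : ∀ j, IsFormMap k d (b j)) {x : Z.carrier → ℙ k A}
    {c : Z.carrier → ℙ k (ι → k)} {y : Z.carrier → ℙ k B} (hx : IsMorphism Z (projSpace k A) x)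
    (hc : IsMorphism Z (projSpace k (ι → k)) c)
    (hli : ∀ z, LinearIndependent k (fun j => b j (x z).rep))
    (hy : ∀ z, IsComb b (x z) (c z) (y z)) : IsMorphism Z (projSpace k B) y := by
  refine isMorphism_projSpace_of_isLift fun z => ?_
  obtain ⟨a, ha⟩ := hx.exists_isLift z
  obtain ⟨γ, hγ⟩ := hc.exists_isLift z
  refine ⟨fun z => ∑ j, γ z j • b j (a z), RegVec.sum _ fun j _ =>
    RegVec.smul (hγ.regVec (LinearMap.proj j)) (ha.regVec.formMap (hb j)), ?_, ?_⟩
  · filter_upwards [ha.ne_zero, ha.mem, hγ.ne_zero] with z' h1 h2 h3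
    exact sum_smul_ne_zero ((linearIndependent_rep_iff hb h1 h2).1 (hli z')) h3
  · filter_upwards [ha.ne_zero, ha.mem, hγ.ne_zero, hγ.mem] with z' h1 h2 h3 h4
    exact (isComb_iff hb h1 h2 h3 h4).1 (hy z')

/-- The coefficients solve a linear system whose matrix is regular in `z` after projection by
coordinates `ψ` dual to the family at one point. Cramer's rule recovers them up to a scalar as the
adjugate applied to a lift of `y`. -/
theorem isMorphism_coeff_of_isComb (hb : ∀ j, IsFormMap k d (b j)) {x : Z.carrier → ℙ k A}
    {c : Z.carrier → ℙ k (ι → k)} {y : Z.carrier → ℙ k B} (hx : IsMorphism Z (projSpace k A) x)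
    (hy : IsMorphism Z (projSpace k B) y)
    (hli : ∀ z, LinearIndependent k (fun j => b j (x z).rep))
    (hxy : ∀ z, IsComb b (x z) (c z) (y z)) : IsMorphism Z (projSpace k (ι → k)) c := by
  classical
  refine isMorphism_projSpace_of_isLift fun z => ?_
  obtain ⟨a, ha⟩ := hx.exists_isLift z
  obtain ⟨β, hβ⟩ := hy.exists_isLift z
  have hlz : LinearIndependent k (fun j => b j (a z)) :=
    (linearIndependent_rep_iff hb ha.ne_zero.self_of_nhds ha.mem.self_of_nhds).1 (hli z)
  obtain ⟨ψ, hψ⟩ := exists_dual_family hlz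
  let M : Z.carrier → Matrix ι ι k := fun z' => Matrix.of fun i j => ψ (b j (a z')) i
  have hM : ∀ i j, Z.RegularAt (fun z' => M z' i j) z := fun i j =>
    (ha.regVec.formMap (hb j)) (LinearMap.proj i ∘ₗ ψ)
  have hMz : (M z).det ≠ 0 := by
    have : M z = 1 := by
      ext i j
      simp [M, hψ, Matrix.one_apply, Pi.single_apply]
    rw [this, Matrix.det_one]
    exact one_ne_zero
  have key : ∀ᶠ z' in 𝓝 z, ∃ r : k, r ≠ 0 ∧
      (M z').adjugate.mulVec (ψ (β z')) = r • (c z').rep := by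
    filter_upwards [ha.ne_zero, ha.mem, hβ.ne_zero, hβ.mem,
      Z.eventually_ne (regularAt_det hM) hMz] with z' h1 h2 h3 h4 h5
    have h6 := (isComb_iff hb h1 h2 (c z').rep_nonzero (rep_mem_submodule _)).1 (hxy z')
    obtain ⟨s, hs, h7⟩ := exists_rep_eq_smul (sum_smul_ne_zero
      ((linearIndependent_rep_iff hb h1 h2).1 (hli z')) (c z').rep_nonzero) h6
    obtain ⟨t, ht⟩ := mem_submodule_iff.1 h4
    have ht0 : t ≠ 0 := by rintro rfl; exact h3 (by rw [← ht, zero_smul])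
    have h8 : ψ (β z') = (t * s) • (M z').mulVec (c z').rep := by
      rw [← ht, h7, smul_smul, map_smul, map_sum]
      congr 1
      ext i
      simp [M, Matrix.mulVec, dotProduct, mul_comm]
    refine ⟨t * s * (M z').det, mul_ne_zero (mul_ne_zero ht0 hs) h5, ?_⟩
    rw [h8, Matrix.mulVec_smul, Matrix.mulVec_mulVec, Matrix.adjugate_mul, Matrix.smul_mulVec,
      Matrix.one_mulVec, smul_smul]
  refine ⟨fun z' => (M z').adjugate.mulVec (ψ (β z')), RegVec.pi fun i =>
    regularAt_sum _ fun j _ => Z.mul (regularAt_adjugate hM i j)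
      (hβ.regVec (LinearMap.proj j ∘ₗ ψ)), ?_, ?_⟩
  · filter_upwards [key] with z' ⟨r, hr, h⟩
    rw [h]
    exact smul_ne_zero hr (c z').rep_nonzero
  · filter_upwards [key] with z' ⟨r, hr, h⟩
    rw [h]
    exact Submodule.smul_mem _ _ (rep_mem_submodule _)

/-- On the open locus of independence the combination is unique and depends on `z` through a
morphism; the set is the preimage of `O` under it. -/
theorem isOpen_isComb (hb : ∀ j, IsFormMap k d (b j)) {x : Z.carrier → ℙ k A}
    {c : Z.carrier → ℙ k (ι → k)} (hx : IsMorphism Z (projSpace k A) x)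
    (hc : IsMorphism Z (projSpace k (ι → k)) c) {O : Set (ℙ k B)} (hO : IsOpen O) :
    IsOpen {z | LinearIndependent k (fun j => b j (x z).rep) ∧
      ∃ y ∈ O, IsComb b (x z) (c z) y} := by
  let Z₁ : Set Z.carrier := {z | LinearIndependent k (fun j => b j (x z).rep)}
  have hZ₁ : IsOpen Z₁ := (isOpen_linearIndependent hb).preimage hx.1
  choose y hy using fun z : Z₁ => exists_isComb z.2 (c z)
  have hm : IsMorphism (Z.restrict Z₁) (projSpace k B) y :=
    isMorphism_of_isComb hb (hx.comp (isMorphism_restrict_val Z Z₁))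
      (hc.comp (isMorphism_restrict_val Z Z₁)) (fun z => z.2) hy
  have ho := hZ₁.isOpenMap_subtype_val _ (hO.preimage hm.1)
  convert ho using 1
  ext z
  constructor
  · rintro ⟨h, y', hy', hc'⟩
    exact ⟨⟨z, h⟩, by
      change y ⟨z, h⟩ ∈ O
      rwa [(hy ⟨z, h⟩).unique h hc'], rfl⟩
  · rintro ⟨z, hz, rfl⟩
    exact ⟨z.2, y z, hz, hy z⟩

end Comb

/-! ### Equivariance, and birationality from a pair of mutually inverse families -/

section Action

variable {k : Type u} [Field k] {G : Type w} [Group G] {A : Type v} [AddCommGroup A] [Module k A]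
  {B : Type v'} [AddCommGroup B] [Module k B]

/-- The action on a projective space. -/
def actProj (ρ : Representation k G A) (g : G) : ℙ k A → ℙ k A :=
  Projectivization.map (ρ g) (representation_injective ρ g)

theorem smul_mem_submodule (ρ : Representation k G A) (g : G) {x : ℙ k A} {a : A}
    (ha : a ∈ x.submodule) : ρ g a ∈ (actProj ρ g x).submodule := by
  induction x using Projectivization.ind with | h y hy =>
  rw [submodule_mk] at ha
  rw [actProj, map_mk, submodule_mk]
  obtain ⟨c, rfl⟩ := Submodule.mem_span_singleton.1 ha
  rw [map_smul]
  exact Submodule.smul_mem _ _ (Submodule.mem_span_singleton_self _)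

theorem smul_rep_mem_submodule (ρ : Representation k G A) (g : G) (x : ℙ k A) :
    ρ g x.rep ∈ (actProj ρ g x).submodule :=
  smul_mem_submodule ρ g (rep_mem_submodule x)

theorem rho_rep_ne_zero (ρ : Representation k G A) (g : G) (x : ℙ k A) : ρ g x.rep ≠ 0 :=
  (map_ne_zero_iff _ (representation_injective ρ g)).2 x.rep_nonzero

theorem smul_projTrivial {m : ℕ} (g : G) (c : (projTrivial k G m).carrier) : g • c = c :=
  eq_of_mem_submodule (Projectivization.rep_nonzero (show ℙ k (Fin (m + 1) → k) from c))
    (smul_rep_mem_submodule (Representation.trivial k G (Fin (m + 1) → k)) g c)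
    (rep_mem_submodule _)

variable {ι : Type} {d : ℕ} {b : ι → A → B} {ρA : Representation k G A}
  {ρB : Representation k G B}

theorem linearIndependent_rep_smul (hb : ∀ j, IsFormMap k d (b j))
    (heq : ∀ j g a, b j (ρA g a) = ρB g (b j a)) (g : G) {x : ℙ k A}
    (h : LinearIndependent k (fun j => b j x.rep)) :
    LinearIndependent k (fun j => b j (actProj ρA g x).rep) := by
  rw [linearIndependent_rep_iff hb (rho_rep_ne_zero ρA g x) (smul_rep_mem_submodule ρA g x)]
  simp only [heq]
  exact h.map' (ρB g) (LinearMap.ker_eq_bot.2 (representation_injective ρB g))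

theorem IsComb.smul [Fintype ι] (hb : ∀ j, IsFormMap k d (b j))
    (heq : ∀ j g a, b j (ρA g a) = ρB g (b j a)) (g : G) {x : ℙ k A} {c : ℙ k (ι → k)} {y : ℙ k B}
    (h : IsComb b x c y) : IsComb b (actProj ρA g x) c (actProj ρB g y) := by
  refine (isComb_iff hb (rho_rep_ne_zero ρA g x) (smul_rep_mem_submodule ρA g x) c.rep_nonzero
    (rep_mem_submodule c)).2 ?_
  have := smul_mem_submodule ρB g h
  simpa only [map_sum, map_smul, heq] using this

/-- If the points of a `G`-stable subset `S` of `ℙ(A)` and those of `ℙ(B)` are generically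
related to each other by families of equivariant polynomial maps, so that each is generically a
linear combination of the values at the other, then `S × ℙ^m` and `ℙ(B) × ℙ^m'` are equivariantly
birational. -/
theorem equivariantlyBirational_of_isComb [Infinite k] [Nontrivial B] {m m' d' : ℕ}
    {b : Fin (m + 1) → A → B} {b' : Fin (m' + 1) → B → A}
    (hb : ∀ j, IsFormMap k d (b j)) (heq : ∀ j g a, b j (ρA g a) = ρB g (b j a))
    (hb' : ∀ j, IsFormMap k d' (b' j)) (heq' : ∀ j g a, b' j (ρB g a) = ρA g (b' j a))
    (S : Set (projRep ρA).carrier) (hS : ∀ (g : G), ∀ x ∈ S, g • x ∈ S)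
    (hirr : IrreducibleSpace ((projRep ρA).restrict S hS).carrier)
    (O : Set (ℙ k B)) (hO : IsOpen O)
    (hOG : ∀ (g : G), ∀ y ∈ O, actProj ρB g y ∈ O)
    (hli : ∀ y ∈ O, LinearIndependent k (fun j => b' j y.rep))
    (h₁ : ∀ x : ℙ k A, x ∈ S → ∀ c, ∀ y ∈ O,
      LinearIndependent k (fun j => b j x.rep) → IsComb b x c y →
      ∃ c', IsComb b' y c' x)
    (h₂ : ∀ y ∈ O, ∀ c' x, IsComb b' y c' x → x ∈ S)
    (h₃ : ∀ y ∈ O, ∀ c' x, IsComb b' y c' x → LinearIndependent k (fun j => b j x.rep) →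
      ∃ c, IsComb b x c y)
    (hne : ∃ y ∈ O, ∃ c' x, IsComb b' y c' x ∧ LinearIndependent k (fun j => b j x.rep)) :
    GSpace.EquivariantlyBirational (((projRep ρA).restrict S hS).prod (projTrivial k G m))
      ((projRep ρB).prod (projTrivial k G m')) := by
  let X := (projSpace k A).restrict S
  let P := projSpace k (Fin (m + 1) → k)
  let P' := projSpace k (Fin (m' + 1) → k)
  let Y := projSpace k B
  let xU : (X.prod P).carrier → ℙ k A := fun z => (fst z).1
  let cU : (X.prod P).carrier → ℙ k (Fin (m + 1) → k) := snd
  let yV : (Y.prod P').carrier → ℙ k B := fst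
  let cV : (Y.prod P').carrier → ℙ k (Fin (m' + 1) → k) := snd
  have hxU : IsMorphism (X.prod P) (projSpace k A) xU :=
    (isMorphism_restrict_val (projSpace k A) S).comp (isMorphism_fst X P)
  have hcU : IsMorphism (X.prod P) P cU := isMorphism_snd X P
  have hyV : IsMorphism (Y.prod P') Y yV := isMorphism_fst Y P'
  have hcV : IsMorphism (Y.prod P') P' cV := isMorphism_snd Y P'
  -- The graph of the birational map consists of the pairs `((x, c), (y, c'))` in which `y` is the
  -- combination of the `b j x` with coefficients `c` and `x` that of the `b' j y` with coefficients
  -- `c'`. `U` and `V` are open sets that this graph matches bijectively.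
  let U : Set (X.prod P).carrier := {z | LinearIndependent k (fun j => b j (xU z).rep) ∧
      ∃ y ∈ O, IsComb b (xU z) (cU z) y}
  let L : Set (ℙ k A) := {x | LinearIndependent k (fun j => b j x.rep)}
  let V : Set (Y.prod P').carrier := {z | LinearIndependent k (fun j => b' j (yV z).rep) ∧
      ∃ x ∈ L, IsComb b' (yV z) (cV z) x} ∩ yV ⁻¹' O
  have hUo : IsOpen U := isOpen_isComb hb hxU hcU hO
  have hVo : IsOpen V := (isOpen_isComb hb' hyV hcV (isOpen_linearIndependent hb)).inter
    (hO.preimage hyV.1)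
  let XG := ((projRep ρA).restrict S hS).prod (projTrivial k G m)
  let YG := (projRep ρB).prod (projTrivial k G m')
  have hUG : ∀ (g : G) (z : XG.carrier), z ∈ U → g • z ∈ U := by
    rintro g z ⟨h, y, hy, hz⟩
    have hc : cU (g • z) = cU z := smul_projTrivial g _
    refine ⟨linearIndependent_rep_smul hb heq g h, _, hOG g y hy, ?_⟩
    rw [hc]
    exact hz.smul hb heq g
  have hVG : ∀ (g : G) (z : YG.carrier), z ∈ V → g • z ∈ V := by
    rintro g z ⟨⟨h, x, hx, hz⟩, hzO⟩
    have hc : cV (g • z) = cV z := smul_projTrivial g _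
    refine ⟨⟨linearIndependent_rep_smul hb' heq' g h, _,
      linearIndependent_rep_smul hb heq g hx, ?_⟩, hOG g _ hzO⟩
    rw [hc]
    exact hz.smul hb' heq' g
  have hf : ∀ z : U, ∃ z' : V, IsComb b (xU z) (cU z) (yV z') ∧
      IsComb b' (yV z') (cV z') (xU z) := by
    rintro ⟨z, h, y, hy, hz⟩
    obtain ⟨c', hc'⟩ := h₁ _ (fst z).2 _ _ hy h hz
    exact ⟨⟨(pair y c' : (Y.prod P').carrier), ⟨hli y hy, _, h, hc'⟩, hy⟩, hz, hc'⟩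
  have hg : ∀ z' : V, ∃ z : U, IsComb b (xU z) (cU z) (yV z') ∧
      IsComb b' (yV z') (cV z') (xU z) := by
    rintro ⟨z', ⟨h, x, hx, hz⟩, hzO⟩
    obtain ⟨c, hc⟩ := h₃ _ hzO _ _ hz hx
    exact ⟨⟨(pair ⟨x, h₂ _ hzO _ _ hz⟩ c : (X.prod P).carrier), hx, _, hzO, hc⟩, hc, hz⟩
  -- The pair `(y, c')` determines the combination `x`; then `x` and `y` determine `c`, by
  -- independence of the `b j x`.
  have huU : ∀ (z' : V) (z₁ z₂ : U), IsComb b (xU z₁) (cU z₁) (yV z') →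
      IsComb b' (yV z') (cV z') (xU z₁) → IsComb b (xU z₂) (cU z₂) (yV z') →
      IsComb b' (yV z') (cV z') (xU z₂) → z₁ = z₂ := by
    intro z' z₁ z₂ h1 h2 h3 h4
    have hx : xU z₁ = xU z₂ := h2.unique z'.2.1.1 h4
    rw [← hx] at h3
    exact Subtype.ext (Prod.ext (Subtype.ext hx) (h1.unique_coeff z₁.2.1 h3))
  have huV : ∀ (z : U) (z₁ z₂ : V), IsComb b (xU z) (cU z) (yV z₁) →
      IsComb b' (yV z₁) (cV z₁) (xU z) → IsComb b (xU z) (cU z) (yV z₂) →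
      IsComb b' (yV z₂) (cV z₂) (xU z) → z₁ = z₂ := by
    intro z z₁ z₂ h1 h2 h3 h4
    have hy : yV z₁ = yV z₂ := h1.unique z.2.1 h3
    rw [← hy] at h4
    exact Subtype.ext (Prod.ext hy (h2.unique_coeff z₁.2.1.1 h4))
  choose f hf₁ hf₂ using hf
  choose f' hg₁ hg₂ using hg
  let e : U ≃ V :=
    { toFun := f
      invFun := f'
      left_inv := fun z => huU (f z) _ _ (hg₁ _) (hg₂ _) (hf₁ _) (hf₂ _)
      right_inv := fun z => huV (f' z) _ _ (hf₁ _) (hf₂ _) (hg₁ _) (hg₂ _) }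
  have hUne : U.Nonempty := by
    obtain ⟨y, hy, c', x, hx, hxL⟩ := hne
    exact ⟨_, (f' ⟨(pair y c' : (Y.prod P').carrier), ⟨hli y hy, x, hxL, hx⟩, hy⟩).2⟩
  have hVne : V.Nonempty := ⟨_, (f ⟨_, hUne.some_mem⟩).2⟩
  have hirrX : IrreducibleSpace X.carrier := hirr
  have hirrP : IrreducibleSpace P.carrier := irreducibleSpace_projectivization
  have hirrP' : IrreducibleSpace P'.carrier := irreducibleSpace_projectivization
  have hirrY : IrreducibleSpace Y.carrier := irreducibleSpace_projectivization
  have hirr₁ := irreducibleSpace_prod X P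
  have hirr₂ := irreducibleSpace_prod Y P'
  have hvU := isMorphism_restrict_val (X.prod P) U
  have hvV := isMorphism_restrict_val (Y.prod P') V
  have hyf : IsMorphism ((X.prod P).restrict U) Y (fun z => yV (f z)) :=
    isMorphism_of_isComb hb (hxU.comp hvU) (hcU.comp hvU) (fun z => z.2.1) hf₁
  -- The morphism to `Y` is needed first: `c'` solves the system formed by the values of `b'` at
  -- `y`.
  have hcf : IsMorphism ((X.prod P).restrict U) P' (fun z => cV (f z)) :=
    isMorphism_coeff_of_isComb hb' hyf (hxU.comp hvU) (fun z => (f z).2.1.1) hf₂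
  have hxg : IsMorphism ((Y.prod P').restrict V) (projSpace k A) (fun z => xU (f' z)) :=
    isMorphism_of_isComb hb' (hyV.comp hvV) (hcV.comp hvV) (fun z => z.2.1.1) hg₂
  have hcg : IsMorphism ((Y.prod P').restrict V) P (fun z => cU (f' z)) :=
    isMorphism_coeff_of_isComb hb hxg (hyV.comp hvV) (fun z => (f' z).2.1) hg₁
  have hxg' : IsMorphism ((Y.prod P').restrict V) X (fun z => fst (f' z).1) :=
    isMorphism_restrict_of_val hxg
  refine ⟨U, V, hUG, hVG, e, hUo, hUo.dense hUne, hVo, hVo.dense hVne,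
    isMorphism_restrict_of_val (isMorphism_prodMk hyf hcf),
    isMorphism_restrict_of_val (isMorphism_prodMk hxg' hcg), ?_⟩
  intro g z
  let fz : (YG.restrict V hVG).carrier := f z
  let z₁ : V := g • fz
  let z₂ : U := g • z
  have hc : cU z₂.1 = cU z.1 := smul_projTrivial g _
  have hc' : cV z₁.1 = cV (f z).1 := smul_projTrivial g _
  -- The relations defining the graph are equivariant, so `g • f z` satisfies those that
  -- characterize `f (g • z)`.
  refine huV z₂ (f z₂) z₁ (hf₁ _) (hf₂ _) ?_ ?_
  · rw [hc]
    exact (hf₁ z).smul hb heq g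
  · rw [hc']
    exact (hf₂ z).smul hb' heq' g

end Action

/-! ### Bivectors -/

section Wedge

variable {k : Type u} [Field k] {W : Type v} [AddCommGroup W] [Module k W]

theorem update_vec_zero {W : Type*} (a b x : W) : Function.update ![a, b] 0 x = ![x, b] := by
  ext i; fin_cases i <;> rfl

theorem update_vec_one {W : Type*} (a b x : W) : Function.update ![a, b] 1 x = ![a, x] := by
  ext i; fin_cases i <;> rfl

/-- The wedge product of two vectors. -/
noncomputable def wedge : W →ₗ[k] W →ₗ[k] ⋀[k]^2 W :=
  LinearMap.mk₂ k (fun a b => exteriorPower.ιMulti k 2 ![a, b])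
    (fun a a' b => by
      simpa only [update_vec_zero] using (exteriorPower.ιMulti k 2).map_update_add ![a, b] 0 a a')
    (fun c a b => by
      simpa only [update_vec_zero] using (exteriorPower.ιMulti k 2).map_update_smul ![a, b] 0 c a)
    (fun a b b' => by
      simpa only [update_vec_one] using (exteriorPower.ιMulti k 2).map_update_add ![a, b] 1 b b')
    (fun c a b => by
      simpa only [update_vec_one] using (exteriorPower.ιMulti k 2).map_update_smul ![a, b] 1 c b)

theorem wedge_apply (a b : W) : wedge (k := k) a b = exteriorPower.ιMulti k 2 ![a, b] := rfl

theorem wedge_self (a : W) : wedge (k := k) a a = 0 :=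
  (exteriorPower.ιMulti k 2).map_eq_zero_of_eq ![a, a] (i := 0) (j := 1) rfl (by decide)

theorem wedge_swap (a b : W) : wedge (k := k) a b = -wedge (k := k) b a := by
  have h := wedge_self (k := k) (a + b)
  simp only [map_add, LinearMap.add_apply, wedge_self, zero_add, add_zero] at h
  exact eq_neg_of_add_eq_zero_right h

theorem exteriorSquare_wedge {G : Type w} [Group G] (ρ : Representation k G W) (g : G) (a b : W) :
    exteriorSquare ρ g (wedge a b) = wedge (k := k) (ρ g a) (ρ g b) := by
  rw [wedge_apply, wedge_apply]
  refine (exteriorPower.map_apply_ιMulti (ρ g) ![a, b]).trans ?_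
  congr 1
  ext i
  fin_cases i <;> rfl

theorem span_wedge : Submodule.span k {p | ∃ a b : W, p = wedge (k := k) a b} = ⊤ := by
  rw [eq_top_iff, ← exteriorPower.ιMulti_span k 2 W, Submodule.span_le]
  rintro _ ⟨a, rfl⟩
  refine Submodule.subset_span ⟨a 0, a 1, ?_⟩
  rw [wedge_apply]
  congr 1
  ext i
  fin_cases i <;> rfl

/-- The contraction of bivectors by a linear form. -/
noncomputable def contraction (ξ : Module.Dual k W) : ⋀[k]^2 W →ₗ[k] W :=
  exteriorPower.alternatingMapLinearEquiv
    { toFun := fun a => ξ (a 0) • a 1 - ξ (a 1) • a 0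
      map_update_add' := by
        intro _ m i x y
        fin_cases i
        · simp [add_smul]; abel
        · simp [add_smul]; abel
      map_update_smul' := by
        intro _ m i c x
        fin_cases i
        · simp [smul_sub, mul_smul, smul_comm c]
        · simp [smul_sub, mul_smul, smul_comm c]
      map_eq_zero_of_eq' := by
        intro a i j h hij
        have : a 0 = a 1 := by
          fin_cases i <;> fin_cases j <;> simp_all
        simp [this] }

theorem contraction_wedge (ξ : Module.Dual k W) (a b : W) :
    contraction ξ (wedge (k := k) a b) = ξ a • b - ξ b • a := by
  rw [wedge_apply, contraction, exteriorPower.alternatingMapLinearEquiv_apply_ιMulti]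
  rfl

theorem wedge_eq_zero_iff {a b : W} (ha : a ≠ 0) :
    wedge (k := k) a b = 0 ↔ b ∈ Submodule.span k {a} := by
  constructor
  · intro h
    obtain ⟨ξ, hξ⟩ : ∃ ξ : Module.Dual k W, ξ a ≠ 0 := by
      by_contra! h'
      exact ha ((Module.forall_dual_apply_eq_zero_iff k _).1 h')
    have h1 := congrArg (contraction ξ) h
    rw [contraction_wedge, map_zero, sub_eq_zero] at h1
    refine Submodule.mem_span_singleton.2 ⟨(ξ a)⁻¹ * ξ b, ?_⟩
    rw [mul_smul, ← h1, smul_smul, inv_mul_cancel₀ hξ, one_smul]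
  · rintro h
    obtain ⟨c, rfl⟩ := Submodule.mem_span_singleton.1 h
    rw [map_smul, wedge_self, smul_zero]

theorem wedge_ne_zero_iff {a b : W} :
    wedge (k := k) a b ≠ 0 ↔ LinearIndependent k ![a, b] := by
  rw [LinearIndependent.pair_iff]
  constructor
  · intro h s t hst
    have h1 := congrArg (wedge (k := k) a) hst
    have h2 := congrArg (fun x => wedge (k := k) x b) hst
    simp only [map_add, map_smul, wedge_self, smul_zero, zero_add, map_zero, LinearMap.add_apply,
      LinearMap.smul_apply, add_zero, LinearMap.zero_apply, smul_eq_zero] at h1 h2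
    tauto
  · intro h h0
    have ha : a ≠ 0 := by
      rintro rfl
      exact one_ne_zero (h 1 0 (by simp)).1
    obtain ⟨c, rfl⟩ := Submodule.mem_span_singleton.1 ((wedge_eq_zero_iff ha).1 h0)
    exact one_ne_zero (neg_eq_zero.1 (h c (-1) (by simp)).2)

theorem mem_grassmannian_iff {x : ℙ k (⋀[k]^2 W)} : x ∈ grassmannian k W ↔
    ∃ a b : W, wedge (k := k) a b ≠ 0 ∧ wedge (k := k) a b ∈ x.submodule := by
  constructor
  · rintro ⟨a, ha, hx⟩
    have h : ![a 0, a 1] = a := by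
      ext i
      fin_cases i <;> rfl
    refine ⟨a 0, a 1, wedge_ne_zero_iff.2 (by rwa [h]), ?_⟩
    rw [hx, wedge_apply, h]
    exact Submodule.mem_span_singleton_self _
  · rintro ⟨a, b, h, hx⟩
    exact ⟨![a, b], wedge_ne_zero_iff.1 h, submodule_eq_span h hx⟩

theorem contraction_wedge_mem (ξ : Module.Dual k W) (a b : W) :
    contraction ξ (wedge (k := k) a b) ∈ Submodule.span k {a, b} := by
  rw [contraction_wedge]
  exact Submodule.sub_mem _ (Submodule.smul_mem _ _ (Submodule.subset_span (by simp)))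
    (Submodule.smul_mem _ _ (Submodule.subset_span (by simp)))

/-- A plane that contains the nonzero vector `w` is spanned by `w` and some other vector. -/
theorem exists_wedge_eq {a b w : W} (hw : w ≠ 0) (h : w ∈ Submodule.span k {a, b}) :
    ∃ x, wedge (k := k) a b = wedge (k := k) w x := by
  obtain ⟨s, t, rfl⟩ := Submodule.mem_span_pair.1 h
  by_cases hs : s = 0
  · subst hs
    have ht : t ≠ 0 := by rintro rfl; simp at hw
    refine ⟨-(t⁻¹ • a), ?_⟩
    simp only [zero_smul, zero_add, map_smul, map_neg, LinearMap.smul_apply, smul_smul]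
    rw [inv_mul_cancel₀ ht, one_smul, wedge_swap]
  · refine ⟨s⁻¹ • b, ?_⟩
    simp only [map_smul, map_add, LinearMap.add_apply, LinearMap.smul_apply, wedge_self, smul_zero,
      add_zero, smul_smul]
    rw [inv_mul_cancel₀ hs, one_smul]

end Wedge

/-! ### Equivariant polynomial maps -/

section Average

variable {k : Type u} [Field k] {G : Type w} [Group G] {A : Type v} [AddCommGroup A] [Module k A]
  {B : Type v'} [AddCommGroup B] [Module k B]

/-- A form that vanishes on the orbit of a vector with trivial stabilizer in the projective space,
outside of this vector. -/
theorem exists_form_orbit [Finite G] (ρ : Representation k G A) {a : A}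
    (h : ∀ g : G, g ≠ 1 → a ∉ Submodule.span k {ρ g a}) :
    ∃ (e : ℕ) (f : A → k), IsForm e f ∧ f a = 1 ∧ ∀ g : G, g ≠ 1 → f (ρ g a) = 0 := by
  classical
  have := Fintype.ofFinite G
  have h1 : ∀ g : G, ∃ l : Module.Dual k A, g ≠ 1 → l a = 1 ∧ l (ρ g a) = 0 := by
    intro g
    by_cases hg : g = 1
    · exact ⟨0, fun h => absurd hg h⟩
    · obtain ⟨l, hl, hl'⟩ := Submodule.exists_le_ker_of_notMem (h g hg)
      refine ⟨(l a)⁻¹ • l, fun _ => ⟨?_, ?_⟩⟩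
      · simp [hl]
      · have : l (ρ g a) = 0 := hl' (Submodule.mem_span_singleton_self _)
        simp [this]
  choose l hl using h1
  -- The factor for `g` is normalized to 1 at `a` and kills `ρ g a`, which is possible because these
  -- two span different lines.
  refine ⟨_, fun x => ∏ g ∈ Finset.univ.erase 1, l g x,
    IsForm.prod _ fun g _ => isForm_linear (l g), ?_, ?_⟩
  · exact Finset.prod_eq_one fun g hg => (hl g (Finset.ne_of_mem_erase hg)).1
  · intro g hg
    exact Finset.prod_eq_zero (Finset.mem_erase.2 ⟨hg, Finset.mem_univ g⟩) (hl g hg).2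

/-- The average over the group of the map `f • σ`. -/
noncomputable def average [Fintype G] (ρA : Representation k G A) (ρB : Representation k G B)
    (f : A → k) (σ : A → B) (a : A) : B :=
  ∑ g : G, f (ρA g⁻¹ a) • ρB g (σ (ρA g⁻¹ a))

variable [Fintype G] {ρA : Representation k G A} {ρB : Representation k G B} {f : A → k} {σ : A → B}

theorem isFormMap_average {d e : ℕ} (hf : IsForm e f) (hσ : IsFormMap k d σ) :
    IsFormMap k (e + d) (average ρA ρB f σ) := by
  refine IsFormMap.sum _ fun g _ => IsFormMap.smul ?_ ?_
  · simpa using (isFormMap_linear (ρA g⁻¹)).isForm_comp hf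
  · simpa using ((isFormMap_linear (ρA g⁻¹)).comp hσ).linear_comp (ρB g)

theorem average_equivariant (g : G) (a : A) :
    average ρA ρB f σ (ρA g a) = ρB g (average ρA ρB f σ a) := by
  rw [average, average, map_sum]
  refine (Fintype.sum_equiv (Equiv.mulLeft g) _ _ fun h => ?_).symm
  rw [Equiv.coe_mulLeft, mul_inv_rev, map_mul, map_smul, map_mul]
  simp only [Module.End.mul_apply]
  rw [← Module.End.mul_apply (ρA g⁻¹), ← map_mul, inv_mul_cancel, map_one]
  rfl

/-- Only the summand of the identity survives at `a`. Hence vectors independent at the free point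
before averaging stay independent there. -/
theorem average_eq {a : A} (h1 : f a = 1) (h : ∀ g : G, g ≠ 1 → f (ρA g a) = 0) :
    average ρA ρB f σ a = σ a := by
  rw [average, Finset.sum_eq_single 1]
  · simp [h1]
  · intro g _ hg
    rw [h _ (inv_ne_one.2 hg), zero_smul]
  · simp

theorem average_mem {K : A → Submodule k B} (hK : ∀ g a x, x ∈ K a → ρB g x ∈ K (ρA g a)) {a : A}
    (h : ∀ g, σ (ρA g a) ∈ K (ρA g a)) : average ρA ρB f σ a ∈ K a := by
  refine Submodule.sum_mem _ fun g _ => Submodule.smul_mem _ _ ?_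
  have := hK g _ _ (h g⁻¹)
  rwa [← Module.End.mul_apply (ρA g), ← map_mul, mul_inv_cancel, map_one] at this

end Average

/-! ### Polynomial sections of the kernel of a matrix of linear forms -/

/-- Minimality of the kernel at `u₀` means maximality of the rank, so near `u₀` the kernel is cut
out by a fixed invertible minor and Cramer's rule extends every kernel vector polynomially. The
degree does not depend on `x`, as a family used in `IsComb` requires. -/
theorem exists_formMap_ker {k : Type*} [Field k] {U W Q : Type*} [AddCommGroup U] [Module k U]
    [AddCommGroup W] [Module k W] [AddCommGroup Q] [Module k Q] [FiniteDimensional k W]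
    (Ω : U →ₗ[k] W →ₗ[k] Q) (u₀ : U)
    (h : ∀ u, Module.finrank k (Ω u₀).ker ≤ Module.finrank k (Ω u).ker) :
    ∃ d, ∀ x ∈ (Ω u₀).ker, ∃ σ : U → W, IsFormMap k d σ ∧ (∀ u, σ u ∈ (Ω u).ker) ∧ σ u₀ = x := by
  classical
  let s := Module.finrank k (Ω u₀).range
  let β := Module.finBasis k (Ω u₀).range
  have hβ : ∀ i, ∃ y, Ω u₀ y = β i := fun i => LinearMap.mem_range.1 (β i).2
  choose J hJ using hβ
  have hli : LinearIndependent k (fun i => Ω u₀ (J i)) := by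
    rw [funext hJ]
    exact β.linearIndependent.map' (Ω u₀).range.subtype (Ω u₀).range.ker_subtype
  obtain ⟨π, hπ⟩ := exists_dual_family hli
  let M : U → Matrix (Fin s) (Fin s) k := fun u => Matrix.of fun i j => π (Ω u (J j)) i
  have hlin : ∀ x i, IsForm 1 (fun u => π (Ω u x) i) := fun x i =>
    isForm_linear (LinearMap.proj i ∘ₗ π ∘ₗ Ω.flip x)
  have hM0 : M u₀ = 1 := by
    ext i j
    simp [M, hπ, Matrix.one_apply, Pi.single_apply]
  have hdet : IsForm s (fun u => (M u).det) := by
    simpa using isForm_det (M := M) (d := fun _ => 1) fun i j => hlin (J j) i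
  -- If the minor is nonzero, `π ∘ Ω u` has rank at least `s`, hence a kernel no larger than that of
  -- `Ω u₀`, and so no larger than that of `Ω u`. The two nested kernels of `Ω u` and `π ∘ Ω u`
  -- therefore agree.
  have hker : ∀ u, (M u).det ≠ 0 → ∀ x, π (Ω u x) = 0 → Ω u x = 0 := by
    intro u hu x hx
    have hle : (Ω u).ker ≤ (π ∘ₗ Ω u).ker := LinearMap.ker_le_ker_comp _ _
    have hli' : LinearIndependent k (fun j => (π ∘ₗ Ω u) (J j)) :=
      Matrix.linearIndependent_cols_of_det_ne_zero hu
    have hli'' : LinearIndependent k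
        (fun j => (⟨(π ∘ₗ Ω u) (J j), LinearMap.mem_range_self _ _⟩ : (π ∘ₗ Ω u).range)) :=
      LinearIndependent.of_comp (Submodule.subtype _) hli'
    have hs : s ≤ Module.finrank k (π ∘ₗ Ω u).range := by
      simpa using hli''.fintype_card_le_finrank
    have h1 := (π ∘ₗ Ω u).finrank_range_add_finrank_ker
    have h2 : s + _ = _ := (Ω u₀).finrank_range_add_finrank_ker
    have h3 := h u
    have heq := Submodule.eq_of_le_of_finrank_le hle (by omega)
    have : x ∈ (π ∘ₗ Ω u).ker := hx
    rwa [← heq] at this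
  refine ⟨s + s, fun x hx => ?_⟩
  let c : U → Fin s → k := fun u => (M u).cramer (π (Ω u x))
  have hc : ∀ i, IsForm s (fun u => c u i) := by
    intro i
    simp only [c, Matrix.cramer_apply]
    have := isForm_det (M := fun u => (M u).updateCol i (π (Ω u x))) (d := fun _ => 1) fun i' j => by
      by_cases hj : j = i
      · subst hj
        simpa using hlin x i'
      · simp only [Matrix.updateCol_ne hj]
        exact hlin (J j) i'
    simpa using this
  -- Cramer's rule: the component of `det M • x` seen by `π ∘ Ω u` is cancelled by a combination of
  -- the `J j`.
  let τ : U → W := fun u => (M u).det • x + (-1 : k) • ∑ j, c u j • J j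
  have hconst : ∀ y : W, IsFormMap k 0 (fun _ : U => y) := fun y l => isForm_const (l y)
  have hτ : IsFormMap k s τ := by
    refine IsFormMap.add (IsFormMap.smul hdet (hconst x)) ?_
    have := IsFormMap.smul (isForm_const (A := U) (-1 : k))
      (IsFormMap.sum Finset.univ fun j _ => IsFormMap.smul (hc j) (hconst (J j)))
    simpa using this
  have hπτ : ∀ u, π (Ω u (τ u)) = 0 := by
    intro u
    have h1 : π (Ω u (∑ j, c u j • J j)) = (M u).mulVec (c u) := by
      ext i
      simp only [M, Matrix.mulVec, dotProduct, map_sum, map_smul, Finset.sum_apply, Pi.smul_apply,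
        smul_eq_mul, Matrix.of_apply]
      exact Finset.sum_congr rfl fun j _ => mul_comm _ _
    rw [map_add, map_add, map_smul, map_smul, map_smul, map_smul, h1, Matrix.mulVec_cramer,
      neg_one_smul, add_neg_cancel]
  -- `τ u` is known to lie in the kernel only where the minor is nonzero; the second factor `det M`
  -- makes the section zero elsewhere. It equals 1 at `u₀`.
  refine ⟨fun u => (M u).det • τ u, IsFormMap.smul hdet hτ, fun u => ?_, ?_⟩
  · change (M u).det • τ u ∈ (Ω u).ker
    by_cases hu : (M u).det = 0
    · rw [hu, zero_smul]; exact Submodule.zero_mem _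
    · exact Submodule.smul_mem _ _ (hker u hu _ (hπτ u))
  · have hx0 : Ω u₀ x = 0 := hx
    have hc0 : c u₀ = 0 := by
      simp only [c, hx0, map_zero]
    simp only [τ, hc0, hM0, Matrix.det_one, one_smul, Pi.zero_apply, zero_smul,
      Finset.sum_const_zero, smul_zero, add_zero]

/-! ### A lower bound for the dimension of a parametrized set -/

section Dimension

variable {k : Type u} [Field k] [Infinite k] {A : Type v} [AddCommGroup A] [Module k A]

/-- The closures of the images of the `D i` form a chain of irreducible closed sets. It is strict
because the `i`-th image lies in the closed linear space `ℙ(V i)` and the next one does not. -/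
theorem le_topologicalKrullDim_of_parametrized {S : Set (ℙ k A)} {E : Type*} [AddCommGroup E]
    [Module k E] {F : E → A} (hF : ∀ l : Module.Dual k A, PolyOnLines (fun e => l (F e)))
    (hS : ∀ e, F e ≠ 0 → ∀ x : ℙ k A, F e ∈ x.submodule → x ∈ S) (N : ℕ)
    {D : ℕ → Submodule k E} (hD : Monotone D) (h0 : ∃ e ∈ D 0, F e ≠ 0) (V : ℕ → Submodule k A)
    (hV : ∀ i < N, ∀ e ∈ D i, F e ∈ V i) (hne : ∀ i < N, ∃ e ∈ D (i + 1), F e ∉ V i) :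
    (N : WithBot ℕ∞) ≤ topologicalKrullDim S := by
  let T : ℕ → Set S := fun i => {x | ∃ e ∈ D i, F e ≠ 0 ∧ F e ∈ x.1.submodule}
  have himg : ∀ i, Subtype.val '' T i = {x : ℙ k A | ∃ e ∈ D i, F e ≠ 0 ∧ F e ∈ x.submodule} := by
    intro i
    ext x
    constructor
    · rintro ⟨x, hx, rfl⟩; exact hx
    · rintro ⟨e, he, h, hx⟩; exact ⟨⟨x, hS e h x hx⟩, ⟨e, he, h, hx⟩, rfl⟩
  have hirr : ∀ i, IsIrreducible (T i) := by
    intro i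
    obtain ⟨e, he, h⟩ := h0
    have h1 := isIrreducible_parametrized (D i) hF ⟨e, hD (Nat.zero_le i) he, h⟩
    rw [← himg] at h1
    refine ⟨h1.nonempty.of_image, ?_⟩
    rintro U V hU hV ⟨x, hxT, hxU⟩ ⟨y, hyT, hyV⟩
    obtain ⟨U', hU', rfl⟩ := isOpen_induced_iff.1 hU
    obtain ⟨V', hV', rfl⟩ := isOpen_induced_iff.1 hV
    obtain ⟨_, ⟨z, hz, rfl⟩, hzU, hzV⟩ := h1.2 U' V' hU' hV' ⟨x, ⟨x, hxT, rfl⟩, hxU⟩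
      ⟨y, ⟨y, hyT, rfl⟩, hyV⟩
    exact ⟨z, hz, hzU, hzV⟩
  let C : ℕ → TopologicalSpace.IrreducibleCloseds S := fun i =>
    ⟨closure (T i), (hirr i).closure, isClosed_closure⟩
  let s : LTSeries (TopologicalSpace.IrreducibleCloseds S) :=
    { length := N
      toFun := fun i => C i
      step := by
        intro i
        change C i < C (i + 1)
        obtain ⟨e, he, hne⟩ := hne i i.2
        have hle : closure (T i) ⊆ closure (T (i + 1)) :=
          closure_mono fun x ⟨e, he, h⟩ => ⟨e, hD (Nat.le_succ i) he, h⟩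
        refine lt_of_le_of_ne hle fun heq => ?_
        have heq : closure (T i) = closure (T (i + 1)) :=
          congrArg TopologicalSpace.IrreducibleCloseds.carrier heq
        have hFe : F e ≠ 0 := fun h => hne (h ▸ Submodule.zero_mem _)
        have hx : (⟨mk k (F e) hFe, hS e hFe _ (mk_mem_submodule hFe)⟩ : S) ∈ T (i + 1) :=
          ⟨e, he, hFe, mk_mem_submodule hFe⟩
        have hcl : closure (T i) ⊆ Subtype.val ⁻¹' projSubspace (V i) := by
          refine closure_minimal ?_ ((isClosed_projSubspace (V i)).preimage continuous_subtype_val)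
          rintro x ⟨e, he, h, hx⟩
          change x.1.submodule ≤ V i
          rw [submodule_eq_span h hx, Submodule.span_singleton_le_iff_mem]
          exact hV i i.2 e he
        have h1 := hcl (heq ▸ subset_closure hx)
        exact hne (h1 (mk_mem_submodule hFe)) }
  exact Order.LTSeries.length_le_krullDim s

end Dimension

/-! ### Planes of the section through a vector, and a lower bound for the dimension of the section
-/

section Kernel

variable {k : Type u} [Field k] {W : Type v} [AddCommGroup W] [Module k W]

/-- The pairing `(w, x) ↦ w ∧ x` with values in the quotient of `⋀² W` by a subspace. -/
noncomputable def wedgeMod (V : Submodule k (⋀[k]^2 W)) : W →ₗ[k] W →ₗ[k] (⋀[k]^2 W ⧸ V) :=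
  wedge.compr₂ V.mkQ

theorem mem_ker_wedgeMod {V : Submodule k (⋀[k]^2 W)} {w x : W} :
    x ∈ (wedgeMod V w).ker ↔ wedge w x ∈ V := by
  rw [LinearMap.mem_ker, wedgeMod, LinearMap.compr₂_apply, Submodule.mkQ_apply,
    Submodule.Quotient.mk_eq_zero]

theorem self_mem_ker_wedgeMod (V : Submodule k (⋀[k]^2 W)) (w : W) : w ∈ (wedgeMod V w).ker := by
  rw [mem_ker_wedgeMod, wedge_self]
  exact V.zero_mem

variable [FiniteDimensional k W]

/-- The kernel of `w ∧ ·` is the line spanned by `w`, so planes through `w` inside `K` correspond to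
lines of `K / ⟨w⟩`. -/
theorem finrank_map_wedge {K : Submodule k W} {w : W} (hw : w ≠ 0) (hK : w ∈ K) :
    Module.finrank k (K.map (wedge (k := k) w)) + 1 = Module.finrank k K := by
  have h1 := LinearMap.finrank_range_add_finrank_ker ((wedge (k := k) w).domRestrict K)
  have h2 : ((wedge (k := k) w).domRestrict K).range = K.map (wedge (k := k) w) :=
    LinearMap.range_domRestrict _ _
  have h3 : ((wedge (k := k) w).domRestrict K).ker = Submodule.span k {⟨w, hK⟩} := by
    ext x
    rw [LinearMap.mem_ker, LinearMap.domRestrict_apply, wedge_eq_zero_iff hw,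
      Submodule.mem_span_singleton, Submodule.mem_span_singleton]
    simp [Subtype.ext_iff]
  have h4 : (⟨w, hK⟩ : K) ≠ 0 := fun h => hw (congrArg Subtype.val h)
  rw [h2, h3, finrank_span_singleton h4] at h1
  exact h1

theorem exists_linearIndependent_map {A : Type*} [AddCommGroup A] [Module k A] (T : W →ₗ[k] A)
    {K : Submodule k W} {m : ℕ} (hm : Module.finrank k (K.map T) = m) :
    ∃ x : Fin m → W, (∀ j, x j ∈ K) ∧ LinearIndependent k (fun j => T (x j)) := by
  have β : Module.Basis (Fin m) k (K.map T) := Module.finBasisOfFinrankEq k (K.map T) hm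
  have h : ∀ j, ∃ x ∈ K, T x = β j := fun j => Submodule.mem_map.1 (β j).2
  choose x hx hx' using h
  refine ⟨x, hx, ?_⟩
  have h2 : LinearIndependent k (fun j => (β j : A)) :=
    β.linearIndependent.map' (K.map T).subtype (K.map T).ker_subtype
  rw [funext hx']
  exact h2

theorem exists_linearIndependent_wedge {K : Submodule k W} {w : W} (hw : w ≠ 0) (hK : w ∈ K)
    {m : ℕ} (hm : Module.finrank k K = m + 2) :
    ∃ x : Fin (m + 1) → W, (∀ j, x j ∈ K) ∧
      LinearIndependent k (fun j => wedge (k := k) w (x j)) :=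
  exists_linearIndependent_map _ (by have := finrank_map_wedge hw hK; omega)

theorem exists_flag {U T : Submodule k W} (hUT : U ≤ T) :
    ∀ N, Module.finrank k T = Module.finrank k U + N →
    ∃ H : ℕ → Submodule k W, Monotone H ∧ H 0 = U ∧ (∀ i, H i ≤ T) ∧ ∀ i < N, H i < H (i + 1) := by
  intro N
  induction N generalizing U with
  | zero => exact fun _ => ⟨fun _ => U, monotone_const, rfl, fun _ => hUT, by simp⟩
  | succ N ih =>
    intro h
    have hlt : U < T := lt_of_le_of_ne hUT (by rintro rfl; omega)
    obtain ⟨t, htT, htU⟩ := SetLike.exists_of_lt hlt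
    have hfin : Module.finrank k (U ⊔ Submodule.span k {t} : Submodule k W) =
        Module.finrank k U + 1 :=
      Submodule.finrank_sup_span_singleton htU
    obtain ⟨H, hH, hH0, hHT, hHlt⟩ := ih (U := U ⊔ Submodule.span k {t})
      (sup_le hUT ((Submodule.span_singleton_le_iff_mem _ _).2 htT)) (by omega)
    have hU : U < H 0 := by
      rw [hH0]
      refine lt_of_le_of_ne le_sup_left fun heq => htU ?_
      rw [heq]
      exact Submodule.mem_sup_right (Submodule.mem_span_singleton_self t)
    refine ⟨fun i => Nat.casesOn i U H, monotone_nat_of_le_succ ?_, rfl, ?_, ?_⟩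
    · rintro (_ | i)
      · exact hU.le
      · exact hH (Nat.le_succ i)
    · rintro (_ | i)
      · exact hUT
      · exact hHT i
    · rintro (_ | i) hi
      · exact hU
      · exact hHlt i (by omega)

/-- The section contains the planes `w ∧ ∑ c_j s_j(w)`, with `s_j` polynomial sections of the
kernels. Fixing `w = w₀` and releasing the coefficients one by one gives `m` steps; moving `w` along
a flag in a hyperplane `ξ = 0` through `w₀` gives `n - 2` more. Contraction by `ξ` recovers the line
of `w`, which separates the later steps. -/
theorem le_topologicalKrullDim_grassmannianSection [Infinite k] (V : Submodule k (⋀[k]^2 W))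
    {w₀ : W} (hw₀ : w₀ ≠ 0)
    (hmin : ∀ w, Module.finrank k (wedgeMod V w₀).ker ≤ Module.finrank k (wedgeMod V w).ker)
    {m : ℕ} (hm : Module.finrank k (wedgeMod V w₀).ker = m + 2) :
    ((m + (Module.finrank k W - 2) : ℕ) : WithBot ℕ∞) ≤
      topologicalKrullDim ↥(grassmannian k W ∩ projSubspace V) := by
  classical
  obtain ⟨x, hxK, hx⟩ := exists_linearIndependent_wedge hw₀ (self_mem_ker_wedgeMod V w₀) hm
  obtain ⟨d, hd⟩ := exists_formMap_ker (wedgeMod V) w₀ hmin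
  choose s hs hsK hs₀ using fun j => hd (x j) (hxK j)
  have hx0 : x 0 ∉ Submodule.span k {w₀} := fun h =>
    hx.ne_zero 0 ((wedge_eq_zero_iff hw₀).2 h)
  obtain ⟨ξ, hξ, hξ'⟩ := Submodule.exists_le_ker_of_notMem hx0
  have hfin : Module.finrank k ξ.ker = Module.finrank k W - 1 := by
    have h : ξ ≠ 0 := by rintro rfl; exact hξ rfl
    have := Module.Dual.finrank_ker_add_one_of_ne_zero h
    omega
  have hfin2 : 2 ≤ Module.finrank k W := by
    have := (wedgeMod V w₀).ker.finrank_le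
    omega
  obtain ⟨H, hH, hH0, hHT, hHlt⟩ := exists_flag hξ' (Module.finrank k W - 2) (by
    rw [finrank_span_singleton hw₀, hfin]; omega)
  have hHξ : ∀ i, ∀ w ∈ H i, ξ w = 0 := fun i w hw => hHT i hw
  have hH0w : ∀ i, w₀ ∈ H i := fun i =>
    hH (Nat.zero_le i) (hH0 ▸ Submodule.mem_span_singleton_self w₀)
  let F : W × (Fin (m + 1) → k) → ⋀[k]^2 W := fun e => wedge e.1 (∑ j, e.2 j • s j e.1)
  -- By truncated subtraction `w` stays on the line of `w₀` while `i ≤ m`; for `i ≥ m` the condition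
  -- on the coefficients is empty.
  let D : ℕ → Submodule k (W × (Fin (m + 1) → k)) := fun i =>
    (H (i - m)).prod (⨅ j : Fin (m + 1), ⨅ _ : i < j, (LinearMap.proj j).ker)
  have hDmem : ∀ i e, e ∈ D i ↔ e.1 ∈ H (i - m) ∧ ∀ j : Fin (m + 1), i < j → e.2 j = 0 := by
    intro i e
    simp [D, Submodule.mem_prod, Submodule.mem_iInf]
  have hFsum : ∀ e, F e = ∑ j, e.2 j • wedge e.1 (s j e.1) := fun e => by
    simp only [F, map_sum, map_smul]
  have hFsingle : ∀ w j, F (w, Pi.single j 1) = wedge w (s j w) := fun w j => by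
    simp [F]
  have hct : ∀ w c, ξ w = 0 → ∃ t : k, t = -ξ (∑ j, c j • s j w) ∧
      contraction ξ (F (w, c)) = t • w := by
    intro w c hw
    refine ⟨_, rfl, ?_⟩
    simp only [F]
    rw [contraction_wedge, hw, zero_smul, zero_sub, neg_smul]
  refine le_topologicalKrullDim_of_parametrized (F := F) ?_ ?_ _ (D := D) ?_ ?_
    (fun i => if i < m then Submodule.span k ((fun j => wedge w₀ (x j)) '' {j : Fin (m + 1) | j ≤ i})
      else (H (i - m)).comap (contraction ξ)) ?_ ?_
  · intro l
    simp only [hFsum, map_sum, map_smul, smul_eq_mul]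
    refine PolyOnLines.sum _ fun j _ => PolyOnLines.mul
      (PolyOnLines.linear (LinearMap.proj j ∘ₗ LinearMap.snd k W (Fin (m + 1) → k))) ?_
    exact (PolyOnLines.form (IsFormMap.bilinear wedge (hs j) l)).comp_linear
      (LinearMap.fst k W (Fin (m + 1) → k))
  · intro e he y hy
    refine ⟨mem_grassmannian_iff.2 ⟨_, _, he, hy⟩, ?_⟩
    change y.submodule ≤ V
    rw [submodule_eq_span he hy, Submodule.span_singleton_le_iff_mem]
    rw [← mem_ker_wedgeMod]
    exact Submodule.sum_mem _ fun j _ => Submodule.smul_mem _ _ (hsK j _)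
  · intro i j hij e he
    rw [hDmem] at he ⊢
    exact ⟨hH (Nat.sub_le_sub_right hij m) he.1, fun l hl => he.2 l (lt_of_le_of_lt hij hl)⟩
  · refine ⟨(w₀, Pi.single 0 1), (hDmem _ _).2 ⟨hH0w _, fun j hj => ?_⟩, ?_⟩
    · refine Pi.single_eq_of_ne ?_ _
      rintro rfl
      simp at hj
    · rw [hFsingle, hs₀]
      exact hx.ne_zero 0
  · rintro i - ⟨w, c⟩ he
    rw [hDmem] at he
    obtain ⟨hw, hc⟩ := he
    simp only at hw hc
    split_ifs with hi
    · rw [Nat.sub_eq_zero_of_le hi.le, hH0] at hw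
      obtain ⟨t, rfl⟩ := Submodule.mem_span_singleton.1 hw
      rw [hFsum]
      refine Submodule.sum_mem _ fun j _ => ?_
      simp only
      by_cases hj : i < j
      · rw [hc j hj, zero_smul]; exact Submodule.zero_mem _
      · rw [(hs j).map_smul, hs₀, map_smul, map_smul, LinearMap.smul_apply]
        exact Submodule.smul_mem _ _ (Submodule.smul_mem _ _ (Submodule.smul_mem _ _
          (Submodule.subset_span ⟨j, not_lt.1 hj, rfl⟩)))
    · obtain ⟨t, -, ht⟩ := hct w c (hHξ _ _ hw)
      rw [Submodule.mem_comap, ht]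
      exact Submodule.smul_mem _ _ hw
  · intro i hi
    split_ifs with him
    · refine ⟨(w₀, Pi.single ⟨i + 1, by omega⟩ 1), (hDmem _ _).2 ⟨hH0w _, fun j hj => ?_⟩, ?_⟩
      · refine Pi.single_eq_of_ne ?_ _
        rintro rfl
        simp at hj
      · rw [hFsingle, hs₀]
        refine hx.notMem_span_image ?_
        simp
    · obtain ⟨w₁, hw₁, hw₁'⟩ := SetLike.exists_of_lt (hHlt (i - m) (by omega))
      obtain ⟨η, hη, hη'⟩ := Submodule.exists_le_ker_of_notMem hw₁'
      have hη₀ : η w₀ = 0 := hη' (hH0w _)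
      -- The contraction of `F (w, e₀)` is `-ξ(s 0 w) • w`. To leave `H (i - m)` it needs `ξ(s 0 w)
      -- ≠ 0`, true at `w₀`, and `η w ≠ 0`, true at `w₁`; some point of the line joining them has
      -- both.
      obtain ⟨t, ht, ht'⟩ := (PolyOnLines.form (hs 0 ξ)).exists_ne_zero (PolyOnLines.linear η)
        (a := w₀) (b := w₁) (by rwa [hs₀]) hη
      set w := w₀ + t • (w₁ - w₀)
      have hw : w ∈ H (i - m + 1) := Submodule.add_mem _ (hH0w _)
        (Submodule.smul_mem _ _ (Submodule.sub_mem _ hw₁ (hH0w _)))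
      have him' : i + 1 - m = i - m + 1 := by omega
      refine ⟨(w, Pi.single 0 1), (hDmem _ _).2 ⟨by rwa [him'], fun j hj => ?_⟩, ?_⟩
      · refine Pi.single_eq_of_ne ?_ _
        rintro rfl
        simp at hj
      · obtain ⟨c, hc, hc'⟩ := hct w (Pi.single 0 1) (hHξ _ _ hw)
        rw [Submodule.mem_comap, hc']
        intro hmem
        have h1 : η (c • w) = 0 := hη' hmem
        rw [map_smul, smul_eq_mul, mul_eq_zero, or_iff_left ht', hc, neg_eq_zero] at h1
        refine ht ?_
        simpa [Pi.single_apply] using h1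

end Kernel

/-! ### Linear sections of a Grassmannian with a pointwise fixed automorphism -/

section LinearAlgebra

variable {k : Type*} [Field k] [IsAlgClosed k]

/-- An alternating bilinear map `A × A → Q` with `dim Q < dim A` for which all the maps `φ u`,
`u ≠ 0`, have one-dimensional kernel exists only if `dim A ≤ 2`. -/
theorem finrank_le_two_of_alternating {A Q : Type*} [AddCommGroup A] [Module k A]
    [FiniteDimensional k A] [AddCommGroup Q] [Module k Q] [FiniteDimensional k Q]
    (φ : A →ₗ[k] A →ₗ[k] Q) (halt : ∀ x, φ x x = 0)
    (hker : ∀ u u', u ≠ 0 → φ u u' = 0 → u' ∈ Submodule.span k {u})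
    (hQ : Module.finrank k Q + 1 ≤ Module.finrank k A) : Module.finrank k A ≤ 2 := by
  by_contra! hA
  have hswap : ∀ x y, φ x y = -φ y x := by
    intro x y
    have h := halt (x + y)
    simp only [map_add, LinearMap.add_apply, halt, zero_add, add_zero] at h
    exact eq_neg_of_add_eq_zero_right h
  have : Nontrivial A := Module.nontrivial_of_finrank_pos (R := k) (by omega)
  obtain ⟨u₀, hu₀⟩ := exists_ne (0 : A)
  obtain ⟨H, hH⟩ := Submodule.exists_isCompl (Submodule.span k {u₀})
  have hfin : 1 + Module.finrank k H = Module.finrank k A := by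
    rw [← Submodule.finrank_add_eq_of_isCompl hH, finrank_span_singleton hu₀]
  have hmemH : ∀ t : k, t • u₀ ∈ H → t = 0 := by
    intro t ht
    have : t • u₀ ∈ Submodule.span k {u₀} ⊓ H :=
      ⟨Submodule.smul_mem _ _ (Submodule.mem_span_singleton_self _), ht⟩
    rw [hH.inf_eq_bot, Submodule.mem_bot, smul_eq_zero] at this
    exact this.resolve_right hu₀
  let P : H →ₗ[k] Q := (φ u₀).domRestrict H
  have hP : Function.Injective P := by
    rw [← LinearMap.ker_eq_bot, LinearMap.ker_eq_bot']
    intro x hx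
    obtain ⟨t, ht⟩ := Submodule.mem_span_singleton.1 (hker u₀ x hu₀ hx)
    have := hmemH t (ht ▸ x.2)
    rw [this, zero_smul] at ht
    exact Subtype.ext ht.symm
  have hle := LinearMap.finrank_le_finrank_of_injective hP
  -- Injectivity gives `dim H ≤ dim Q` and the hypothesis gives the converse, so `φ u₀` identifies
  -- `H` with `Q`. Through this identification each `φ x` becomes an endomorphism `N x` of `H`, with
  -- `N x y = -N y x`.
  let e : H ≃ₗ[k] Q := LinearEquiv.ofInjectiveOfFinrankEq P hP (by omega)
  have he : ∀ y : H, e y = φ u₀ y := fun y => rfl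
  let N : H → H →ₗ[k] H := fun x => e.symm ∘ₗ (φ x).domRestrict H
  have hN : ∀ x y : H, φ u₀ (N x y) = φ x y := by
    intro x y
    rw [← he]
    exact e.apply_symm_apply _
  have hNswap : ∀ x y : H, N x y = -N y x := by
    intro x y
    refine hP ?_
    change φ u₀ (N x y : H) = φ u₀ ((-N y x : H) : A)
    rw [hN, Submodule.coe_neg, map_neg, hN]
    exact hswap _ _
  -- No `N x` has a nonzero eigenvalue: `φ (x - μ u₀)` would kill `y`, making `y` a multiple of `x -
  -- μ u₀`, and for `μ ≠ 0` the only such multiple in `H` is zero.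
  have heig : ∀ (x y : H) (μ : k), μ ≠ 0 → N x y = μ • y → y = 0 := by
    intro x y μ hμ hxy
    have h1 : φ ((x : A) - μ • u₀) y = 0 := by
      rw [map_sub, LinearMap.sub_apply, map_smul, LinearMap.smul_apply, ← hN, hxy,
        Submodule.coe_smul, map_smul, sub_self]
    have h2 : (x : A) - μ • u₀ ≠ 0 := fun h => hμ (hmemH μ (by
      rw [← sub_eq_zero.1 h]; exact x.2))
    obtain ⟨c, hc⟩ := Submodule.mem_span_singleton.1 (hker _ _ h2 h1)
    have h3 : (c * μ) • u₀ ∈ H := by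
      have : (c * μ) • u₀ = c • (x : A) - y := by rw [← hc, smul_sub, smul_smul]; abel
      rw [this]
      exact H.sub_mem (H.smul_mem _ x.2) y.2
    have hc0 : c = 0 := (mul_eq_zero.1 (hmemH _ h3)).resolve_right hμ
    rw [hc0, zero_smul] at hc
    exact Subtype.ext hc.symm
  have hkerN : ∀ x y : H, x ≠ 0 → N x y = 0 → y ∈ Submodule.span k {x} := by
    intro x y hx hxy
    have h1 : φ x y = 0 := by rw [← hN, hxy]; simp
    obtain ⟨c, hc⟩ := Submodule.mem_span_singleton.1
      (hker _ _ (fun h => hx (Subtype.ext h)) h1)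
    exact Submodule.mem_span_singleton.2 ⟨c, Subtype.ext hc⟩
  have : Nontrivial H := Module.nontrivial_of_finrank_pos (R := k) (by omega)
  obtain ⟨x, hx⟩ := exists_ne (0 : H)
  have hNx : N x x = 0 := hP (by
    change φ u₀ (N x x : H) = φ u₀ ((0 : H) : A)
    rw [hN, halt, Submodule.coe_zero, map_zero])
  let L : Submodule k H := Submodule.span k {x}
  have hL : L ≤ L.comap (N x) := by
    rw [Submodule.span_le, Set.singleton_subset_iff]
    change N x x ∈ L
    rw [hNx]
    exact L.zero_mem
  have hLfin : Module.finrank k L = 1 := finrank_span_singleton hx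
  have : Nontrivial (H ⧸ L) := by
    refine Module.nontrivial_of_finrank_pos (R := k) ?_
    have := L.finrank_quotient_add_finrank
    omega
  -- `dim A ≥ 3` makes `H / ⟨x⟩` nonzero, so over an algebraically closed field there is `y ∉ ⟨x⟩`
  -- with `N x y = μ y + c x`. If `μ = 0`, then `x` is an eigenvector of `N y` with eigenvalue `-c ≠
  -- 0`; otherwise `y + (c / μ) x` is one of `N x` with eigenvalue `μ`.
  obtain ⟨μ, hμ⟩ := Module.End.exists_eigenvalue (L.mapQ L (N x) hL)
  obtain ⟨q, hq⟩ := hμ.exists_hasEigenvector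
  obtain ⟨y, rfl⟩ := L.mkQ_surjective q
  have hy : y ∉ L := fun h => hq.2 (by simpa using h)
  have h1 := hq.apply_eq_smul
  rw [Submodule.mkQ_apply, Submodule.mapQ_apply, ← Submodule.Quotient.mk_smul,
    Submodule.Quotient.eq] at h1
  obtain ⟨c, hc⟩ := Submodule.mem_span_singleton.1 h1
  by_cases hμ0 : μ = 0
  · rw [hμ0, zero_smul, sub_zero] at hc
    have hc0 : c ≠ 0 := by
      rintro rfl
      rw [zero_smul] at hc
      exact hy (hkerN x y hx hc.symm)
    refine hx (heig y x (-c) (neg_ne_zero.2 hc0) ?_)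
    rw [hNswap, ← hc, neg_smul]
  · have h2 : y + (c / μ) • x = 0 := by
      refine heig x _ μ hμ0 ?_
      rw [map_add, map_smul, hNx, smul_zero, add_zero, smul_add, smul_smul,
        mul_div_cancel₀ _ hμ0, hc]
      abel
    refine hy ?_
    rw [eq_neg_of_add_eq_zero_left h2]
    exact L.neg_mem (L.smul_mem _ (Submodule.mem_span_singleton_self x))

end LinearAlgebra

/-! ### The section attached to a decomposition into two eigenspaces -/

section Fixed

variable {k : Type u} [Field k] {W : Type v} [AddCommGroup W] [Module k W]

/-- Contraction by a form that kills `a` but not `b` isolates `a` on the left and lands in the plane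
of `c` and `d` on the right. -/
theorem mem_span_of_wedge_eq {a b c d : W} {t : k} (h : wedge (k := k) a b ≠ 0)
    (heq : wedge a b = t • wedge (k := k) c d) : a ∈ Submodule.span k {c, d} := by
  have hb : b ≠ 0 := by rintro rfl; simp at h
  have hab : b ∉ Submodule.span k {a} := fun hab => by
    by_cases ha : a = 0
    · subst ha; simp at h
    · exact h ((wedge_eq_zero_iff ha).2 hab)
  obtain ⟨ξ, hξ, hξ'⟩ := Submodule.exists_le_ker_of_notMem hab
  have hξa : ξ a = 0 := hξ' (Submodule.mem_span_singleton_self a)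
  have h1 : ξ b • a ∈ Submodule.span k {c, d} := by
    have h2 := congrArg (contraction ξ) heq
    rw [contraction_wedge, hξa, zero_smul, zero_sub, map_smul] at h2
    rw [← Submodule.neg_mem_iff, h2]
    exact Submodule.smul_mem _ _ (contraction_wedge_mem ξ c d)
  exact (Submodule.smul_mem_iff _ hξ).1 h1

variable [FiniteDimensional k W]

theorem finrank_le_finrank_ker_wedgeMod (V : Submodule k (⋀[k]^2 W)) (w : W) :
    Module.finrank k W ≤ Module.finrank k (wedgeMod V w).ker +
      Module.finrank k (⋀[k]^2 W ⧸ V) := by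
  have h1 := (wedgeMod V w).finrank_range_add_finrank_ker
  have h2 := (wedgeMod V w).range.finrank_le
  omega

/-- Apply the lemma on alternating maps to `(u, u') ↦ u ∧ u'` modulo `V` and modulo `v₀ ∧ B`. The
second quotient lowers the dimension by at least `dim B - 1`. If `u ∧ u'` and `v₀ ∧ v'` agree modulo
`V`, then `(u + v₀) ∧ (u' - v') ∈ V`, the cross terms being in `A ∧ B ⊆ V`, so `u'` is a multiple of
`u`. -/
theorem finrank_le_two_of_ker_eq_span [IsAlgClosed k] {V : Submodule k (⋀[k]^2 W)}
    {A B : Submodule k W} (hAB : Disjoint A B)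
    (hfin : Module.finrank k (⋀[k]^2 W ⧸ V) + 2 = Module.finrank k A + Module.finrank k B)
    (hV : ∀ u ∈ A, ∀ v ∈ B, wedge u v ∈ V)
    (hker : ∀ u ∈ A, ∀ v ∈ B, u ≠ 0 → v ≠ 0 → ∀ x, wedge (u + v) x ∈ V →
      x ∈ Submodule.span k {u, v}) {u₀ v₀ : W} (hu₀ : u₀ ∈ A) (hv₀ : v₀ ∈ B) (hu₀' : u₀ ≠ 0)
    (hv₀' : v₀ ≠ 0) : Module.finrank k A ≤ 2 := by
  let T : Submodule k (⋀[k]^2 W ⧸ V) := B.map (wedgeMod V v₀)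
  have hdis : ∀ x ∈ A, x ∈ B → x = 0 := fun x hA hB => Submodule.disjoint_def.1 hAB x hA hB
  have hTfin : Module.finrank k B ≤ Module.finrank k T + 1 := by
    have h1 := LinearMap.finrank_range_add_finrank_ker ((wedgeMod V v₀).domRestrict B)
    have h2 : ((wedgeMod V v₀).domRestrict B).range = T := LinearMap.range_domRestrict _ _
    have h3 : ((wedgeMod V v₀).domRestrict B).ker ≤ Submodule.span k {⟨v₀, hv₀⟩} := by
      intro x hx
      have hx' : x.1 ∈ (wedgeMod V v₀).ker := hx
      rw [mem_ker_wedgeMod] at hx'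
      have h4 : wedge (u₀ + v₀) x.1 ∈ V := by
        rw [map_add, LinearMap.add_apply]
        exact V.add_mem (hV _ hu₀ _ x.2) hx'
      obtain ⟨s, t, hst⟩ := Submodule.mem_span_pair.1 (hker _ hu₀ _ hv₀ hu₀' hv₀' _ h4)
      have h5 : s • u₀ = 0 := hdis _ (A.smul_mem _ hu₀) (by
        rw [eq_sub_of_add_eq hst]
        exact B.sub_mem x.2 (B.smul_mem _ hv₀))
      rw [h5, zero_add] at hst
      exact Submodule.mem_span_singleton.2 ⟨t, Subtype.ext hst⟩
    have h4 := Submodule.finrank_mono h3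
    have h5 : (⟨v₀, hv₀⟩ : B) ≠ 0 := fun h => hv₀' (congrArg Subtype.val h)
    rw [finrank_span_singleton h5] at h4
    rw [h2] at h1
    omega
  let φ : A →ₗ[k] A →ₗ[k] ((⋀[k]^2 W ⧸ V) ⧸ T) :=
    ((wedgeMod V).compr₂ T.mkQ).domRestrict₁₂ A A
  refine finrank_le_two_of_alternating φ ?_ ?_ ?_
  · intro x
    change T.mkQ (V.mkQ (wedge x.1 x.1)) = 0
    rw [wedge_self, map_zero, map_zero]
  · rintro ⟨u, hu⟩ ⟨u', hu'⟩ hne h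
    have hu0 : u ≠ 0 := fun h => hne (Subtype.ext h)
    have h : T.mkQ (wedgeMod V u u') = 0 := h
    rw [Submodule.mkQ_apply, Submodule.Quotient.mk_eq_zero] at h
    obtain ⟨v', hv', hvu⟩ := h
    have h1 : wedge u u' - wedge v₀ v' ∈ V := by
      rw [← Submodule.Quotient.mk_eq_zero, Submodule.Quotient.mk_sub]
      exact sub_eq_zero.2 hvu.symm
    have h2 : wedge (u + v₀) (u' - v') ∈ V := by
      have : wedge (u + v₀) (u' - v') = wedge (k := k) u u' - wedge v₀ v' - wedge u v' -
          wedge u' v₀ := by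
        rw [wedge_swap u' v₀, map_add, LinearMap.add_apply, map_sub, map_sub]
        abel
      rw [this]
      exact V.sub_mem (V.sub_mem h1 (hV _ hu _ hv')) (hV _ hu' _ hv₀)
    obtain ⟨s, t, hst⟩ := Submodule.mem_span_pair.1 (hker _ hu _ hv₀ hu0 hv₀' _ h2)
    have h3 : u' - s • u = 0 := hdis _ (A.sub_mem hu' (A.smul_mem _ hu)) (by
      have : u' - s • u = v' + t • v₀ := by
        rw [sub_eq_iff_eq_add]
        exact (eq_add_of_sub_eq hst.symm).trans (by abel)
      rw [this]
      exact B.add_mem hv' (B.smul_mem _ hv₀))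
    exact Submodule.mem_span_singleton.2 ⟨s, Subtype.ext (sub_eq_zero.1 h3).symm⟩
  · have := T.finrank_quotient_add_finrank
    omega

theorem exists_le_span_pair {A : Submodule k W} (hA : Module.finrank k A ≤ 2) {u₁ : W}
    (hu₁ : u₁ ∈ A) (h : u₁ ≠ 0) : ∃ u₂ ∈ A, A ≤ Submodule.span k {u₁, u₂} := by
  by_cases hle : A ≤ Submodule.span k {u₁}
  · exact ⟨u₁, hu₁, by simpa using hle⟩
  · obtain ⟨u₂, hu₂, hu₂'⟩ := SetLike.not_le_iff_exists.1 hle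
    refine ⟨u₂, hu₂, ?_⟩
    have h1 : Submodule.span k {u₁, u₂} ≤ A := by
      rw [Submodule.span_le]
      rintro x (rfl | rfl)
      exacts [hu₁, hu₂]
    refine (Submodule.eq_of_le_of_finrank_le h1 ?_).ge
    have h2 := Submodule.finrank_sup_span_singleton hu₂'
    rw [finrank_span_singleton h, ← Submodule.span_union, Set.singleton_union] at h2
    omega

/-- If a plane spanned by `u ∈ A` and `v ∈ B` is the only one in the linear section that contains
`u + v`, then the section is `A ∧ B`. -/
theorem le_span_wedge_of_ker_eq_span [IsAlgClosed k] {V : Submodule k (⋀[k]^2 W)}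
    {A B : Submodule k W} (hAB : IsCompl A B)
    (hfin : Module.finrank k (⋀[k]^2 W ⧸ V) + 2 = Module.finrank k W)
    (hV : ∀ u ∈ A, ∀ v ∈ B, wedge u v ∈ V)
    (hker : ∀ u ∈ A, ∀ v ∈ B, u ≠ 0 → v ≠ 0 → ∀ x, wedge (u + v) x ∈ V →
      x ∈ Submodule.span k {u, v}) {u₀ v₀ : W} (hu₀ : u₀ ∈ A) (hv₀ : v₀ ∈ B) (hu₀' : u₀ ≠ 0)
    (hv₀' : v₀ ≠ 0) :
    V ≤ Submodule.span k {p | ∃ u ∈ A, ∃ v ∈ B, p = wedge (k := k) u v} := by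
  have hdim := Submodule.finrank_add_eq_of_isCompl hAB
  have hA : Module.finrank k A ≤ 2 :=
    finrank_le_two_of_ker_eq_span hAB.disjoint (by omega) hV hker hu₀ hv₀ hu₀' hv₀'
  have hB : Module.finrank k B ≤ 2 := by
    refine finrank_le_two_of_ker_eq_span (V := V) hAB.disjoint.symm (by omega)
      (fun u hu v hv => ?_) (fun u hu v hv hu' hv' x hx => ?_) hv₀ hu₀ hv₀' hu₀'
    · rw [wedge_swap]
      exact V.neg_mem (hV v hv u hu)
    · rw [Set.pair_comm]
      exact hker v hv u hu hv' hu' x (by rwa [add_comm])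
  obtain ⟨u₂, hu₂, hAs⟩ := exists_le_span_pair hA hu₀ hu₀'
  obtain ⟨v₂, hv₂, hBs⟩ := exists_le_span_pair hB hv₀ hv₀'
  set M : Submodule k (⋀[k]^2 W) := Submodule.span k {p | ∃ u ∈ A, ∃ v ∈ B, p = wedge (k := k) u v}
    with hMdef
  have hM : ∀ u ∈ A, ∀ v ∈ B, wedge u v ∈ M := fun u hu v hv =>
    Submodule.subset_span ⟨u, hu, v, hv, rfl⟩
  have hMV : M ≤ V := Submodule.span_le.2 (by rintro _ ⟨u, hu, v, hv, rfl⟩; exact hV u hu v hv)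
  have hpair : ∀ x y x' : W, ∀ y' ∈ Submodule.span k {x, x'}, y ∈ Submodule.span k {x, x'} →
      ∃ t : k, wedge (k := k) y y' = t • wedge x x' := by
    intro x y x' y' hy' hy
    obtain ⟨a, b, rfl⟩ := Submodule.mem_span_pair.1 hy
    obtain ⟨c, d, rfl⟩ := Submodule.mem_span_pair.1 hy'
    refine ⟨a * d - b * c, ?_⟩
    simp only [map_add, map_smul, LinearMap.add_apply, LinearMap.smul_apply, wedge_self, smul_zero,
      zero_add, add_zero]
    rw [wedge_swap x' x]
    module
  -- Since `A` and `B` have dimension at most 2, the summands `⋀² A` and `⋀² B` of `⋀² W` are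
  -- spanned by one bivector each.
  have htop : ∀ p : ⋀[k]^2 W, ∃ q ∈ M, ∃ s t : k, p = q + s • wedge u₀ u₂ + t • wedge v₀ v₂ := by
    intro p
    have hp : p ∈ Submodule.span k {p | ∃ a b : W, p = wedge (k := k) a b} := by
      rw [span_wedge]; trivial
    induction hp using Submodule.span_induction with
    | mem p hp =>
      obtain ⟨a, b, rfl⟩ := hp
      have hsup := hAB.sup_eq_top
      obtain ⟨u, hu, v, hv, rfl⟩ := Submodule.mem_sup.1 (hsup ▸ Submodule.mem_top : a ∈ A ⊔ B)
      obtain ⟨u', hu', v', hv', rfl⟩ := Submodule.mem_sup.1 (hsup ▸ Submodule.mem_top : b ∈ A ⊔ B)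
      obtain ⟨s, hs⟩ := hpair u₀ u u₂ u' (hAs hu') (hAs hu)
      obtain ⟨t, ht⟩ := hpair v₀ v v₂ v' (hBs hv') (hBs hv)
      refine ⟨wedge u v' - wedge u' v, M.sub_mem (hM _ hu _ hv') (hM _ hu' _ hv), s, t, ?_⟩
      rw [← hs, ← ht, wedge_swap u' v]
      simp only [map_add, LinearMap.add_apply]
      abel
    | zero => exact ⟨0, M.zero_mem, 0, 0, by simp⟩
    | add p p' _ _ h h' =>
      obtain ⟨q, hq, s, t, rfl⟩ := h
      obtain ⟨q', hq', s', t', rfl⟩ := h'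
      exact ⟨q + q', M.add_mem hq hq', s + s', t + t', by rw [add_smul, add_smul]; abel⟩
    | smul c p _ h =>
      obtain ⟨q, hq, s, t, rfl⟩ := h
      exact ⟨c • q, M.smul_mem _ hq, c * s, c * t, by simp only [smul_add, mul_smul]⟩
  intro p hp
  obtain ⟨q, hq, s, t, rfl⟩ := htop p
  -- This bivector differs from the given element of `V` only by elements of `A ∧ B`. The hypothesis
  -- on `u₀ + v₀` then makes `s u₂` and `t v₂` multiples of `u₀` and `v₀`, and the two extra terms
  -- vanish.
  have h1 : wedge (u₀ + v₀) (s • u₂ + t • v₂) ∈ V := by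
    have : wedge (u₀ + v₀) (s • u₂ + t • v₂) = (q + s • wedge u₀ u₂ + t • wedge v₀ v₂) - q +
        t • wedge (k := k) u₀ v₂ - s • wedge u₂ v₀ := by
      rw [wedge_swap u₂ v₀]
      simp only [map_add, map_smul, LinearMap.add_apply]
      module
    rw [this]
    exact V.sub_mem (V.add_mem (V.sub_mem hp (hMV hq)) (V.smul_mem _ (hV _ hu₀ _ hv₂)))
      (V.smul_mem _ (hV _ hu₂ _ hv₀))
  obtain ⟨c, d, hcd⟩ := Submodule.mem_span_pair.1 (hker _ hu₀ _ hv₀ hu₀' hv₀' _ h1)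
  have h2 : c • u₀ - s • u₂ = 0 := Submodule.disjoint_def.1 hAB.disjoint _
    (A.sub_mem (A.smul_mem _ hu₀) (A.smul_mem _ hu₂)) (by
      have : c • u₀ - s • u₂ = t • v₂ - d • v₀ := by
        rw [sub_eq_sub_iff_add_eq_add, hcd]; abel
      rw [this]
      exact B.sub_mem (B.smul_mem _ hv₂) (B.smul_mem _ hv₀))
  have h3 : s • u₂ = c • u₀ := (sub_eq_zero.1 h2).symm
  have h4 : t • v₂ = d • v₀ := by
    rw [h3] at hcd
    exact (add_left_cancel hcd).symm
  rw [← map_smul, ← map_smul, h3, h4, map_smul, map_smul, wedge_self, wedge_self, smul_zero,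
    smul_zero, add_zero, add_zero]
  exact hq

end Fixed

/-! ### Automorphisms of finite order acting as a scalar on the cone over the section -/

section Fixed

variable {k : Type u} [Field k] {W : Type v} [AddCommGroup W] [Module k W]

/-- In characteristic zero `X ^ N - 1` is separable, so its root `T` is diagonalizable. -/
theorem iSup_eigenspace_eq_top_of_pow_eq_one [IsAlgClosed k] [CharZero k] [FiniteDimensional k W]
    {T : Module.End k W} {N : ℕ} (hN : 0 < N) (hT : T ^ N = 1) : ⨆ μ, T.eigenspace μ = ⊤ := by
  refine Module.End.IsSemisimple.iSup_eigenspace_eq_top ?_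
  refine Module.End.isSemisimple_of_squarefree_aeval_eq_zero
    (p := (Polynomial.X ^ N - 1 : Polynomial k)) ?_ ?_
  · exact (Polynomial.X_pow_sub_one_separable_iff.2 (by exact_mod_cast hN.ne')).squarefree
  · simp [hT]

theorem wedge_ne_zero_of_disjoint {A B : Submodule k W} (hAB : Disjoint A B) {u v : W} (hu : u ∈ A)
    (hv : v ∈ B) (hu0 : u ≠ 0) (hv0 : v ≠ 0) : wedge (k := k) u v ≠ 0 := by
  intro h
  obtain ⟨c, rfl⟩ := Submodule.mem_span_singleton.1 ((wedge_eq_zero_iff hu0).1 h)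
  exact hv0 (Submodule.disjoint_def.1 hAB _ (A.smul_mem _ hu) hv)

/-- If an endomorphism of finite order acts as a scalar on the cone over a linear section of the
Grassmannian of lines, of small codimension, then it is itself a scalar or acts as a scalar on the
whole linear space that cuts out the section. -/
theorem map_eq_smul_of_forall_wedge [IsAlgClosed k] [CharZero k] [FiniteDimensional k W]
    {T : Module.End k W} {N : ℕ} (hN : 0 < N) (hTN : T ^ N = 1) {V : Submodule k (⋀[k]^2 W)}
    (hV : Module.finrank k (⋀[k]^2 W ⧸ V) + 2 ≤ Module.finrank k W) {c : k}
    (hc : ∀ a b, wedge a b ∈ V → wedge (T a) (T b) = c • wedge (k := k) a b)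
    (hT : ¬∃ a : k, ∀ w, T w = a • w) : ∀ p ∈ V, exteriorPower.map 2 T p = c • p := by
  have htop := iSup_eigenspace_eq_top_of_pow_eq_one hN hTN
  have hinj : Function.Injective T := by
    intro x y hxy
    have h : ∀ x, (T ^ (N - 1)) (T x) = x := fun x => by
      rw [← Module.End.mul_apply, ← pow_succ, Nat.sub_add_cancel hN, hTN, Module.End.one_apply]
    rw [← h x, hxy, h]
  have hc0 : ∀ a b, wedge a b ∈ V → wedge (k := k) a b ≠ 0 → wedge (T a) (T b) ≠
      (0 : ⋀[k]^2 W) := by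
    intro a b _ h
    rw [wedge_ne_zero_iff] at h ⊢
    have h1 := h.map' T (LinearMap.ker_eq_bot.2 hinj)
    have h2 : T ∘ ![a, b] = ![T a, T b] := by
      ext i
      fin_cases i <;> rfl
    rwa [h2] at h1
  -- Every plane of the section is `T`-stable, because `⋀² T` multiplies its bivector by the scalar
  -- `c`, and by injectivity the image bivector is nonzero.
  have hspan : ∀ a b, wedge a b ∈ V → wedge (k := k) a b ≠ 0 → T a ∈ Submodule.span k {a, b} :=
    fun a b h h0 => mem_span_of_wedge_eq (hc0 a b h h0) (hc a b h)
  -- the plane through a vector that is not an eigenvector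
  have hker : ∀ w, T w ∉ Submodule.span k {w} →
      (wedgeMod V w).ker = Submodule.span k {w, T w} ∧
      Module.finrank k (⋀[k]^2 W ⧸ V) + 2 = Module.finrank k W := by
    intro w hw
    have hw0 : w ≠ 0 := by
      rintro rfl
      rw [map_zero] at hw
      exact hw (Submodule.zero_mem _)
    have hle : (wedgeMod V w).ker ≤ Submodule.span k {w, T w} := by
      intro x hx
      rw [mem_ker_wedgeMod] at hx
      by_cases h0 : wedge (k := k) w x = 0
      · exact Submodule.span_mono (by simp) ((wedge_eq_zero_iff hw0).1 h0)
      · obtain ⟨s, t, hst⟩ := Submodule.mem_span_pair.1 (hspan w x hx h0)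
        have ht : t ≠ 0 := by
          rintro rfl
          rw [zero_smul, add_zero] at hst
          exact hw (Submodule.mem_span_singleton.2 ⟨s, hst⟩)
        rw [← Submodule.smul_mem_iff _ ht, eq_sub_of_add_eq' hst]
        exact Submodule.sub_mem _ (Submodule.subset_span (by simp))
          (Submodule.smul_mem _ _ (Submodule.subset_span (by simp)))
    have h1 := finrank_le_finrank_ker_wedgeMod V w
    have h2 : Module.finrank k (Submodule.span k {w, T w}) ≤ 2 := by
      classical
      have := (finrank_span_finset_le_card (R := k) ({w, T w} : Finset W)).trans Finset.card_le_two
      rwa [Finset.coe_pair] at this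
    have h3 := Submodule.finrank_mono hle
    -- The kernel has dimension at least `n - r ≥ 2` and lies in a space of dimension at most 2, so
    -- both bounds are equalities.
    exact ⟨Submodule.eq_of_le_of_finrank_le hle (by omega), by omega⟩
  have hquad : ∀ w, T w ∉ Submodule.span k {w} → T (T w) ∈ Submodule.span k {w, T w} := by
    intro w hw
    have hw0 : w ≠ 0 := by
      rintro rfl
      rw [map_zero] at hw
      exact hw (Submodule.zero_mem _)
    have h1 : wedge w (T w) ∈ V := by
      rw [← mem_ker_wedgeMod, (hker w hw).1]
      exact Submodule.subset_span (by simp)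
    have h2 : wedge (k := k) w (T w) ≠ 0 := fun h => hw ((wedge_eq_zero_iff hw0).1 h)
    have h3 : wedge (T w) w ∈ V := by rw [wedge_swap]; exact V.neg_mem h1
    have h4 : wedge (k := k) (T w) w ≠ 0 := by rw [wedge_swap]; exact neg_ne_zero.2 h2
    rw [Set.pair_comm]
    exact hspan _ _ h3 h4
  -- the two eigenvalues
  obtain ⟨a, ha⟩ : ∃ a, T.HasEigenvalue a := by
    have : Nontrivial W := Module.nontrivial_of_finrank_pos (R := k) (by omega)
    exact Module.End.exists_eigenvalue T
  obtain ⟨b, hb, hab⟩ : ∃ b, T.HasEigenvalue b ∧ b ≠ a := by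
    by_contra! h
    refine hT ⟨a, fun w => ?_⟩
    have : ⨆ μ, T.eigenspace μ ≤ T.eigenspace a := by
      refine iSup_le fun μ => ?_
      by_cases hμ : T.HasEigenvalue μ
      · rw [h μ hμ]
      · rw [Module.End.hasEigenvalue_iff, not_not] at hμ
        rw [hμ]
        exact bot_le
    exact Module.End.mem_eigenspace_iff.1 (this (htop ▸ Submodule.mem_top))
  obtain ⟨u₀, hu₀⟩ := ha.exists_hasEigenvector
  obtain ⟨v₀, hv₀⟩ := hb.exists_hasEigenvector
  have hdis : Disjoint (T.eigenspace a) (T.eigenspace b) :=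
    T.eigenspaces_iSupIndep.pairwiseDisjoint hab.symm
  have hab' : ∀ u ∈ T.eigenspace a, ∀ v ∈ T.eigenspace b, u ≠ 0 → v ≠ 0 →
      T (u + v) ∉ Submodule.span k {u + v} := by
    intro u hu v hv hu0 hv0 h
    have hT : T (u + v) = a • u + b • v := by
      rw [map_add, Module.End.mem_eigenspace_iff.1 hu, Module.End.mem_eigenspace_iff.1 hv]
    have h1 := (wedge_eq_zero_iff (fun h0 => hu0 ?_)).2 h
    · rw [hT] at h1
      have h2 : wedge (k := k) (u + v) (a • u + b • v) = (b - a) • wedge u v := by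
        simp only [map_add, map_smul, LinearMap.add_apply, wedge_self, zero_add,
          add_zero]
        rw [wedge_swap v u]
        module
      rw [h2, smul_eq_zero] at h1
      exact h1.elim (sub_ne_zero.2 hab) (wedge_ne_zero_of_disjoint hdis hu hv hu0 hv0)
    · rw [eq_neg_of_add_eq_zero_left h0] at hu ⊢
      rw [Submodule.neg_mem_iff] at hu
      rw [Submodule.disjoint_def.1 hdis v hu hv, neg_zero]
  -- A third eigenvalue is impossible: for `w` the sum of three eigenvectors, `T² w ∈ ⟨w, T w⟩`
  -- makes all three eigenvalues roots of one monic quadratic polynomial.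
  have heig : ∀ e, T.HasEigenvalue e → e = a ∨ e = b := by
    intro e he
    by_contra! hne
    obtain ⟨x, hx⟩ := he.exists_hasEigenvector
    have hli : LinearIndependent k ![u₀, v₀, x] := by
      refine Module.End.eigenvectors_linearIndependent' T ![a, b, e] ?_ _ ?_
      · intro i j hij
        fin_cases i <;> fin_cases j <;> simp_all
      · intro i
        fin_cases i
        exacts [hu₀, hv₀, hx]
    rw [Fintype.linearIndependent_iff] at hli
    have hli' : ∀ p q r : k, p • u₀ + q • v₀ + r • x = 0 → p = 0 ∧ q = 0 ∧ r = 0 := by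
      intro p q r h
      have := hli ![p, q, r] (by simpa [Fin.sum_univ_three] using h)
      exact ⟨this 0, this 1, this 2⟩
    have hTw : T (u₀ + v₀ + x) = a • u₀ + b • v₀ + e • x := by
      rw [map_add, map_add, hu₀.apply_eq_smul, hv₀.apply_eq_smul, hx.apply_eq_smul]
    have h1 : T (u₀ + v₀ + x) ∉ Submodule.span k {u₀ + v₀ + x} := by
      intro h
      obtain ⟨s, hs⟩ := Submodule.mem_span_singleton.1 h
      rw [hTw] at hs
      obtain ⟨h2, h3, -⟩ := hli' (a - s) (b - s) (e - s) (by
        rw [← sub_eq_zero.2 hs.symm]; module)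
      exact hab ((sub_eq_zero.1 h3).trans (sub_eq_zero.1 h2).symm)
    obtain ⟨s, t, hst⟩ := Submodule.mem_span_pair.1 (hquad _ h1)
    rw [hTw, map_add, map_add, map_smul, map_smul, map_smul, hu₀.apply_eq_smul, hv₀.apply_eq_smul,
      hx.apply_eq_smul] at hst
    obtain ⟨h2, h3, h4⟩ := hli' (a * a - s - t * a) (b * b - s - t * b) (e * e - s - t * e) (by
      rw [← sub_eq_zero.2 hst.symm]; module)
    have h5 : (b - a) * (b + a - t) = 0 := by linear_combination h3 - h2
    have h6 : (e - a) * (e + a - t) = 0 := by linear_combination h4 - h2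
    have h7 := (mul_eq_zero.1 h5).resolve_left (sub_ne_zero.2 hab)
    have h8 := (mul_eq_zero.1 h6).resolve_left (sub_ne_zero.2 hne.1)
    exact hne.2 (by linear_combination h8 - h7)
  have hcompl : IsCompl (T.eigenspace a) (T.eigenspace b) := by
    refine ⟨hdis, codisjoint_iff.2 (eq_top_iff.2 ?_)⟩
    rw [← htop]
    refine iSup_le fun μ => ?_
    by_cases hμ : T.HasEigenvalue μ
    · rcases heig μ hμ with rfl | rfl
      exacts [le_sup_left, le_sup_right]
    · rw [Module.End.hasEigenvalue_iff, not_not] at hμ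
      rw [hμ]
      exact bot_le
  have hmem : ∀ u ∈ T.eigenspace a, ∀ v ∈ T.eigenspace b, u ≠ 0 → v ≠ 0 →
      Submodule.span k {u + v, T (u + v)} = Submodule.span k {u, v} := by
    intro u hu v hv _ _
    rw [map_add, Module.End.mem_eigenspace_iff.1 hu, Module.End.mem_eigenspace_iff.1 hv]
    have hba : b - a ≠ 0 := sub_ne_zero.2 hab
    refine le_antisymm (Submodule.span_le.2 ?_) (Submodule.span_le.2 ?_)
    · rintro x (rfl | rfl)
      · exact Submodule.mem_span_pair.2 ⟨1, 1, by simp⟩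
      · exact Submodule.mem_span_pair.2 ⟨a, b, rfl⟩
    · rintro x (rfl | rfl)
      · rw [SetLike.mem_coe, ← Submodule.smul_mem_iff _ hba]
        exact Submodule.mem_span_pair.2 ⟨b, -1, by module⟩
      · rw [SetLike.mem_coe, ← Submodule.smul_mem_iff _ hba]
        exact Submodule.mem_span_pair.2 ⟨-a, 1, by module⟩
  have hkerAB : ∀ u ∈ T.eigenspace a, ∀ v ∈ T.eigenspace b, u ≠ 0 → v ≠ 0 →
      (wedgeMod V (u + v)).ker = Submodule.span k {u, v} := fun u hu v hv hu0 hv0 => by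
    rw [(hker _ (hab' u hu v hv hu0 hv0)).1, hmem u hu v hv hu0 hv0]
  have hVAB : ∀ u ∈ T.eigenspace a, ∀ v ∈ T.eigenspace b, wedge u v ∈ V := by
    intro u hu v hv
    by_cases hu0 : u = 0
    · subst hu0
      rw [map_zero, LinearMap.zero_apply]
      exact V.zero_mem
    by_cases hv0 : v = 0
    · subst hv0
      rw [map_zero]
      exact V.zero_mem
    have h1 : v ∈ (wedgeMod V (u + v)).ker := by
      rw [hkerAB u hu v hv hu0 hv0]
      exact Submodule.subset_span (by simp)
    rw [mem_ker_wedgeMod, map_add, LinearMap.add_apply, wedge_self, add_zero] at h1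
    exact h1
  have hle := le_span_wedge_of_ker_eq_span hcompl
    (hker _ (hab' u₀ hu₀.1 v₀ hv₀.1 hu₀.2 hv₀.2)).2 hVAB
    (fun u hu v hv hu0 hv0 x hx => by
      rwa [← hkerAB u hu v hv hu0 hv0, mem_ker_wedgeMod]) hu₀.1 hv₀.1 hu₀.2 hv₀.2
  -- `V` is contained in the span of the `u ∧ v` with `u`, `v` in the two eigenspaces; these lie in
  -- `V`, so `⋀² T` multiplies them by `c`.
  intro p hp
  have hp' := hle hp
  clear hp
  induction hp' using Submodule.span_induction with
  | mem p hp =>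
    obtain ⟨u, hu, v, hv, rfl⟩ := hp
    rw [← hc u v (hVAB u hu v hv), wedge_apply, wedge_apply]
    refine (exteriorPower.map_apply_ιMulti T ![u, v]).trans ?_
    congr 1
    ext i
    fin_cases i <;> rfl
  | zero => simp
  | add x y _ _ h1 h2 => rw [map_add, h1, h2, smul_add]
  | smul t x _ h => rw [map_smul, h, smul_comm]

end Fixed

/-! ### Generic freeness -/

section Free

variable {k : Type u} [Field k] {G : Type w} [Group G] {A : Type v} [AddCommGroup A] [Module k A]

theorem actProj_eq_iff {ρ : Representation k G A} {g : G} {x : ℙ k A} :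
    actProj ρ g x = x ↔ ρ g x.rep ∈ Submodule.span k {x.rep} := by
  rw [← submodule_eq]
  exact ⟨fun h => by simpa only [h] using smul_rep_mem_submodule ρ g x, fun h =>
    eq_of_mem_submodule (rho_rep_ne_zero ρ g x) (smul_rep_mem_submodule ρ g x) h⟩

theorem eq_one_of_genericallyFree {ρ : Representation k G A} (h : (projRep ρ).GenericallyFree)
    [Nontrivial A] {g : G} {c : k} (hc : ∀ a, ρ g a = c • a) : g = 1 := by
  obtain ⟨U, -, hU, hfree⟩ := h
  obtain ⟨a, ha⟩ := exists_ne (0 : A)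
  have : Nonempty (projRep ρ).carrier := ⟨mk k a ha⟩
  obtain ⟨x, hx⟩ := hU.nonempty
  refine hfree x hx g (actProj_eq_iff.2 ?_)
  rw [hc]
  exact Submodule.smul_mem _ _ (Submodule.mem_span_singleton_self _)

/-- A fixed line is spanned by an eigenvector. As there are finitely many eigenvalues, the fixed
locus is a finite union of linear subspaces, hence closed. -/
theorem setOf_actProj_eq [FiniteDimensional k A] (ρ : Representation k G A) (g : G) :
    {x : ℙ k A | actProj ρ g x = x} =
      ⋃ μ ∈ {μ : k | Module.End.HasEigenvalue (ρ g) μ},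
        projSubspace (Module.End.eigenspace (ρ g) μ) := by
  ext x
  simp only [Set.mem_ofPred_eq, Set.mem_iUnion]
  have hmem : ∀ μ, x ∈ projSubspace (Module.End.eigenspace (ρ g) μ) ↔ ρ g x.rep = μ • x.rep := by
    intro μ
    change x.submodule ≤ _ ↔ _
    rw [submodule_eq, Submodule.span_singleton_le_iff_mem, Module.End.mem_eigenspace_iff]
  simp only [hmem]
  rw [actProj_eq_iff, Submodule.mem_span_singleton]
  constructor
  · rintro ⟨μ, hμ⟩
    exact ⟨μ, Module.End.hasEigenvalue_of_hasEigenvector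
      ⟨Module.End.mem_eigenspace_iff.2 hμ.symm, x.rep_nonzero⟩, hμ.symm⟩
  · rintro ⟨μ, -, hμ⟩
    exact ⟨μ, hμ.symm⟩

theorem isClosed_setOf_actProj_eq [FiniteDimensional k A] (ρ : Representation k G A) (g : G) :
    IsClosed {x : ℙ k A | actProj ρ g x = x} := by
  rw [setOf_actProj_eq]
  exact (Module.End.finite_hasEigenvalue _).isClosed_biUnion fun μ _ => isClosed_projSubspace _

/-- A point of the linear section with trivial stabilizer. -/
theorem exists_free_point [IsAlgClosed k] [CharZero k] [Finite G] [FiniteDimensional k A]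
    (ρ : Representation k G A) (V : Subrepresentation (exteriorSquare ρ))
    (hdim : Module.finrank k (⋀[k]^2 A ⧸ V.toSubmodule) + 2 ≤ Module.finrank k A)
    (hA : (projRep ρ).GenericallyFree)
    (hV : (projRep (A := V.toSubmodule) V.toRepresentation).GenericallyFree)
    (hirr : IrreducibleSpace ↥(grassmannian k A ∩ projSubspace V.toSubmodule)) :
    ∃ x ∈ grassmannian k A ∩ projSubspace V.toSubmodule,
      ∀ g : G, g ≠ 1 → actProj (exteriorSquare ρ) g x ≠ x := by
  classical
  have := Fintype.ofFinite G
  have : Nontrivial A := Module.nontrivial_of_finrank_pos (R := k) (by omega)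
  set X := grassmannian k A ∩ projSubspace V.toSubmodule with hX
  obtain ⟨x₁⟩ := hirr.toNonempty
  have : Nontrivial V.toSubmodule :=
    ⟨⟨x₁.1.rep, x₁.2.2 (rep_mem_submodule _)⟩, 0, fun h =>
      x₁.1.rep_nonzero (congrArg Subtype.val h)⟩
  let U : G → Set X := fun g => {x | actProj (exteriorSquare ρ) g x.1 ≠ x.1}
  have hUo : ∀ g, IsOpen (U g) := fun g =>
    ((isClosed_setOf_actProj_eq (exteriorSquare ρ) g).preimage continuous_subtype_val).isOpen_compl
  have hUne : ∀ g, g ≠ 1 → (U g).Nonempty := by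
    intro g hg
    by_contra hemp
    rw [Set.not_nonempty_iff_eq_empty] at hemp
    have hfix : ∀ x : X, x.1 ∈ {x : ℙ k (⋀[k]^2 A) | actProj (exteriorSquare ρ) g x = x} := by
      intro x
      by_contra h
      have : x ∈ U g := h
      rw [hemp] at this
      exact this
    rw [setOf_actProj_eq] at hfix
    have hfin := Module.End.finite_hasEigenvalue (exteriorSquare ρ g)
    -- An irreducible space covered by finitely many closed sets lies in one of them, so a single
    -- eigenvalue serves for the whole section.
    obtain ⟨μ, hμ⟩ : ∃ μ : k, ∀ x : X,
        x.1 ∈ projSubspace (Module.End.eigenspace (exteriorSquare ρ g) μ) := by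
      have hi : IsIrreducible (Set.univ : Set X) := IrreducibleSpace.isIrreducible_univ X
      rw [isIrreducible_iff_sUnion_isClosed] at hi
      obtain ⟨s, hs, hs'⟩ := hi (hfin.toFinset.image fun μ => Subtype.val ⁻¹'
        projSubspace (Module.End.eigenspace (exteriorSquare ρ g) μ)) (by
          intro s hs
          obtain ⟨μ, -, rfl⟩ := Finset.mem_image.1 hs
          exact (isClosed_projSubspace _).preimage continuous_subtype_val) (by
          intro x _
          obtain ⟨μ, hμ, hx⟩ := Set.mem_iUnion₂.1 (hfix x)
          exact ⟨_, Finset.mem_coe.2 (Finset.mem_image.2 ⟨μ, hfin.mem_toFinset.2 hμ, rfl⟩), hx⟩)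
      obtain ⟨μ, -, rfl⟩ := Finset.mem_image.1 hs
      exact ⟨μ, fun x => hs' (Set.mem_univ x)⟩
    have key := map_eq_smul_of_forall_wedge (T := ρ g) (orderOf_pos g)
      (by rw [← map_pow, pow_orderOf_eq_one, map_one]) hdim (c := μ) (fun a b hab => by
        rw [← exteriorSquare_wedge]
        by_cases h0 : wedge (k := k) a b = 0
        · rw [h0, map_zero, smul_zero]
        · have hx := mk_mem_submodule (k := k) h0
          let x : ℙ k (⋀[k]^2 A) := Projectivization.mk k (wedge a b) h0
          have hle : x.submodule ≤ V.toSubmodule := by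
            rwa [submodule_mk, Submodule.span_singleton_le_iff_mem]
          have h1 := hμ ⟨x, mem_grassmannian_iff.2 ⟨a, b, h0, hx⟩, hle⟩
          exact Module.End.mem_eigenspace_iff.1 (h1 hx))
      (fun ⟨c, hc⟩ => hg (eq_one_of_genericallyFree hA hc))
    refine hg (eq_one_of_genericallyFree hV (c := μ) fun p => Subtype.ext ?_)
    exact key p.1 p.2
  -- Each `g ≠ 1` moves the points of a nonempty open set; by irreducibility the finitely many such
  -- sets have a common point.
  have hi : IsIrreducible (Set.univ : Set X) := IrreducibleSpace.isIrreducible_univ X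
  rw [isIrreducible_iff_sInter] at hi
  obtain ⟨x, -, hx⟩ := hi ((Finset.univ.erase 1).image U) (by
      intro s hs
      obtain ⟨g, -, rfl⟩ := Finset.mem_image.1 hs
      exact hUo g) (by
      intro s hs
      obtain ⟨g, hg, rfl⟩ := Finset.mem_image.1 hs
      rw [Set.univ_inter]
      exact hUne g (Finset.ne_of_mem_erase hg))
  exact ⟨x.1, x.2, fun g hg => hx _ (Finset.mem_coe.2 (Finset.mem_image.2
    ⟨g, Finset.mem_erase.2 ⟨hg, Finset.mem_univ g⟩, rfl⟩))⟩

end Free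

/-! ### Supports of bivectors, and openness of the condition of maximal rank -/

section Aux

variable {k : Type u} [Field k] {W : Type v} [AddCommGroup W] [Module k W]

theorem exists_sum_eq_of_linearIndependent {A : Type*} [AddCommGroup A] [Module k A]
    {M : Submodule k A} [FiniteDimensional k M] {ι : Type*} [Fintype ι] {b : ι → A}
    (hb : LinearIndependent k b) (hM : ∀ j, b j ∈ M) (hcard : Module.finrank k M ≤ Fintype.card ι)
    {x : A} (hx : x ∈ M) : ∃ γ : ι → k, ∑ j, γ j • b j = x := by
  have hle : Submodule.span k (Set.range b) ≤ M :=
    Submodule.span_le.2 (by rintro _ ⟨j, rfl⟩; exact hM j)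
  have heq := Submodule.eq_of_le_of_finrank_le hle (by rwa [finrank_span_eq_card hb])
  rw [← heq] at hx
  exact (Submodule.mem_span_range_iff_exists_fun k).1 hx

/-- The smallest subspace whose exterior square contains the bivector `p`. -/
noncomputable def bivectorSupport (p : ⋀[k]^2 W) : Submodule k W :=
  Submodule.span k (Set.range fun ξ : Module.Dual k W => contraction ξ p)

theorem bivectorSupport_wedge_le (a b : W) :
    bivectorSupport (wedge (k := k) a b) ≤ Submodule.span k {a, b} := by
  rw [bivectorSupport, Submodule.span_le]
  rintro _ ⟨ξ, rfl⟩
  exact contraction_wedge_mem ξ a b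

/-- The group carries the contraction of `p` by `ξ` to the contraction of `g p` by `ξ ∘ g⁻¹`; it
suffices to check this on decomposable bivectors, which span. -/
theorem bivectorSupport_equivariant {G : Type w} [Group G] (ρ : Representation k G W) (g : G)
    (p : ⋀[k]^2 W) (x : W) (hx : x ∈ bivectorSupport p) :
    ρ g x ∈ bivectorSupport (exteriorSquare ρ g p) := by
  have hcon : ∀ (ξ : Module.Dual k W) (p : ⋀[k]^2 W),
      ρ g (contraction ξ p) = contraction (ξ ∘ₗ ρ g⁻¹) (exteriorSquare ρ g p) := by
    intro ξ p
    have hp : p ∈ Submodule.span k {p | ∃ a b : W, p = wedge (k := k) a b} := by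
      rw [span_wedge]; trivial
    have hinv : ∀ a, ρ g⁻¹ (ρ g a) = a := fun a => by
      rw [← Module.End.mul_apply, ← map_mul, inv_mul_cancel, map_one, Module.End.one_apply]
    induction hp using Submodule.span_induction with
    | mem p hp =>
      obtain ⟨a, b, rfl⟩ := hp
      rw [exteriorSquare_wedge, contraction_wedge, contraction_wedge, map_sub, map_smul, map_smul,
        LinearMap.comp_apply, LinearMap.comp_apply, hinv, hinv]
    | zero => simp
    | add x y _ _ h1 h2 => rw [map_add, map_add, map_add, map_add, h1, h2]
    | smul t x _ h => rw [map_smul, map_smul, map_smul, map_smul, h]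
  induction hx using Submodule.span_induction with
  | mem x hx =>
    obtain ⟨ξ, rfl⟩ := hx
    exact Submodule.subset_span ⟨ξ ∘ₗ ρ g⁻¹, (hcon ξ p).symm⟩
  | zero => rw [map_zero]; exact Submodule.zero_mem _
  | add x y _ _ h1 h2 => rw [map_add]; exact Submodule.add_mem _ h1 h2
  | smul t x _ h => rw [map_smul]; exact Submodule.smul_mem _ _ h

theorem exists_rep_eq_wedge {x : ℙ k (⋀[k]^2 W)} (hx : x ∈ grassmannian k W) :
    ∃ a b : W, x.rep = wedge (k := k) a b := by
  obtain ⟨a, b, h, hab⟩ := mem_grassmannian_iff.1 hx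
  obtain ⟨c, -, hc⟩ := exists_rep_eq_smul h hab
  exact ⟨c • a, b, by rw [hc, map_smul, LinearMap.smul_apply]⟩

theorem wedgeMod_equivariant {G : Type w} [Group G] {ρ : Representation k G W}
    (V : Subrepresentation (exteriorSquare ρ)) (g : G) (w x : W)
    (hx : x ∈ (wedgeMod V.toSubmodule w).ker) :
    ρ g x ∈ (wedgeMod V.toSubmodule (ρ g w)).ker := by
  rw [mem_ker_wedgeMod] at hx ⊢
  rw [← exteriorSquare_wedge]
  exact V.apply_mem_toSubmodule g hx

/-- The inequality says that `wedgeMod V y.rep` has the full rank `r`, that is, its values on some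
`r` vectors are independent; for each choice of the vectors this is open. -/
theorem isOpen_finrank_ker_wedgeMod_le [FiniteDimensional k W] (V : Submodule k (⋀[k]^2 W)) :
    IsOpen {y : ℙ k W | Module.finrank k (wedgeMod V y.rep).ker +
      Module.finrank k (⋀[k]^2 W ⧸ V) ≤ Module.finrank k W} := by
  have heq : {y : ℙ k W | Module.finrank k (wedgeMod V y.rep).ker +
      Module.finrank k (⋀[k]^2 W ⧸ V) ≤ Module.finrank k W} =
      ⋃ J : Fin (Module.finrank k (⋀[k]^2 W ⧸ V)) → W,
        {y : ℙ k W | LinearIndependent k (fun j => wedgeMod V y.rep (J j))} := by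
    ext y
    have h1 := (wedgeMod V y.rep).finrank_range_add_finrank_ker
    simp only [Set.mem_iUnion, Set.mem_ofPred_eq]
    constructor
    · intro h
      have h2 : (⊤ : Submodule k W).map (wedgeMod V y.rep) = (wedgeMod V y.rep).range :=
        Submodule.map_top _
      have h3 := (wedgeMod V y.rep).range.finrank_le
      obtain ⟨J, -, hJ⟩ := exists_linearIndependent_map (wedgeMod V y.rep) (K := ⊤)
        (m := Module.finrank k (⋀[k]^2 W ⧸ V)) (by rw [h2]; omega)
      exact ⟨J, hJ⟩
    · rintro ⟨J, hJ⟩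
      have h2 : LinearIndependent k (fun j => (⟨wedgeMod V y.rep (J j),
          LinearMap.mem_range_self _ _⟩ : (wedgeMod V y.rep).range)) :=
        LinearIndependent.of_comp (wedgeMod V y.rep).range.subtype hJ
      have h3 := h2.fintype_card_le_finrank
      rw [Fintype.card_fin] at h3
      omega
  rw [heq]
  exact isOpen_iUnion fun J => isOpen_linearIndependent (d := 1)
    (b := fun j w => wedgeMod V w (J j)) fun j => isFormMap_linear ((wedgeMod V).flip (J j))

end Aux

/-! ### The incidence of points and lines -/

section Incidence

variable {k : Type u} [Field k] {W : Type v} [AddCommGroup W] [Module k W]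

theorem rep_notMem_span_of_actProj_ne {G : Type w} [Group G] {ρ : Representation k G W} {g : G}
    {x : ℙ k W} (h : actProj ρ g x ≠ x) : x.rep ∉ Submodule.span k {ρ g x.rep} := fun h' =>
  h (eq_of_mem_submodule x.rep_nonzero
    ((Submodule.span_singleton_le_iff_mem _ _).2 (smul_rep_mem_submodule ρ g x) h')
    (rep_mem_submodule x))

theorem ker_wedgeMod_smul (V : Submodule k (⋀[k]^2 W)) {c : k} (hc : c ≠ 0) (w : W) :
    (wedgeMod V (c • w)).ker = (wedgeMod V w).ker := by
  rw [map_smul, LinearMap.ker_smul _ _ hc]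

theorem finrank_ker_wedgeMod_le {G : Type w} [Group G] {ρ : Representation k G W}
    [FiniteDimensional k W] (V : Subrepresentation (exteriorSquare ρ)) (g : G) (w : W) :
    Module.finrank k (wedgeMod V.toSubmodule (ρ g w)).ker ≤
      Module.finrank k (wedgeMod V.toSubmodule w).ker := by
  have h : (wedgeMod V.toSubmodule (ρ g w)).ker ≤
      (wedgeMod V.toSubmodule w).ker.map (ρ g) := fun x hx => by
    have h1 := wedgeMod_equivariant V g⁻¹ _ _ hx
    rw [← Module.End.mul_apply (ρ g⁻¹), ← map_mul, inv_mul_cancel, map_one,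
      Module.End.one_apply] at h1
    refine ⟨_, h1, ?_⟩
    rw [← Module.End.mul_apply (ρ g), ← map_mul, mul_inv_cancel, map_one, Module.End.one_apply]
  exact (Submodule.finrank_mono h).trans (Submodule.finrank_map_le _ _)

variable {m d : ℕ} {s : Fin (m + 1) → W → W} {V : Submodule k (⋀[k]^2 W)}

/-- A line that passes through the point `y` is a combination of the given lines through `y`. -/
theorem exists_isComb_wedge [FiniteDimensional k W]
    (hs : ∀ j, IsFormMap k d fun w => wedge (k := k) w (s j w))
    (hV : ∀ j w, s j w ∈ (wedgeMod V w).ker) {y : ℙ k W}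
    (hy : Module.finrank k (wedgeMod V y.rep).ker ≤ m + 2)
    (hli : LinearIndependent k fun j => wedge (k := k) y.rep (s j y.rep))
    {x : ℙ k (⋀[k]^2 W)} (hx : x ∈ projSubspace V) {a b : W} (hab : wedge a b ∈ x.submodule)
    (h0 : wedge (k := k) a b ≠ 0) (hyab : y.rep ∈ Submodule.span k {a, b}) :
    ∃ c, IsComb (fun j w => wedge (k := k) w (s j w)) y c x := by
  obtain ⟨z, hz⟩ := exists_wedge_eq y.rep_nonzero hyab
  rw [hz] at hab h0
  have h1 := finrank_map_wedge y.rep_nonzero (self_mem_ker_wedgeMod V y.rep)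
  obtain ⟨γ, hγ⟩ := exists_sum_eq_of_linearIndependent hli
    (M := (wedgeMod V y.rep).ker.map (wedge (k := k) y.rep))
    (fun j => Submodule.mem_map_of_mem (hV j _)) (by rw [Fintype.card_fin]; omega)
    (Submodule.mem_map_of_mem (mem_ker_wedgeMod.2 (hx hab)))
  have hγ0 : γ ≠ 0 := by
    rintro rfl
    exact h0 (by rw [← hγ]; simp)
  refine ⟨mk k γ hγ0, (isComb_iff hs y.rep_nonzero (rep_mem_submodule y) hγ0
    (mk_mem_submodule hγ0)).2 ?_⟩
  rwa [hγ]

theorem IsComb.exists_wedge (hV : ∀ j w, s j w ∈ (wedgeMod V w).ker) {y : ℙ k W}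
    {c : ℙ k (Fin (m + 1) → k)} {x : ℙ k (⋀[k]^2 W)}
    (hli : LinearIndependent k fun j => wedge (k := k) y.rep (s j y.rep))
    (h : IsComb (fun j w => wedge (k := k) w (s j w)) y c x) :
    ∃ z ∈ (wedgeMod V y.rep).ker, x.rep = wedge y.rep z := by
  obtain ⟨r, -, hr⟩ := exists_rep_eq_smul (sum_smul_ne_zero hli c.rep_nonzero) h
  refine ⟨r • ∑ j, c.rep j • s j y.rep, Submodule.smul_mem _ _
    (Submodule.sum_mem _ fun j _ => Submodule.smul_mem _ _ (hV j _)), ?_⟩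
  rw [hr, map_smul, map_sum]
  simp only [map_smul]

/-- A point of the line `x` is a combination of two given points of this line. -/
theorem exists_isComb_support {t : Fin 2 → ⋀[k]^2 W → W} (ht : ∀ i, IsFormMap k d (t i))
    (hts : ∀ i p, t i p ∈ bivectorSupport p) {x : ℙ k (⋀[k]^2 W)}
    (hli : LinearIndependent k fun i => t i x.rep) {y : ℙ k W} {z : W}
    (hx : x.rep = wedge y.rep z) : ∃ c, IsComb t x c y := by
  classical
  have hmem : ∀ i, t i x.rep ∈ Submodule.span k {y.rep, z} := fun i =>
    bivectorSupport_wedge_le _ _ (hx ▸ hts i x.rep)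
  have hfin : FiniteDimensional k (Submodule.span k {y.rep, z}) :=
    FiniteDimensional.span_of_finite k (by simp)
  have hcard : Module.finrank k (Submodule.span k {y.rep, z}) ≤ Fintype.card (Fin 2) := by
    have h := finrank_span_finset_le_card (R := k) ({y.rep, z} : Finset W)
    rw [Finset.coe_pair] at h
    exact h.trans Finset.card_le_two
  obtain ⟨γ, hγ⟩ := exists_sum_eq_of_linearIndependent hli hmem hcard
    (Submodule.subset_span (Set.mem_insert y.rep {z}))
  have hγ0 : γ ≠ 0 := by
    rintro rfl
    exact y.rep_nonzero (by rw [← hγ]; simp)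
  refine ⟨mk k γ hγ0, (isComb_iff ht x.rep_nonzero (rep_mem_submodule x) hγ0
    (mk_mem_submodule hγ0)).2 ?_⟩
  rw [hγ]
  exact rep_mem_submodule y

theorem IsComb.mem_bivectorSupport {ι : Type} [Fintype ι] {t : ι → ⋀[k]^2 W → W}
    (hts : ∀ i p, t i p ∈ bivectorSupport p) {x : ℙ k (⋀[k]^2 W)} {c : ℙ k (ι → k)} {y : ℙ k W}
    (hli : LinearIndependent k fun i => t i x.rep) (h : IsComb t x c y) :
    y.rep ∈ bivectorSupport x.rep := by
  obtain ⟨r, -, hr⟩ := exists_rep_eq_smul (sum_smul_ne_zero hli c.rep_nonzero) h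
  rw [hr]
  exact Submodule.smul_mem _ _ (Submodule.sum_mem _ fun j _ => Submodule.smul_mem _ _ (hts j _))

end Incidence

/-! ### Equivariant families of lines and points -/

section Families

variable {k : Type u} [Field k] {G : Type w} [Group G] [Finite G] {W : Type v} [AddCommGroup W]
  [Module k W] (ρ : Representation k G W)

/-- At the free point `y` the kernel has minimal dimension, so a basis of it modulo `y` extends to
polynomial sections. Averaging makes them equivariant, keeps them in the kernels, which are permuted
by the group, and does not change their values at `y`. -/
theorem exists_equivariant_lines [FiniteDimensional k W] (V : Subrepresentation (exteriorSquare ρ)) {y : ℙ k W}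
    (hy : ∀ g : G, g ≠ 1 → actProj ρ g y ≠ y) {m : ℕ}
    (hm : Module.finrank k (wedgeMod V.toSubmodule y.rep).ker = m + 2)
    (hmin : ∀ w, m + 2 ≤ Module.finrank k (wedgeMod V.toSubmodule w).ker) :
    ∃ (d : ℕ) (s : Fin (m + 1) → W → W), (∀ j, IsFormMap k d (s j)) ∧
      (∀ j g w, s j (ρ g w) = ρ g (s j w)) ∧
      (∀ j w, s j w ∈ (wedgeMod V.toSubmodule w).ker) ∧
      LinearIndependent k fun j => wedge (k := k) y.rep (s j y.rep) := by
  have := Fintype.ofFinite G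
  obtain ⟨x, hxK, hxli⟩ := exists_linearIndependent_wedge y.rep_nonzero
    (self_mem_ker_wedgeMod V.toSubmodule y.rep) hm
  obtain ⟨d, hd⟩ := exists_formMap_ker (wedgeMod V.toSubmodule) y.rep fun w => hm ▸ hmin w
  choose σ hσ hσK hσy using fun j => hd (x j) (hxK j)
  obtain ⟨e, f, hf, hf1, hf0⟩ := exists_form_orbit ρ fun g hg =>
    rep_notMem_span_of_actProj_ne (hy g hg)
  refine ⟨e + d, fun j => average ρ ρ f (σ j), fun j => isFormMap_average hf (hσ j),
    fun j => average_equivariant, fun j w => ?_, ?_⟩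
  · exact average_mem (K := fun w => (wedgeMod V.toSubmodule w).ker)
      (fun g w x hx => wedgeMod_equivariant V g w x hx) fun g => hσK j _
  · simpa only [average_eq hf1 hf0, hσy] using hxli

theorem exists_equivariant_points {x : ℙ k (⋀[k]^2 W)} (hx : x ∈ grassmannian k W)
    (hfree : ∀ g : G, g ≠ 1 → actProj (exteriorSquare ρ) g x ≠ x) :
    ∃ (d : ℕ) (t : Fin 2 → ⋀[k]^2 W → W), (∀ i, IsFormMap k d (t i)) ∧
      (∀ i g p, t i (exteriorSquare ρ g p) = ρ g (t i p)) ∧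
      (∀ i p, t i p ∈ bivectorSupport p) ∧ LinearIndependent k fun i => t i x.rep := by
  have := Fintype.ofFinite G
  obtain ⟨a, b, hab⟩ := exists_rep_eq_wedge hx
  have hli : LinearIndependent k ![a, b] := wedge_ne_zero_iff.1 (hab ▸ x.rep_nonzero)
  obtain ⟨ψ, hψ⟩ := exists_dual_family hli
  -- The order of the two dual coordinates is reversed so that contraction of `a ∧ b` gives `-a` and
  -- `b` in this order.
  let ξ : Fin 2 → Module.Dual k W := ![LinearMap.proj 1 ∘ₗ ψ, LinearMap.proj 0 ∘ₗ ψ]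
  obtain ⟨e, f, hf, hf1, hf0⟩ := exists_form_orbit (exteriorSquare ρ) fun g hg =>
    rep_notMem_span_of_actProj_ne (hfree g hg)
  have ha : ψ a = Pi.single 0 1 := hψ 0
  have hb : ψ b = Pi.single 1 1 := hψ 1
  refine ⟨e + 1, fun i => average (exteriorSquare ρ) ρ f (contraction (ξ i)), fun i =>
    isFormMap_average hf (isFormMap_linear _), fun i => average_equivariant, fun i p => ?_, ?_⟩
  · exact average_mem (K := bivectorSupport) (bivectorSupport_equivariant ρ) fun g =>
      Submodule.subset_span ⟨ξ i, rfl⟩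
  · simp only [average_eq hf1 hf0]
    rw [hab]
    have h : (fun i => contraction (ξ i) (wedge (k := k) a b)) =
        ![(-1 : kˣ), 1] • ![a, b] := by
      ext i
      fin_cases i <;> simp [ξ, contraction_wedge, ha, hb]
    rw [h]
    exact hli.units_smul _

end Families

/-! ### Lines through a generic point, and lines that meet an open set on a hyperplane -/

section Main

variable {k : Type u} [Field k] {W : Type v} [AddCommGroup W] [Module k W]

/-- If a linear section of the Grassmannian has the expected dimension, then so has the space of its
lines through some point. -/
theorem exists_finrank_ker_wedgeMod_le [FiniteDimensional k W] [Infinite k] [Nontrivial W]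
    {V : Submodule k (⋀[k]^2 W)}
    (hV : Module.finrank k (⋀[k]^2 W ⧸ V) + 2 ≤ Module.finrank k W)
    (hdim : topologicalKrullDim ↥(grassmannian k W ∩ projSubspace V) =
      ((2 * (Module.finrank k W - 2) - Module.finrank k (⋀[k]^2 W ⧸ V) : ℕ) : WithBot ℕ∞)) :
    ∃ y : ℙ k W, Module.finrank k (wedgeMod V y.rep).ker + Module.finrank k (⋀[k]^2 W ⧸ V) ≤
      Module.finrank k W := by
  have : Nonempty (ℙ k W) := by
    obtain ⟨w, hw⟩ := exists_ne (0 : W)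
    exact ⟨mk k w hw⟩
  let F : ℙ k W → ℕ := fun y => Module.finrank k (wedgeMod V y.rep).ker
  let y : ℙ k W := Function.argmin F
  have hy : ∀ z, F y ≤ F z := fun z => Function.argmin_le F z
  have hmin : ∀ w, Module.finrank k (wedgeMod V y.rep).ker ≤
      Module.finrank k (wedgeMod V w).ker := by
    intro w
    by_cases hw : w = 0
    · rw [hw, map_zero, LinearMap.ker_zero, finrank_top]
      exact Submodule.finrank_le _
    · obtain ⟨c, hc, h⟩ := exists_rep_eq_smul hw (mk_mem_submodule (k := k) hw)
      have := hy (mk k w hw)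
      simp only [F] at this
      rwa [h, ker_wedgeMod_smul V hc] at this
  have h1 := finrank_le_finrank_ker_wedgeMod V y.rep
  obtain ⟨m, hm⟩ : ∃ m, Module.finrank k (wedgeMod V y.rep).ker = m + 2 :=
    ⟨Module.finrank k (wedgeMod V y.rep).ker - 2, by omega⟩
  -- With `m + 2` the minimal dimension of a kernel, comparison with the expected dimension gives `m
  -- + (n - 2) ≤ 2 (n - 2) - r`, that is, `m + 2 + r ≤ n`.
  have h2 := le_topologicalKrullDim_grassmannianSection V y.rep_nonzero hmin hm
  rw [hdim] at h2
  have h3 : m + (Module.finrank k W - 2) ≤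
      2 * (Module.finrank k W - 2) - Module.finrank k (⋀[k]^2 W ⧸ V) := by exact_mod_cast h2
  exact ⟨y, by omega⟩

/-- The lines of `S` that meet the hyperplane `ξ = 0` in a single point, which lies in a given open set,
form an open subset. -/
theorem isOpen_setOf_line_meets {S : Set (ℙ k (⋀[k]^2 W))} {O : Set (ℙ k W)} (hO : IsOpen O)
    (ξ : Module.Dual k W) :
    IsOpen {x : S | ∃ y ∈ O, contraction ξ x.1.rep ≠ 0 ∧ contraction ξ x.1.rep ∈ y.submodule} := by
  -- A family with one member and the constant coefficient `1 ∈ ℙ⁰` reduces the claim to openness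
  -- for combinations. The contraction by `ξ` of the bivector of a line is its intersection with `ξ
  -- = 0`.
  have h1 : (fun _ : Fin 1 => (1 : k)) ≠ 0 := one_ne_zero
  have h := isOpen_isComb (Z := (projSpace k (⋀[k]^2 W)).restrict S) (d := 1)
    (b := fun _ : Fin 1 => contraction ξ) (fun _ => isFormMap_linear _)
    (isMorphism_restrict_val (projSpace k (⋀[k]^2 W)) S) (isMorphism_const _ (projSpace k (Fin 1 → k)) (mk k _ h1)) hO
  refine (congrArg IsOpen (Set.ext fun x => ?_)).mpr h
  have hli : LinearIndependent k (fun _ : Fin 1 => contraction ξ x.1.rep) ↔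
      contraction ξ x.1.rep ≠ 0 := linearIndependent_unique_iff
  have hc : ∀ y : ℙ k W, IsComb (fun _ : Fin 1 => contraction ξ) x.1 (mk k _ h1) y ↔
      contraction ξ x.1.rep ∈ y.submodule := fun y => by
    rw [isComb_iff (d := 1) (fun _ => isFormMap_linear _) x.1.rep_nonzero (rep_mem_submodule _) h1
      (mk_mem_submodule h1)]
    simp
  constructor
  · rintro ⟨y, hy, h2, h3⟩
    exact ⟨hli.2 h2, y, hy, (hc y).2 h3⟩
  · rintro ⟨h2, y, hy, h3⟩
    exact ⟨y, hy, hli.1 h2, (hc y).1 h3⟩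

end Main

/-! ### The main theorem -/

theorem mainTheorem3 {k : Type u} [Field k] [IsAlgClosed k] [CharZero k]
    {G : Type w} [Group G] [Finite G]
    {W : Type v} [AddCommGroup W] [Module k W] [FiniteDimensional k W]
    (ρ : Representation k G W) (V : Subrepresentation (exteriorSquare ρ)) (n r : ℕ)
    (hn : Module.finrank k W = n)
    (hr : Module.finrank k (↥(⋀[k]^2 W) ⧸ V.toSubmodule) = r)
    (hrn : r + 2 ≤ n)
    (hW : (projRep ρ).GenericallyFree)
    (hV : (projRep (A := V.toSubmodule) V.toRepresentation).GenericallyFree)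
    (hirr : IrreducibleSpace (grassmannianSection ρ V).carrier)
    (hdim : topologicalKrullDim (grassmannianSection ρ V).carrier =
      ((2 * (n - 2) - r : ℕ) : WithBot ℕ∞)) :
    GSpace.EquivariantlyBirational
      ((grassmannianSection ρ V).prod (projTrivial k G 1))
      ((projRep ρ).prod (projTrivial k G (n - 2 - r))) := by
  have hinf : Infinite k := inferInstance
  have hnt : Nontrivial W := Module.nontrivial_of_finrank_pos (R := k) (by omega)
  subst hn hr
  set n := Module.finrank k W
  set r := Module.finrank k (↥(⋀[k]^2 W) ⧸ V.toSubmodule)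
  let S : Set (ℙ k (⋀[k]^2 W)) := grassmannian k W ∩ projSubspace V.toSubmodule
  let O₁ : Set (ℙ k W) := {y | Module.finrank k (wedgeMod V.toSubmodule y.rep).ker + r ≤ n}
  have hO₁ : IsOpen O₁ := isOpen_finrank_ker_wedgeMod_le V.toSubmodule
  have hge := finrank_le_finrank_ker_wedgeMod V.toSubmodule
  obtain ⟨y₀, hy₀, hfree⟩ : ∃ y ∈ O₁, ∀ g : G, g ≠ 1 → actProj ρ g y ≠ y := by
    obtain ⟨U, -, hU, hfree⟩ := hW
    obtain ⟨y, hy, hyU⟩ := hU.inter_open_nonempty O₁ hO₁ (exists_finrank_ker_wedgeMod_le hrn hdim)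
    exact ⟨y, hy, fun g hg h => hg (hfree y hyU g h)⟩
  obtain ⟨x₀, hx₀, hfree'⟩ := exists_free_point ρ V hrn hW hV hirr
  -- At `y₀` the kernel has the minimal dimension `n - r = (n - 2 - r) + 2`; one dimension is lost
  -- to `y₀` itself, leaving `n - 1 - r` generating lines.
  obtain ⟨d, s, hs, hseq, hsV, hsli⟩ := exists_equivariant_lines ρ V hfree (m := n - 2 - r)
    (by have h1 := hge y₀.rep; simp only [O₁, Set.mem_ofPred_eq] at hy₀; omega)
    (fun w => by have h1 := hge w; omega)
  obtain ⟨d', t, ht, hteq, hts, htli⟩ := exists_equivariant_points ρ hx₀.1 hfree'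
  have hsw : ∀ j, IsFormMap k (1 + d) fun w => wedge (k := k) w (s j w) := fun j =>
    IsFormMap.bilinear wedge (hs j)
  have hsweq : ∀ j g w, wedge (k := k) (ρ g w) (s j (ρ g w)) =
      exteriorSquare ρ g (wedge w (s j w)) := fun j g w => by rw [hseq, exteriorSquare_wedge]
  let O : Set (ℙ k W) := {y | LinearIndependent k fun j => wedge (k := k) y.rep (s j y.rep)} ∩ O₁
  have hO : IsOpen O := (isOpen_linearIndependent hsw).inter hO₁
  have hOG : ∀ (g : G), ∀ y ∈ O, actProj ρ g y ∈ O := by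
    rintro g y ⟨h1, h2⟩
    refine ⟨linearIndependent_rep_smul hsw hsweq g h1, le_trans (Nat.add_le_add_right ?_ r) h2⟩
    obtain ⟨c, hc, h⟩ := exists_rep_eq_smul (rho_rep_ne_zero ρ g y) (smul_rep_mem_submodule ρ g y)
    rw [h, ker_wedgeMod_smul _ hc]
    exact finrank_ker_wedgeMod_le V g y.rep
  -- For `y` in `O` the equivariant lines through `y` span all the lines of the section through `y`.
  have key : ∀ y ∈ O, ∀ x ∈ S, y.rep ∈ bivectorSupport x.rep →
      ∃ c, IsComb (fun j w => wedge (k := k) w (s j w)) y c x := by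
    rintro y ⟨h1, h2⟩ x hx hyx
    obtain ⟨a, b, hab⟩ := exists_rep_eq_wedge hx.1
    refine exists_isComb_wedge hsw hsV (by simp only [O₁, Set.mem_ofPred_eq] at h2; omega) h1 hx.2
      (hab ▸ rep_mem_submodule x) (hab ▸ x.rep_nonzero) (bivectorSupport_wedge_le a b ?_)
    rwa [← hab]
  refine equivariantlyBirational_of_isComb (m := 1) (m' := n - 2 - r) ht hteq hsw hsweq S
    (grassmannian_section_stable ρ V) hirr O hO hOG (fun y hy => hy.1) ?_ ?_ ?_ ?_
  · intro x hx c y hy hli h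
    exact key y hy x hx (h.mem_bivectorSupport hts hli)
  · intro y hy c x h
    obtain ⟨z, hz, hxz⟩ := h.exists_wedge hsV hy.1
    have hmem : wedge y.rep z ∈ x.submodule := hxz ▸ rep_mem_submodule x
    refine ⟨mem_grassmannian_iff.2 ⟨y.rep, z, hxz ▸ x.rep_nonzero, hmem⟩, ?_⟩
    change x.submodule ≤ V.toSubmodule
    rw [submodule_eq, Submodule.span_singleton_le_iff_mem, hxz]
    exact mem_ker_wedgeMod.1 hz
  · intro y hy c x h hli
    obtain ⟨z, -, hxz⟩ := h.exists_wedge hsV hy.1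
    exact exists_isComb_support ht hts hli hxz
  · have h0 : wedge (k := k) y₀.rep (s 0 y₀.rep) ≠ 0 := hsli.ne_zero 0
    let x₁ : ℙ k (⋀[k]^2 W) := Projectivization.mk k _ h0
    have hx₁ : x₁ ∈ S := by
      refine ⟨mem_grassmannian_iff.2 ⟨_, _, h0, mk_mem_submodule h0⟩, ?_⟩
      change x₁.submodule ≤ V.toSubmodule
      rw [submodule_mk, Submodule.span_singleton_le_iff_mem]
      exact mem_ker_wedgeMod.1 (hsV 0 _)
    -- A pair `(y, x)` is needed with `y ∈ O` and `x` a line of `X` through `y` on which the two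
    -- equivariant points are independent. The hyperplane `ξ = 0` meets the line `x₁` exactly in `y₀
    -- ∈ O`. Meeting `ξ = 0` in a single point of `O` is an open condition on lines, satisfied by
    -- `x₁`; independence is another, satisfied by `x₀`. Irreducibility of `X` gives a line with
    -- both.
    obtain ⟨ψ, hψ⟩ := exists_dual_family (wedge_ne_zero_iff.1 h0)
    let ξ : Module.Dual k W := LinearMap.proj 1 ∘ₗ ψ
    have hξ₀ : ξ y₀.rep = 0 := by
      have h : ψ y₀.rep = Pi.single 0 1 := hψ 0
      simp [ξ, h]
    have hξ₁ : ξ (s 0 y₀.rep) = 1 := by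
      have h : ψ (s 0 y₀.rep) = Pi.single 1 1 := hψ 1
      simp [ξ, h]
    obtain ⟨c, hc, hx₁rep⟩ := exists_rep_eq_smul h0 (mk_mem_submodule (k := k) h0)
    have hcon : contraction ξ x₁.rep = -c • y₀.rep := by
      rw [hx₁rep, map_smul, contraction_wedge, hξ₀, hξ₁]
      module
    have hir : IsPreirreducible (Set.univ : Set S) := hirr.isPreirreducible_univ
    obtain ⟨x, -, ⟨y, hy, hxy, hxy'⟩, hxli⟩ := hir _
      {x : S | LinearIndependent k fun i => t i x.1.rep} (isOpen_setOf_line_meets hO ξ)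
      ((isOpen_linearIndependent ht).preimage continuous_subtype_val)
      ⟨⟨x₁, hx₁⟩, trivial, y₀, ⟨hsli, hy₀⟩, by
        rw [hcon]; exact smul_ne_zero (neg_ne_zero.2 hc) y₀.rep_nonzero, by
        rw [hcon]; exact Submodule.smul_mem _ _ (rep_mem_submodule y₀)⟩
      ⟨⟨x₀, hx₀⟩, trivial, htli⟩
    obtain ⟨e, -, he⟩ := exists_rep_eq_smul hxy hxy'
    obtain ⟨c', hc'⟩ := key y hy x.1 x.2
      (he ▸ Submodule.smul_mem _ _ (Submodule.subset_span ⟨ξ, rfl⟩))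
    exact ⟨y, hy, c', x.1, hc', hxli⟩
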